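/- Let $C$ be a smooth, projective, geometrically connected curve over a finite field $\mathbb F_q$, $\mathbb K=\mathbb F_q(C)$ its function field, $\infty\in C$ a closed point, and ${\bf A}\subset\mathbb K$ the ring of functions regular outside $\infty$ (a Dedekind domain with fraction field $\mathbb K$). Let $\mathbb K_\infty$ be the completion of $\mathbb K$ at $\infty$, ${\bf C}_\infty$ the completion of an algebraic closure of $\mathbb K_\infty$, $\mathbb A_{\mathbb K,f}=\prod'_{v\ne\infty}\mathbb K_v$ the ring of finite adeles and $R=\prod_{v\neq\infty}{\bf A}_v$. Let $n\ge 0$; elements of $\mathbb K^n$ and $\mathbb A_{\mathbb K,f}^n$ are row vectors. Let $\tilde\Omega^n$ be the set of $\mathbb K_\infty$-linearly independent tuples $\omega\in{\bf C}_\infty^n$, let $\Omega^n=\tilde\Omega^n/{\bf C}_\infty^*$, on which $\mathrm{GL}_n(\mathbb K)$ acts from the left (tuples being regarded as columns), and put $\iota_\omega(x)=\sum_i x_i\omega_i$. An $n$-dimensional $\mathbb K$-rational lattice is a pair $(\Lambda,\phi)$ of a finitely generated ${\bf A}$-submodule $\Lambda\subset\mathbb K^n$ spanning $\mathbb K^n$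 over $\mathbb K$ and an ${\bf A}$-linear map $\phi:(\mathbb K/{\bf A})^n\to\mathbb K\Lambda/\Lambda$. Two of them are isomorphic if some $\gamma\in\mathrm{GL}_n(\mathbb K)$ carries one to the other: $\Lambda'=\Lambda\gamma$ and $\phi'=\gamma\circ\phi$, where $\gamma$ acts by right multiplication. They are commensurable if there is $\gamma\in \mathrm{GL}_n(\mathbb K)$ with $\mathbb K\Lambda'=\mathbb K\Lambda\gamma$ (automatic here) and $\phi'=\gamma\circ\phi$ modulo $\Lambda\gamma+\Lambda'$. An $n$-dimensional $\mathbb K$-rational ${\bf C}_\infty$-lattice is a pair $(\Lambda,\phi)$ of a finitely generated discrete ${\bf A}$-submodule $\Lambda\subset{\bf C}_\infty$ with $\dim_{\mathbb K_\infty}\mathbb K_\infty\Lambda=n$ and an ${\bf A}$-linear map $\phi:(\mathbb K/{\bf A})^n\to\mathbb K\Lambda/\Lambda$; isomorphism means $\Lambda'=\lambda\Lambda$, $\phi'=\lambda\phi$ for some $\lambda\in{\bf C}_\infty^*$, and commensurability means that for some $\lambda\in{\bf C}_\infty^*$ one has $\mathbb K\Lambda'=\lambda\mathbb K\Lambda$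 and $\phi'=\lambda\phi$ modulo $\lambda\Lambda+\Lambda'$. Let $\mathcal K_{\mathbb K,n}$, $\mathcal K_{\mathbb K,n}^{{\bf C}_\infty}$ be the sets of isomorphism classes. **Theorem.** (1) Commensurability is an equivalence relation on $\mathcal K_{\mathbb K,n}$; let $\mathcal L_{\mathbb K,n}$ be the quotient. Let $\mathrm{GL}_n(\mathbb K)\backslash\mathrm{GL}_n(\mathbb A_{\mathbb K,f})\times_{\mathrm{GL}_n(R)}M_n(R)$ be the quotient of $\mathrm{GL}_n(\mathbb A_{\mathbb K,f})\times M_n(R)$ by $(g,\rho)\sim(\gamma gm,\rho m)$ for $\gamma\in \mathrm{GL}_n(\mathbb K)$, $m\in\mathrm{GL}_n(R)$. Then $(g,\rho)\mapsto(R^ng^{-1}\cap\mathbb K^n,\ \rho g^{-1})$ is a well-defined bijection of it onto $\mathcal K_{\mathbb K,n}$; here $\rho g^{-1}$ stands for the map $\phi$ induced by right multiplication by $\rho g^{-1}$ from $(\mathbb K/{\bf A})^n=(\mathbb A_{\mathbb K,f}/R)^n$ to $\mathbb A_{\mathbb K,f}^n/R^ng^{-1}=\mathbb K^n/(R^ng^{-1}\cap\mathbb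 K^n)$. Via this bijection the map $$\Theta:\ (g,\rho)\mapsto\rho g^{-1}$$ to $\mathrm{GL}_n(\mathbb K)\backslash M_n(\mathbb A_{\mathbb K,f})$, where $\gamma\in\mathrm{GL}_n(\mathbb K)$ acts by $u\mapsto u\gamma^{-1}$, induces a bijection $\mathcal L_{\mathbb K,n}\simeq\mathrm{GL}_n(\mathbb K)\backslash M_n(\mathbb A_{\mathbb K,f})$. (2) Commensurability is an equivalence relation on $\mathcal K_{\mathbb K,n}^{{\bf C}_\infty}$; let $\mathcal L_{\mathbb K,n}^{{\bf C}_\infty}$ be the quotient. Let $\mathrm{GL}_n(\mathbb K)\backslash\mathrm{GL}_n(\mathbb A_{\mathbb K,f})\times\Omega^n\times_{\mathrm{GL}_n(R)}M_n(R)$ be the quotient by $(g,z,\rho)\sim(\gamma gm,\gamma z,\rho m)$ for $\gamma\in \mathrm{GL}_n(\mathbb K)$, $m\in\mathrm{GL}_n(R)$. Then $(g,[\omega],\rho)\mapsto(\iota_\omega(R^ng^{-1}\cap\mathbb K^n),\ \iota_\omega(\rho g^{-1}))$ is a well-defined bijection of it onto $\mathcal K_{\mathbb K,n}^{{\bf C}_\infty}$,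 and via this bijection the map $$\Upsilon:\ (g,z,\rho)\mapsto(\rho g^{-1},z)$$ induces a bijection $\mathcal L_{\mathbb K,n}^{{\bf C}_\infty}\simeq\mathrm{GL}_n(\mathbb K)\backslash\big(M_n(\mathbb A_{\mathbb K,f})\times\Omega^n\big)$, where $\gamma\in\mathrm{GL}_n(\mathbb K)$ acts by $(u,z)\mapsto(u\gamma^{-1},\gamma z)$. -/

import Mathlib

open scoped MatrixGroups NNReal

noncomputable section

namespace RatLat

/-! ### The function field and its completion at infinity -/

/-- `K` is the function field of a smooth projective geometrically connected curve over `Fq`: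
a function field in one variable over `Fq` whose field of constants is `Fq`. -/
structure IsFunctionField (Fq K : Type*) [Field Fq] [Field K] [Algebra Fq K] : Prop where
  exists_finite : ∃ T : K, Transcendental Fq T ∧
    FiniteDimensional (IntermediateField.adjoin Fq ({T} : Set K)) K
  constants : ∀ x : K, IsAlgebraic Fq x → x ∈ (algebraMap Fq K).range

section Infinity

/- A closed point of the curve is a discrete valuation ring of the function field;
the point at infinity is `pl`. -/
variable (K : Type*) [Field K] (pl : ValuationSubring K) [IsDiscreteValuationRing pl]

/-- The completion of `K` at the place `pl`. -/
abbrev Kinf : Type _ := (IsDiscreteValuationRing.maximalIdeal pl).adicCompletion K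

/-- The cardinality of the residue field of `pl` (which is finite, hence at least two, when `K` is
a global function field); the base of the normalized absolute value. -/
def absBase : ℝ≥0 := max 2 (Nat.card (IsLocalRing.ResidueField pl) : ℝ≥0)

lemma one_lt_absBase : 1 < absBase K pl := lt_max_of_lt_left one_lt_two

instance : (Valued.v : Valuation (Kinf K pl) (WithZero (Multiplicative ℤ))).RankOne :=
  Valuation.IsRankOneDiscrete.rankOne _ (one_lt_absBase K pl)

/-- The normalized absolute value on the completion. -/
instance : NormedField (Kinf K pl) :=
  Valued.toNormedField (Kinf K pl) (WithZero (Multiplicative ℤ))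

instance : NontriviallyNormedField (Kinf K pl) where
  non_trivial := by
    obtain ⟨x, hx⟩ := IsDedekindDomain.HeightOneSpectrum.valuedAdicCompletion_surjective K
      (IsDiscreteValuationRing.maximalIdeal pl) (WithZero.exp (1 : ℤ))
    refine ⟨x, ?_⟩
    rw [Valued.toNormedField.one_lt_norm_iff, hx, ← WithZero.exp_zero]
    exact WithZero.exp_lt_exp.2 one_pos

instance : IsUltrametricDist (Kinf K pl) :=
  inferInstanceAs (@IsUltrametricDist (Kinf K pl)
    (Valued.toNormedField (Kinf K pl) (WithZero (Multiplicative ℤ))).toDist)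

/-- A fixed algebraic closure of `Kinf`, with the unique extension of the absolute value. -/
abbrev KinfBar : Type _ := AlgebraicClosure (Kinf K pl)

instance : NormedField (KinfBar K pl) := spectralNorm.normedField (Kinf K pl) (KinfBar K pl)

instance : NormedAlgebra (Kinf K pl) (KinfBar K pl) :=
  spectralNorm.normedAlgebra (Kinf K pl) (KinfBar K pl)

/-- The field `C_∞`: the completion of the algebraic closure of `Kinf`. -/
def Cinf : Type _ := UniformSpace.Completion (KinfBar K pl)

instance : NormedField (Cinf K pl) :=
  inferInstanceAs (NormedField (UniformSpace.Completion (KinfBar K pl)))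

instance : CompleteSpace (Cinf K pl) :=
  inferInstanceAs (CompleteSpace (UniformSpace.Completion (KinfBar K pl)))

instance : NormedAlgebra (KinfBar K pl) (Cinf K pl) :=
  inferInstanceAs (NormedAlgebra (KinfBar K pl) (UniformSpace.Completion (KinfBar K pl)))

/-- `C_∞` as a `Kinf`-algebra, through the algebraic closure. -/
instance : Algebra (Kinf K pl) (Cinf K pl) :=
  ((algebraMap (KinfBar K pl) (Cinf K pl)).comp
    (algebraMap (Kinf K pl) (KinfBar K pl))).toAlgebra

instance : IsScalarTower (Kinf K pl) (KinfBar K pl) (Cinf K pl) :=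
  IsScalarTower.of_algebraMap_eq' rfl

/-- `C_∞` as an algebra over `K`, and over every ring mapping to `K`. -/
instance {S : Type*} [CommRing S] [Algebra S K] : Algebra S (Cinf K pl) :=
  (((algebraMap (Kinf K pl) (Cinf K pl)).comp (algebraMap K (Kinf K pl))).comp
    (algebraMap S K)).toAlgebra

instance {S : Type*} [CommRing S] [Algebra S K] : IsScalarTower S K (Cinf K pl) :=
  IsScalarTower.of_algebraMap_eq' rfl

instance : IsScalarTower K (Kinf K pl) (Cinf K pl) :=
  IsScalarTower.of_algebraMap_eq' rfl

end Infinity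

/-! ### Lattices with labelled torsion points -/

section Lattices

variable (A K : Type*) [CommRing A] [Field K] [Algebra A K]

/-- The `A`-module `(K/A)^n`. -/
abbrev TorsionPts (n : ℕ) : Type _ := Fin n → K ⧸ LinearMap.range (Algebra.linearMap A K)

variable {A}
variable {V W : Type*} [AddCommGroup V] [Module A V] [Module K V] [IsScalarTower A K V]
  [AddCommGroup W] [Module A W] [Module K W] [IsScalarTower A K W]

/-- The `A`-module `KΛ/Λ`, as a submodule of `V/Λ`. -/
def spanQuot (Λ : Submodule A V) : Submodule A (V ⧸ Λ) :=
  ((Submodule.span K (Λ : Set V)).restrictScalars A).map Λ.mkQ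

variable (A V)

/-- A pair `(Λ, φ)` of an `A`-submodule `Λ` of the `K`-vector space `V` and an `A`-linear map
`φ : (K/A)^n → KΛ/Λ`. -/
structure LabelledModule (n : ℕ) where
  lat : Submodule A V
  hom : TorsionPts A K n →ₗ[A] spanQuot K lat

variable {A K V} {n : ℕ}

/-- `φ(t)` is the class of the vector `v` modulo `Λ`. -/
def LabelledModule.Maps (L : LabelledModule A K V n) (t : TorsionPts A K n) (v : V) : Prop :=
  (L.hom t : V ⧸ L.lat) = Submodule.Quotient.mk v

/-- The `K`-linear map `f` carries `(Λ, φ)` to `(Λ', φ')`: `Λ' = f(Λ)` and `φ' = f ∘ φ`. -/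
def Carries (f : V →ₗ[K] W) (L : LabelledModule A K V n) (L' : LabelledModule A K W n) : Prop :=
  L'.lat = L.lat.map (f.restrictScalars A) ∧ ∀ t v, L.Maps t v → L'.Maps t (f v)

/-- Commensurability of `f(Λ, φ)` and `(Λ', φ')`: the modules `f(Λ)` and `Λ'` span the same
`K`-vector space, and `f ∘ φ = φ'` modulo `f(Λ) + Λ'`. -/
def CommVia (f : V →ₗ[K] W) (L : LabelledModule A K V n) (L' : LabelledModule A K W n) : Prop :=
  Submodule.span K (L.lat.map (f.restrictScalars A) : Set W) =
      Submodule.span K (L'.lat : Set W) ∧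
    ∀ t v v', L.Maps t v → L'.Maps t v' → f v - v' ∈ L.lat.map (f.restrictScalars A) ⊔ L'.lat

lemma LabelledModule.exists_maps (L : LabelledModule A K V n) (t : TorsionPts A K n) :
    ∃ v, L.Maps t v :=
  (Submodule.Quotient.mk_surjective L.lat (L.hom t : V ⧸ L.lat)).imp fun _ h => h.symm

lemma Carries.refl (L : LabelledModule A K V n) : Carries LinearMap.id L L :=
  ⟨by ext; simp, fun _ _ h => h⟩

lemma Carries.trans {U : Type*} [AddCommGroup U] [Module A U] [Module K U] [IsScalarTower A K U]
    {f : V →ₗ[K] W} {g : W →ₗ[K] U} {L : LabelledModule A K V n} {L' : LabelledModule A K W n}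
    {L'' : LabelledModule A K U n} (h : Carries f L L') (h' : Carries g L' L'') :
    Carries (g ∘ₗ f) L L'' := by
  refine ⟨?_, fun t v hv => h'.2 t _ (h.2 t v hv)⟩
  rw [h'.1, h.1, ← Submodule.map_comp]
  rfl

lemma Carries.symm {f : V →ₗ[K] W} {g : W →ₗ[K] V} (hgf : ∀ v, g (f v) = v)
    {L : LabelledModule A K V n} {L' : LabelledModule A K W n} (h : Carries f L L') :
    Carries g L' L := by
  refine ⟨?_, fun t w hw => ?_⟩
  · rw [h.1]
    ext v
    simp [hgf]
  · obtain ⟨v, hv⟩ := L.exists_maps t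
    have h2 : Submodule.Quotient.mk w = Submodule.Quotient.mk (f v) := hw.symm.trans (h.2 t v hv)
    rw [Submodule.Quotient.eq, h.1] at h2
    obtain ⟨l, hl, hl'⟩ := h2
    have : g w - v = l := by
      have := congrArg g hl'
      simpa [hgf] using this.symm
    rw [LabelledModule.Maps, hv, eq_comm, Submodule.Quotient.eq, this]
    exact hl

end Lattices

/-! ### `K`-rational lattices and commensurability -/

section Rational

variable (A K : Type*) [CommRing A] [Field K] [Algebra A K] (n : ℕ)

/-- An `n`-dimensional `K`-rational lattice: a finitely generated `A`-submodule of `K^n` of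
rank `n`, with a homomorphism `(K/A)^n → KΛ/Λ`. -/
def RationalLattice : Type _ :=
  {L : LabelledModule A K (Fin n → K) n // Submodule.IsLattice K L.lat}

/-- The matrix `γ` acts on row vectors from the right. -/
abbrev rowMul {K : Type*} [Field K] {n : ℕ} (γ : GL (Fin n) K) : (Fin n → K) →ₗ[K] (Fin n → K) :=
  Matrix.vecMulLinear (γ : Matrix (Fin n) (Fin n) K)

/-- Isomorphism of `K`-rational lattices. -/
instance rationalIso : Setoid (RationalLattice A K n) where
  r L L' := ∃ γ : GL (Fin n) K, Carries (rowMul γ) L.1 L'.1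
  iseqv :=
    { refl := fun L => ⟨1, by
        have : rowMul (1 : GL (Fin n) K) = LinearMap.id := by ext; simp
        rw [this]
        exact Carries.refl _⟩
      symm := fun ⟨γ, h⟩ => ⟨γ⁻¹, h.symm fun v => by
        simp [Matrix.vecMul_vecMul, ← Units.val_mul,
          -Matrix.coe_units_inv]⟩
      trans := fun ⟨γ, h⟩ ⟨γ', h'⟩ => ⟨γ * γ', by
        have : rowMul (γ * γ') = rowMul γ' ∘ₗ rowMul γ := by
          refine LinearMap.ext fun v => ?_
          simp [Matrix.vecMul_vecMul]
        rw [this]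
        exact h.trans h'⟩ }

/-- The set of isomorphism classes of `n`-dimensional `K`-rational lattices. -/
abbrev RationalClass : Type _ := Quotient (rationalIso A K n)

variable {A K n} in
/-- Commensurability of isomorphism classes of `K`-rational lattices. -/
def RationalComm (a b : RationalClass A K n) : Prop :=
  ∃ (L L' : RationalLattice A K n) (γ : GL (Fin n) K),
    ⟦L⟧ = a ∧ ⟦L'⟧ = b ∧ CommVia (rowMul γ) L.1 L'.1

/-- The set of commensurability classes of `n`-dimensional `K`-rational lattices. -/
abbrev RationalCommClass : Type _ := Quot (RationalComm (A := A) (K := K) (n := n))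

variable (pl : ValuationSubring K) [IsDiscreteValuationRing pl]

/-- An `n`-dimensional `K`-rational `C_∞`-lattice: a finitely generated discrete `A`-submodule `Λ`
of `C_∞` whose `Kinf`-span has dimension `n`, with a homomorphism `(K/A)^n → KΛ/Λ`. -/
def CLattice : Type _ :=
  {L : LabelledModule A K (Cinf K pl) n // L.lat.FG ∧ DiscreteTopology L.lat ∧
    Module.finrank (Kinf K pl) (Submodule.span (Kinf K pl) (L.lat : Set (Cinf K pl))) = n}

variable {K} in
/-- Multiplication by a nonzero scalar of `C_∞`. -/
abbrev scale (c : (Cinf K pl)ˣ) : Cinf K pl →ₗ[K] Cinf K pl :=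
  LinearMap.mulLeft K (c : Cinf K pl)

/-- Isomorphism (scaling) of `K`-rational `C_∞`-lattices. -/
instance cIso : Setoid (CLattice A K n pl) where
  r L L' := ∃ c : (Cinf K pl)ˣ, Carries (scale pl c) L.1 L'.1
  iseqv :=
    { refl := fun L => ⟨1, by
        have : scale pl (1 : (Cinf K pl)ˣ) = LinearMap.id := LinearMap.ext fun v => by simp
        rw [this]
        exact Carries.refl _⟩
      symm := fun ⟨c, h⟩ => ⟨c⁻¹, h.symm fun v => by simp⟩
      trans := fun ⟨c, h⟩ ⟨c', h'⟩ => ⟨c' * c, by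
        have : scale pl (c' * c) = scale pl c' ∘ₗ scale pl c :=
          LinearMap.ext fun v => by simp [mul_assoc]
        rw [this]
        exact h.trans h'⟩ }

/-- The set of isomorphism classes of `n`-dimensional `K`-rational `C_∞`-lattices. -/
abbrev CClass : Type _ := Quotient (cIso A K n pl)

variable {A K n pl} in
/-- Commensurability of isomorphism classes of `K`-rational `C_∞`-lattices. -/
def CComm (a b : CClass A K n pl) : Prop :=
  ∃ (L L' : CLattice A K n pl) (c : (Cinf K pl)ˣ),
    ⟦L⟧ = a ∧ ⟦L'⟧ = b ∧ CommVia (scale pl c) L.1 L'.1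

/-- The set of commensurability classes of `n`-dimensional `K`-rational `C_∞`-lattices. -/
abbrev CCommClass : Type _ := Quot (CComm (A := A) (K := K) (n := n) (pl := pl))

end Rational

/-! ### The domain `Ω^n` -/

section Omega

variable (K : Type*) [Field K] (pl : ValuationSubring K) [IsDiscreteValuationRing pl] (n : ℕ)

/-- The `n`-tuples of elements of `C_∞` that are linearly independent over `Kinf`. -/
def OmegaTilde : Type _ := {ω : Fin n → Cinf K pl // LinearIndependent (Kinf K pl) ω}

variable {K pl n}

/-- `γ ω`, for `γ` in `GL_n(K)` and `ω` regarded as a column vector. -/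
def actVec (γ : GL (Fin n) K) (ω : Fin n → Cinf K pl) : Fin n → Cinf K pl :=
  fun i => ∑ j, (γ : Matrix (Fin n) (Fin n) K) i j • ω j

lemma actVec_one (ω : Fin n → Cinf K pl) : actVec 1 ω = ω := by
  funext i
  simp [actVec, Matrix.one_apply]

lemma actVec_mul (γ γ' : GL (Fin n) K) (ω : Fin n → Cinf K pl) :
    actVec (γ * γ') ω = actVec γ (actVec γ' ω) := by
  funext i
  simp only [actVec, Units.val_mul, Matrix.mul_apply, Finset.sum_smul, Finset.smul_sum, mul_smul]
  exact Finset.sum_comm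

lemma actVec_smul (γ : GL (Fin n) K) (c : Cinf K pl) (ω : Fin n → Cinf K pl) :
    actVec γ (c • ω) = c • actVec γ ω := by
  funext i
  simp only [actVec, Pi.smul_apply, Finset.smul_sum]
  exact Finset.sum_congr rfl fun j _ => by simp only [smul_eq_mul, mul_smul_comm]

lemma actVec_linearIndependent (γ : GL (Fin n) K) {ω : Fin n → Cinf K pl}
    (h : LinearIndependent (Kinf K pl) ω) : LinearIndependent (Kinf K pl) (actVec γ ω) := by
  rw [Fintype.linearIndependent_iff] at h ⊢
  intro x hx
  let M : GL (Fin n) (Kinf K pl) := Matrix.GeneralLinearGroup.map (algebraMap K (Kinf K pl)) γ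
  have h0 : Matrix.vecMul x (M : Matrix (Fin n) (Fin n) (Kinf K pl)) = 0 := by
    funext j
    refine h (Matrix.vecMul x (M : Matrix (Fin n) (Fin n) (Kinf K pl))) ?_ j
    rw [← hx]
    simp only [actVec, Matrix.vecMul, dotProduct, Finset.sum_smul, Finset.smul_sum]
    rw [Finset.sum_comm]
    refine Finset.sum_congr rfl fun i _ => Finset.sum_congr rfl fun j _ => ?_
    rw [mul_smul]
    congr 1
  have h1 : Matrix.vecMul (Matrix.vecMul x (M : Matrix (Fin n) (Fin n) (Kinf K pl)))
      ((M⁻¹ : GL (Fin n) (Kinf K pl)) : Matrix (Fin n) (Fin n) (Kinf K pl)) = x := by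
    rw [Matrix.vecMul_vecMul, ← Units.val_mul, mul_inv_cancel, Units.val_one, Matrix.vecMul_one]
  intro i
  rw [← h1, h0, Matrix.zero_vecMul]
  rfl

variable (K pl n) in
/-- Proportionality of tuples. -/
instance omegaSetoid : Setoid (OmegaTilde K pl n) where
  r ω ω' := ∃ c : (Cinf K pl)ˣ, ω'.1 = (c : Cinf K pl) • ω.1
  iseqv :=
    { refl := fun ω => ⟨1, by simp⟩
      symm := fun ⟨c, h⟩ => ⟨c⁻¹, by rw [h, smul_smul]; simp⟩
      trans := fun ⟨c, h⟩ ⟨c', h'⟩ => ⟨c' * c, by rw [h', h, smul_smul, Units.val_mul]⟩ }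

variable (K pl n) in
/-- The space `Ω^n`, the quotient of `OmegaTilde` by the scaling action of the multiplicative
group of `C_∞`. -/
abbrev Omega : Type _ := Quotient (omegaSetoid K pl n)

/-- The left action of `GL_n(K)` on `Ω^n`. -/
def omegaAct (γ : GL (Fin n) K) : Omega K pl n → Omega K pl n :=
  Quotient.map (fun ω => (⟨actVec γ ω.1, actVec_linearIndependent γ ω.2⟩ : OmegaTilde K pl n))
    fun _ _ ⟨c, h⟩ => ⟨c, by
      change actVec γ _ = _
      rw [h, actVec_smul]⟩

lemma omegaAct_one (z : Omega K pl n) : omegaAct 1 z = z := by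
  induction z using Quotient.inductionOn with
  | h ω => exact congrArg _ (Subtype.ext (actVec_one ω.1))

lemma omegaAct_mul (γ γ' : GL (Fin n) K) (z : Omega K pl n) :
    omegaAct (γ * γ') z = omegaAct γ (omegaAct γ' z) := by
  induction z using Quotient.inductionOn with
  | h ω => exact congrArg _ (Subtype.ext (actVec_mul γ γ' ω.1))

/-- The map `ι_ω : K^n → C_∞`, `x ↦ ∑ i, x i * ω i`. -/
def iotaMap (ω : OmegaTilde K pl n) : (Fin n → K) →ₗ[K] Cinf K pl :=
  Fintype.linearCombination K ω.1

end Omega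

/-! ### Adelic data -/

section Adelic

open IsDedekindDomain Matrix

variable (A K : Type*) [CommRing A] [IsDedekindDomain A] [Field K] [Algebra A K]
  [IsFractionRing A K] (n : ℕ) (pl : ValuationSubring K) [IsDiscreteValuationRing pl]

/-- The ring `R` of finite integral adeles, the product of the rings `A_v`. -/
def intAdeles : Subring (FiniteAdeleRing A K) where
  carrier := {a | ∀ v, a v ∈ v.adicCompletionIntegers K}
  mul_mem' ha hb v := mul_mem (ha v) (hb v)
  one_mem' v := one_mem (v.adicCompletionIntegers K)
  add_mem' ha hb v := add_mem (ha v) (hb v)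
  zero_mem' v := zero_mem (v.adicCompletionIntegers K)
  neg_mem' ha v := neg_mem (ha v)

variable {A K n}

/-- The diagonal embedding of `GL_n(K)` in `GL_n` of the finite adeles. -/
def diagGL (γ : GL (Fin n) K) : GL (Fin n) (FiniteAdeleRing A K) :=
  GeneralLinearGroup.map (algebraMap K (FiniteAdeleRing A K)) γ

/-- The inclusion of `GL_n(R)` in `GL_n` of the finite adeles. -/
def inclGL (m : GL (Fin n) (intAdeles A K)) : GL (Fin n) (FiniteAdeleRing A K) :=
  GeneralLinearGroup.map (intAdeles A K).subtype m

/-- The inclusion of `M_n(R)` in `M_n` of the finite adeles. -/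
def inclMat (ρ : Matrix (Fin n) (Fin n) (intAdeles A K)) :
    Matrix (Fin n) (Fin n) (FiniteAdeleRing A K) :=
  ρ.map (intAdeles A K).subtype

/-- The diagonal embedding of `K^n` in row vectors of finite adeles. -/
def diagVec (x : Fin n → K) : Fin n → FiniteAdeleRing A K :=
  fun i => algebraMap K (FiniteAdeleRing A K) (x i)

/-- The matrix `ρ g⁻¹`. -/
def rhoInv (g : GL (Fin n) (FiniteAdeleRing A K)) (ρ : Matrix (Fin n) (Fin n) (intAdeles A K)) :
    Matrix (Fin n) (Fin n) (FiniteAdeleRing A K) :=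
  inclMat ρ * ((g⁻¹ : GL (Fin n) (FiniteAdeleRing A K)) :
    Matrix (Fin n) (Fin n) (FiniteAdeleRing A K))

lemma diagGL_one : diagGL (A := A) (1 : GL (Fin n) K) = 1 := map_one _

lemma diagGL_mul (γ γ' : GL (Fin n) K) :
    diagGL (A := A) (γ * γ') = diagGL γ * diagGL γ' := map_mul _ _ _

lemma diagGL_inv (γ : GL (Fin n) K) : diagGL (A := A) γ⁻¹ = (diagGL γ)⁻¹ := map_inv _ _

lemma inclGL_one : inclGL (1 : GL (Fin n) (intAdeles A K)) = 1 := map_one _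

lemma inclGL_mul (m m' : GL (Fin n) (intAdeles A K)) :
    inclGL (m * m') = inclGL m * inclGL m' := map_mul _ _ _

lemma inclGL_inv (m : GL (Fin n) (intAdeles A K)) : inclGL m⁻¹ = (inclGL m)⁻¹ := map_inv _ _

lemma inclMat_mul_val (ρ : Matrix (Fin n) (Fin n) (intAdeles A K))
    (m : GL (Fin n) (intAdeles A K)) :
    inclMat (ρ * (m : Matrix (Fin n) (Fin n) (intAdeles A K))) =
      inclMat ρ * (inclGL m : Matrix (Fin n) (Fin n) (FiniteAdeleRing A K)) :=
  Matrix.map_mul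

lemma rhoInv_act (γ : GL (Fin n) K) (m : GL (Fin n) (intAdeles A K))
    (g : GL (Fin n) (FiniteAdeleRing A K)) (ρ : Matrix (Fin n) (Fin n) (intAdeles A K)) :
    rhoInv (diagGL γ * g * inclGL m) (ρ * (m : Matrix (Fin n) (Fin n) (intAdeles A K))) =
      rhoInv g ρ * ((diagGL γ)⁻¹ : GL (Fin n) (FiniteAdeleRing A K)).val := by
  rw [rhoInv, rhoInv, inclMat_mul_val, _root_.mul_inv_rev, _root_.mul_inv_rev, Units.val_mul, Units.val_mul,
    Matrix.mul_assoc, ← Matrix.mul_assoc (inclGL m).val, ← Units.val_mul, mul_inv_cancel,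
    Units.val_one, Matrix.one_mul, Matrix.mul_assoc]

variable (A K n)

/-- The relation `(g, ρ) ∼ (γ g m, ρ m)`, for `γ` in `GL_n(K)` and `m` in `GL_n(R)`. -/
instance doubleSetoid :
    Setoid (GL (Fin n) (FiniteAdeleRing A K) × Matrix (Fin n) (Fin n) (intAdeles A K)) where
  r a b := ∃ (γ : GL (Fin n) K) (m : GL (Fin n) (intAdeles A K)),
    b.1 = diagGL γ * a.1 * inclGL m ∧ b.2 = a.2 * m.val
  iseqv :=
    { refl := fun a => ⟨1, 1, by simp [diagGL_one, inclGL_one], by simp⟩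
      symm := fun {a b} ⟨γ, m, h, h'⟩ => ⟨γ⁻¹, m⁻¹, by
          rw [h, diagGL_inv, inclGL_inv]; group, by
          rw [h', Matrix.mul_assoc, ← Units.val_mul, mul_inv_cancel]; simp⟩
      trans := fun {a b c} ⟨γ, m, h, h'⟩ ⟨γ₂, m₂, h₂, h₂'⟩ => ⟨γ₂ * γ, m * m₂, by
          rw [h₂, h, diagGL_mul, inclGL_mul]; group, by
          rw [h₂', h', Matrix.mul_assoc, Units.val_mul]⟩ }

/-- The quotient `GL_n(K) \ (GL_n(𝔸_f) ×_{GL_n(R)} M_n(R))`. -/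
abbrev DoubleQuot : Type _ := Quotient (doubleSetoid A K n)

/-- The relation `(g, z, ρ) ∼ (γ g m, γ z, ρ m)`, for `γ` in `GL_n(K)` and `m` in `GL_n(R)`. -/
instance doubleSetoidC : Setoid (GL (Fin n) (FiniteAdeleRing A K) × Omega K pl n ×
    Matrix (Fin n) (Fin n) (intAdeles A K)) where
  r a b := ∃ (γ : GL (Fin n) K) (m : GL (Fin n) (intAdeles A K)),
    b.1 = diagGL γ * a.1 * inclGL m ∧ b.2.1 = omegaAct γ a.2.1 ∧ b.2.2 = a.2.2 * m.val
  iseqv :=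
    { refl := fun a => ⟨1, 1, by simp [diagGL_one, inclGL_one], (omegaAct_one _).symm, by simp⟩
      symm := fun {a b} ⟨γ, m, h, hz, h'⟩ => ⟨γ⁻¹, m⁻¹, by
          rw [h, diagGL_inv, inclGL_inv]; group, by
          rw [hz, ← omegaAct_mul, inv_mul_cancel, omegaAct_one], by
          rw [h', Matrix.mul_assoc, ← Units.val_mul, mul_inv_cancel]; simp⟩
      trans := fun {a b c} ⟨γ, m, h, hz, h'⟩ ⟨γ₂, m₂, h₂, hz₂, h₂'⟩ => ⟨γ₂ * γ, m * m₂, by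
          rw [h₂, h, diagGL_mul, inclGL_mul]; group, by
          rw [hz₂, hz, omegaAct_mul], by
          rw [h₂', h', Matrix.mul_assoc, Units.val_mul]⟩ }

/-- The quotient `GL_n(K) \ (GL_n(𝔸_f) × Ω^n ×_{GL_n(R)} M_n(R))`. -/
abbrev DoubleQuotC : Type _ := Quotient (doubleSetoidC A K n pl)

/-- The action `u ↦ u γ⁻¹` of `GL_n(K)` on `M_n(𝔸_f)`. -/
instance matSetoid : Setoid (Matrix (Fin n) (Fin n) (FiniteAdeleRing A K)) where
  r u u' := ∃ γ : GL (Fin n) K, u' = u * ((diagGL γ)⁻¹ : GL (Fin n) (FiniteAdeleRing A K)).val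
  iseqv :=
    { refl := fun u => ⟨1, by simp [diagGL_one]⟩
      symm := fun {u u'} ⟨γ, h⟩ => ⟨γ⁻¹, by
        rw [h, diagGL_inv, inv_inv, Matrix.mul_assoc, ← Units.val_mul, inv_mul_cancel]; simp⟩
      trans := fun {a b c} ⟨γ, h⟩ ⟨γ₂, h₂⟩ => ⟨γ₂ * γ, by
        rw [h₂, h, diagGL_mul, _root_.mul_inv_rev, Matrix.mul_assoc, Units.val_mul]⟩ }

/-- The quotient `GL_n(K) \ M_n(𝔸_f)`. -/
abbrev MatQuot : Type _ := Quotient (matSetoid A K n)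

/-- The action `(u, z) ↦ (u γ⁻¹, γ z)` of `GL_n(K)` on `M_n(𝔸_f) × Ω^n`. -/
instance matSetoidC : Setoid (Matrix (Fin n) (Fin n) (FiniteAdeleRing A K) × Omega K pl n) where
  r a b := ∃ γ : GL (Fin n) K,
    b.1 = a.1 * ((diagGL γ)⁻¹ : GL (Fin n) (FiniteAdeleRing A K)).val ∧ b.2 = omegaAct γ a.2
  iseqv :=
    { refl := fun u => ⟨1, by simp [diagGL_one], (omegaAct_one _).symm⟩
      symm := fun {u u'} ⟨γ, h, hz⟩ => ⟨γ⁻¹, by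
        rw [h, diagGL_inv, inv_inv, Matrix.mul_assoc, ← Units.val_mul, inv_mul_cancel]; simp, by
        rw [hz, ← omegaAct_mul, inv_mul_cancel, omegaAct_one]⟩
      trans := fun {a b c} ⟨γ, h, hz⟩ ⟨γ₂, h₂, hz₂⟩ => ⟨γ₂ * γ, by
        rw [h₂, h, diagGL_mul, _root_.mul_inv_rev, Matrix.mul_assoc, Units.val_mul], by
        rw [hz₂, hz, omegaAct_mul]⟩ }

/-- The quotient `GL_n(K) \ (M_n(𝔸_f) × Ω^n)`. -/
abbrev MatQuotC : Type _ := Quotient (matSetoidC A K n pl)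

/-- The map `Θ`, `(g, ρ) ↦ ρ g⁻¹`. -/
def Theta : DoubleQuot A K n → MatQuot A K n :=
  Quotient.map (fun a => rhoInv a.1 a.2) fun a b ⟨γ, m, h, h'⟩ => ⟨γ, by
    rw [h, h', rhoInv_act]⟩

/-- The map `Υ`, `(g, z, ρ) ↦ (ρ g⁻¹, z)`. -/
def Upsilon : DoubleQuotC A K n pl → MatQuotC A K n pl :=
  Quotient.map (fun a => (rhoInv a.1 a.2.2, a.2.1)) fun a b ⟨γ, m, h, hz, h'⟩ => ⟨γ, by
    change rhoInv b.1 b.2.2 = _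
    rw [h, h', rhoInv_act], hz⟩

variable {A K n pl}

/-- The row vector `w` of finite adeles lies in `R^n g⁻¹`. -/
def MemLat (g : GL (Fin n) (FiniteAdeleRing A K)) (w : Fin n → FiniteAdeleRing A K) : Prop :=
  ∃ r : Fin n → intAdeles A K, w = (fun i => (r i : FiniteAdeleRing A K)) ᵥ*
    ((g⁻¹ : GL (Fin n) (FiniteAdeleRing A K)) : Matrix (Fin n) (Fin n) (FiniteAdeleRing A K))

/-- `(Λ, φ) = (R^n g⁻¹ ∩ K^n, ρ g⁻¹)`: the map `φ` corresponds to right multiplication by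
`ρ g⁻¹` from `(𝔸_f/R)^n` to `𝔸_f^n / R^n g⁻¹`. -/
def Represents (g : GL (Fin n) (FiniteAdeleRing A K))
    (ρ : Matrix (Fin n) (Fin n) (intAdeles A K)) (L : LabelledModule A K (Fin n → K) n) : Prop :=
  (∀ y : Fin n → K, y ∈ L.lat ↔ MemLat g (diagVec y)) ∧
    ∀ x y : Fin n → K, L.Maps (fun i => Submodule.Quotient.mk (x i)) y →
      MemLat g (diagVec y - diagVec x ᵥ* rhoInv g ρ)

/-- `(Λ, φ) = (ι_ω(R^n g⁻¹ ∩ K^n), ι_ω(ρ g⁻¹))`. -/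
def RepresentsC (g : GL (Fin n) (FiniteAdeleRing A K)) (ω : OmegaTilde K pl n)
    (ρ : Matrix (Fin n) (Fin n) (intAdeles A K)) (L : LabelledModule A K (Cinf K pl) n) : Prop :=
  ∃ L₀ : LabelledModule A K (Fin n → K) n, Represents g ρ L₀ ∧ Carries (iotaMap ω) L₀ L

end Adelic

end RatLat

end

namespace RatLat

section FiniteAdeles

open IsDedekindDomain HeightOneSpectrum Matrix

variable {A K : Type*} [CommRing A] [IsDedekindDomain A] [Field K] [Algebra A K]
  [IsFractionRing A K] {n : ℕ}

lemma algebraMap_A_apply (a : A) (v : HeightOneSpectrum A) :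
    algebraMap A (FiniteAdeleRing A K) a v = algebraMap K (v.adicCompletion K) (algebraMap A K a) :=
  rfl

lemma algebraMap_K_apply (a : K) (v : HeightOneSpectrum A) :
    algebraMap K (FiniteAdeleRing A K) a v = algebraMap K (v.adicCompletion K) a :=
  rfl

lemma valued_algebraMap (v : HeightOneSpectrum A) (x : K) :
    Valued.v (algebraMap K (v.adicCompletion K) x) = v.valuation K x :=
  valuedAdicCompletion_eq_valuation' v x

lemma algebraMap_mem_intAdeles (a : A) : algebraMap A (FiniteAdeleRing A K) a ∈ intAdeles A K := by
  intro v
  rw [mem_adicCompletionIntegers, algebraMap_A_apply, valued_algebraMap]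
  exact v.valuation_le_one a

lemma smul_mem_intAdeles (a : A) {x : FiniteAdeleRing A K} (hx : x ∈ intAdeles A K) :
    a • x ∈ intAdeles A K := by
  rw [Algebra.smul_def]
  exact mul_mem (algebraMap_mem_intAdeles a) hx

lemma algebraMap_mem_intAdeles_iff {x : K} :
    algebraMap K (FiniteAdeleRing A K) x ∈ intAdeles A K ↔ ∃ a, algebraMap A K a = x := by
  refine ⟨fun h => mem_integers_of_valuation_le_one K x fun v => ?_, ?_⟩
  · rw [← valued_algebraMap]
    exact h v
  · rintro ⟨a, rfl⟩
    exact algebraMap_mem_intAdeles a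

lemma exists_smul_mem_intAdeles (x : FiniteAdeleRing A K) :
    ∃ d : A, d ≠ 0 ∧ d • x ∈ intAdeles A K := by
  classical
  have hfin : {v | x v ∉ v.adicCompletionIntegers K}.Finite := x.2
  choose b hb hb' using fun v : HeightOneSpectrum A =>
    adicCompletion.mul_nonZeroDivisor_mem_adicCompletionIntegers v (x v)
  refine ⟨∏ v ∈ hfin.toFinset, b v,
    Finset.prod_ne_zero_iff.2 fun v _ => nonZeroDivisors.ne_zero (hb v), fun v => ?_⟩
  rw [Algebra.smul_def]
  change algebraMap A (FiniteAdeleRing A K) _ v * x v ∈ _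
  by_cases hv : v ∈ hfin.toFinset
  · rw [← Finset.prod_erase_mul _ _ hv, map_mul]
    change (algebraMap A (FiniteAdeleRing A K) _ v * algebraMap A (FiniteAdeleRing A K) _ v) * _ ∈ _
    rw [mul_assoc]
    refine mul_mem (algebraMap_mem_intAdeles (K := K) _ v) ?_
    rw [mul_comm]
    exact hb' v
  · refine mul_mem (algebraMap_mem_intAdeles (K := K) _ v) ?_
    simpa using hv

lemma exists_smul_mem_intAdeles_of_finite {ι : Type*} [Finite ι] (x : ι → FiniteAdeleRing A K) :
    ∃ d : A, d ≠ 0 ∧ ∀ i, d • x i ∈ intAdeles A K := by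
  classical
  have := Fintype.ofFinite ι
  choose d hd hd' using fun i => exists_smul_mem_intAdeles (x i)
  refine ⟨∏ i, d i, Finset.prod_ne_zero_iff.2 fun i _ => hd i, fun i => ?_⟩
  rw [← Finset.prod_erase_mul _ _ (Finset.mem_univ i), mul_smul]
  exact smul_mem_intAdeles _ (hd' i)

lemma exists_sub_algebraMap_mem_integers (v : HeightOneSpectrum A) (x : v.adicCompletion K) :
    ∃ k : K, x - algebraMap K (v.adicCompletion K) k ∈ v.adicCompletionIntegers K := by
  have hopen : IsOpen (v.adicCompletionIntegers K : Set (v.adicCompletion K)) :=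
    Valued.isOpen_valuationSubring _
  have : IsOpen ((fun y => x - y) ⁻¹' (v.adicCompletionIntegers K : Set (v.adicCompletion K))) :=
    hopen.preimage (by fun_prop)
  obtain ⟨k, hk⟩ := (denseRange_algebraMap K v).exists_mem_open this
    ⟨x, by simp⟩
  exact ⟨k, hk⟩

lemma exists_intValuation_eq_exp (v : HeightOneSpectrum A) {d : A} (hd : d ≠ 0) :
    ∃ e : ℕ, v.intValuation d = WithZero.exp (-(e : ℤ)) :=
  ⟨_, v.intValuation_if_neg hd⟩

/-- Strong approximation for the finite adeles: every finite adele is the sum of an element of `K`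
and an integral adele. -/
lemma exists_sub_algebraMap_mem_intAdeles (x : FiniteAdeleRing A K) :
    ∃ k : K, x - algebraMap K (FiniteAdeleRing A K) k ∈ intAdeles A K := by
  classical
  have hfin : {v | x v ∉ v.adicCompletionIntegers K}.Finite := x.2
  choose k₀ hk₀ using fun v : HeightOneSpectrum A => exists_sub_algebraMap_mem_integers v (x v)
  set k : HeightOneSpectrum A → K := fun v => if v ∈ hfin.toFinset then k₀ v else 0 with hk
  have hkx : ∀ v, x v - algebraMap K (v.adicCompletion K) (k v) ∈ v.adicCompletionIntegers K := by
    intro v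
    by_cases hv : v ∈ hfin.toFinset
    · simp only [hk, if_pos hv]
      exact hk₀ v
    · simp only [hk, if_neg hv, map_zero, sub_zero]
      simpa using hv
  obtain ⟨d, hd⟩ := IsLocalization.exist_integer_multiples (nonZeroDivisors A) hfin.toFinset k
  have hd0 : (d : A) ≠ 0 := nonZeroDivisors.ne_zero d.2
  have hdK : algebraMap A K d ≠ 0 := by simp
  have hdk : ∀ v, ∃ c : A, algebraMap A K c = algebraMap A K d * k v := by
    intro v
    by_cases hv : v ∈ hfin.toFinset
    · obtain ⟨c, hc⟩ := hd v hv
      exact ⟨c, by rw [hc, Algebra.smul_def]⟩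
    · exact ⟨0, by simp only [hk, if_neg hv, map_zero, mul_zero]⟩
  choose c hc using hdk
  have hT : {v : HeightOneSpectrum A | v.asIdeal ∣ Ideal.span {(d : A)}}.Finite :=
    Ideal.finite_factors (by simp)
  choose e he using fun v : HeightOneSpectrum A => exists_intValuation_eq_exp v hd0
  obtain ⟨y, hy⟩ := IsDedekindDomain.exists_forall_sub_mem_ideal (s := hT.toFinset)
    (fun v : HeightOneSpectrum A => v.asIdeal) e (fun v _ => v.prime)
    (fun v _ w _ h h' => h (HeightOneSpectrum.ext h')) (fun v => c v)
  have hyv : ∀ v : HeightOneSpectrum A, v.intValuation (y - c v) ≤ v.intValuation (d : A) := by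
    intro v
    by_cases hv : v ∈ hT.toFinset
    · rw [he, intValuation_le_pow_iff_mem]
      exact hy v hv
    · have : ¬ v.intValuation (d : A) < 1 := by
        rw [intValuation_lt_one_iff_dvd]
        simpa using hv
      exact (v.intValuation_le_one _).trans (not_lt.1 this)
  refine ⟨algebraMap A K y / algebraMap A K d, fun v => ?_⟩
  change x v - algebraMap K (v.adicCompletion K) (algebraMap A K y / algebraMap A K d) ∈ _
  have hsplit : x v - algebraMap K (v.adicCompletion K) (algebraMap A K y / algebraMap A K d) =
      (x v - algebraMap K (v.adicCompletion K) (k v)) -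
        algebraMap K (v.adicCompletion K) (algebraMap A K (y - c v) / algebraMap A K d) := by
    have : algebraMap A K (y - c v) / algebraMap A K d =
        algebraMap A K y / algebraMap A K d - k v := by
      rw [map_sub, hc]
      field_simp
    rw [this, map_sub]
    ring
  rw [hsplit]
  refine sub_mem (hkx v) ?_
  rw [mem_adicCompletionIntegers, valued_algebraMap, map_div₀, valuation_of_algebraMap,
    valuation_of_algebraMap]
  exact div_le_one_of_le₀ (hyv v) zero_le

/-! ### Row vectors of adeles -/

/-- The row vector `w` of finite adeles has integral entries. -/
def IsIntVec (w : Fin n → FiniteAdeleRing A K) : Prop := ∀ i, w i ∈ intAdeles A K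

lemma IsIntVec.add {w w' : Fin n → FiniteAdeleRing A K} (h : IsIntVec w) (h' : IsIntVec w') :
    IsIntVec (w + w') := fun i => add_mem (h i) (h' i)

lemma IsIntVec.sub {w w' : Fin n → FiniteAdeleRing A K} (h : IsIntVec w) (h' : IsIntVec w') :
    IsIntVec (w - w') := fun i => sub_mem (h i) (h' i)

lemma IsIntVec.smul {w : Fin n → FiniteAdeleRing A K} (a : A) (h : IsIntVec w) :
    IsIntVec (a • w) := fun i => smul_mem_intAdeles a (h i)

/-- The matrix `u` of finite adeles has integral entries. -/
def IsIntMat (u : Matrix (Fin n) (Fin n) (FiniteAdeleRing A K)) : Prop :=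
  ∀ i j, u i j ∈ intAdeles A K

lemma IsIntVec.vecMul {w : Fin n → FiniteAdeleRing A K} (h : IsIntVec w)
    {u : Matrix (Fin n) (Fin n) (FiniteAdeleRing A K)} (hu : IsIntMat u) : IsIntVec (w ᵥ* u) :=
  fun j => sum_mem fun i _ => mul_mem (h i) (hu i j)

lemma isIntMat_inclMat (ρ : Matrix (Fin n) (Fin n) (intAdeles A K)) : IsIntMat (inclMat ρ) :=
  fun i j => (ρ i j).2

lemma isIntMat_inclGL (m : GL (Fin n) (intAdeles A K)) :
    IsIntMat (inclGL m).val := fun i j => (m.val i j).2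

lemma IsIntMat.exists_inclMat {u : Matrix (Fin n) (Fin n) (FiniteAdeleRing A K)}
    (hu : IsIntMat u) : ∃ ρ, inclMat ρ = u := ⟨fun i j => ⟨u i j, hu i j⟩, rfl⟩

lemma inclMat_injective :
    Function.Injective (inclMat : Matrix (Fin n) (Fin n) (intAdeles A K) → _) :=
  fun _ _ h => Matrix.ext fun i j => Subtype.ext (congrFun (congrFun h i) j)

lemma exists_inclGL {g : GL (Fin n) (FiniteAdeleRing A K)} (hg : IsIntMat g.val)
    (hg' : IsIntMat (g⁻¹).val) : ∃ m, inclGL m = g := by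
  obtain ⟨ρ, hρ⟩ := hg.exists_inclMat
  obtain ⟨ρ', hρ'⟩ := hg'.exists_inclMat
  have hmul : ∀ a b : Matrix (Fin n) (Fin n) (intAdeles A K),
      inclMat (a * b) = inclMat a * inclMat b := fun a b => Matrix.map_mul
  have hone : inclMat (1 : Matrix (Fin n) (Fin n) (intAdeles A K)) = 1 :=
    Matrix.map_one _ (map_zero _) (map_one _)
  refine ⟨⟨ρ, ρ', inclMat_injective ?_, inclMat_injective ?_⟩, Units.ext hρ⟩
  · rw [hmul, hρ, hρ', hone, ← Units.val_mul, mul_inv_cancel, Units.val_one]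
  · rw [hmul, hρ, hρ', hone, ← Units.val_mul, inv_mul_cancel, Units.val_one]

lemma diagVec_add (x y : Fin n → K) : diagVec (A := A) (x + y) = diagVec x + diagVec y :=
  funext fun _ => map_add _ _ _

lemma diagVec_sub (x y : Fin n → K) : diagVec (A := A) (x - y) = diagVec x - diagVec y :=
  funext fun _ => map_sub _ _ _

lemma diagVec_zero : diagVec (A := A) (0 : Fin n → K) = 0 :=
  funext fun _ => map_zero _

lemma diagVec_smul (a : A) (x : Fin n → K) : diagVec (A := A) (a • x) = a • diagVec x :=
  funext fun i => by
    change algebraMap K (FiniteAdeleRing A K) (a • x i) = a • algebraMap K (FiniteAdeleRing A K) (x i)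
    rw [Algebra.smul_def, Algebra.smul_def, map_mul, ← IsScalarTower.algebraMap_apply]

lemma diagVec_vecMul (x : Fin n → K) (γ : GL (Fin n) K) :
    diagVec (A := A) (x ᵥ* γ.val) = diagVec x ᵥ* (diagGL γ).val := by
  funext j
  exact RingHom.map_vecMul (algebraMap K (FiniteAdeleRing A K)) γ.val x j

lemma memLat_iff {g : GL (Fin n) (FiniteAdeleRing A K)} {w : Fin n → FiniteAdeleRing A K} :
    MemLat g w ↔ IsIntVec (w ᵥ* g.val) := by
  constructor
  · rintro ⟨r, rfl⟩
    rw [Matrix.vecMul_vecMul, ← Units.val_mul, inv_mul_cancel, Units.val_one, Matrix.vecMul_one]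
    exact fun i => (r i).2
  · intro h
    refine ⟨fun i => ⟨_, h i⟩, ?_⟩
    change w = (w ᵥ* g.val) ᵥ* _
    rw [Matrix.vecMul_vecMul, ← Units.val_mul, mul_inv_cancel, Units.val_one, Matrix.vecMul_one]

lemma MemLat.add {g : GL (Fin n) (FiniteAdeleRing A K)} {w w' : Fin n → FiniteAdeleRing A K}
    (h : MemLat g w) (h' : MemLat g w') : MemLat g (w + w') := by
  rw [memLat_iff, Matrix.add_vecMul] at *
  exact h.add h'

lemma MemLat.sub {g : GL (Fin n) (FiniteAdeleRing A K)} {w w' : Fin n → FiniteAdeleRing A K}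
    (h : MemLat g w) (h' : MemLat g w') : MemLat g (w - w') := by
  rw [memLat_iff, Matrix.sub_vecMul] at *
  exact h.sub h'

lemma MemLat.zero {g : GL (Fin n) (FiniteAdeleRing A K)} : MemLat g 0 := by
  rw [memLat_iff, Matrix.zero_vecMul]
  exact fun i => zero_mem _

lemma MemLat.smul {g : GL (Fin n) (FiniteAdeleRing A K)} {w : Fin n → FiniteAdeleRing A K} (a : A)
    (h : MemLat g w) : MemLat g (a • w) := by
  rw [memLat_iff, Matrix.smul_vecMul] at *
  exact h.smul a

lemma memLat_mul_iff {g h : GL (Fin n) (FiniteAdeleRing A K)} {w : Fin n → FiniteAdeleRing A K} :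
    MemLat (g * h) w ↔ MemLat h (w ᵥ* g.val) := by
  rw [memLat_iff, memLat_iff, Units.val_mul, Matrix.vecMul_vecMul]

lemma exists_smul_isIntMat (u : Matrix (Fin n) (Fin n) (FiniteAdeleRing A K)) :
    ∃ d : A, d ≠ 0 ∧ IsIntMat (d • u) := by
  obtain ⟨d, hd, h⟩ := exists_smul_mem_intAdeles_of_finite
    fun p : Fin n × Fin n => u p.1 p.2
  exact ⟨d, hd, fun i j => h (i, j)⟩

/-- Some nonzero multiple of `R^n` is contained in `R^n g⁻¹`. -/
lemma exists_smul_memLat (g : GL (Fin n) (FiniteAdeleRing A K)) :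
    ∃ d : A, d ≠ 0 ∧ ∀ w, IsIntVec w → MemLat g (d • w) := by
  obtain ⟨d, hd, h⟩ := exists_smul_isIntMat g.val
  refine ⟨d, hd, fun w hw => ?_⟩
  rw [memLat_iff, Matrix.smul_vecMul, ← Matrix.vecMul_smul]
  exact hw.vecMul h

/-- A nonzero multiple of `R^n g⁻¹` is contained in `R^n`. -/
lemma exists_smul_isIntVec (g : GL (Fin n) (FiniteAdeleRing A K)) :
    ∃ d : A, d ≠ 0 ∧ ∀ w, MemLat g w → IsIntVec (d • w) := by
  obtain ⟨d, hd, h⟩ := exists_smul_isIntMat (g⁻¹).val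
  refine ⟨d, hd, fun w hw => ?_⟩
  obtain ⟨r, rfl⟩ := hw
  rw [← Matrix.vecMul_smul]
  exact IsIntVec.vecMul (fun i => (r i).2) h

lemma isUnit_algebraMap {d : A} (hd : d ≠ 0) : IsUnit (algebraMap A (FiniteAdeleRing A K) d) := by
  rw [IsScalarTower.algebraMap_apply A K]
  exact (IsUnit.mk0 _ (by simpa using hd)).map _

/-- Strong approximation: `𝔸_f^n = K^n + d R^n`. -/
lemma exists_diagVec_add_smul {d : A} (hd : d ≠ 0) (w : Fin n → FiniteAdeleRing A K) :
    ∃ (x : Fin n → K) (r : Fin n → FiniteAdeleRing A K), IsIntVec r ∧ w = diagVec x + d • r := by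
  obtain ⟨u, hu⟩ := isUnit_algebraMap (K := K) hd
  choose k hk using fun i =>
    exists_sub_algebraMap_mem_intAdeles ((u⁻¹ : (FiniteAdeleRing A K)ˣ).val * w i)
  refine ⟨d • k, fun i => (u⁻¹ : (FiniteAdeleRing A K)ˣ).val * w i - algebraMap K _ (k i), hk, ?_⟩
  rw [diagVec_smul]
  funext i
  simp only [Pi.add_apply, Pi.smul_apply, smul_sub, diagVec, add_sub_cancel]
  rw [Algebra.smul_def, ← hu, Units.mul_inv_cancel_left]

lemma exists_sub_diagVec_memLat (g : GL (Fin n) (FiniteAdeleRing A K))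
    (w : Fin n → FiniteAdeleRing A K) : ∃ x : Fin n → K, MemLat g (w - diagVec x) := by
  obtain ⟨d, hd, h⟩ := exists_smul_memLat g
  obtain ⟨x, r, hr, rfl⟩ := exists_diagVec_add_smul hd w
  exact ⟨x, by simpa using h r hr⟩

/-- `R^n g⁻¹` is determined by its intersection with `K^n`. -/
lemma memLat_of_forall_diagVec {g g' : GL (Fin n) (FiniteAdeleRing A K)}
    (h : ∀ x : Fin n → K, MemLat g (diagVec x) → MemLat g' (diagVec x))
    {w : Fin n → FiniteAdeleRing A K} (hw : MemLat g w) : MemLat g' w := by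
  obtain ⟨d, hd, hdg⟩ := exists_smul_memLat g
  obtain ⟨d', hd', hdg'⟩ := exists_smul_memLat g'
  obtain ⟨x, r, hr, rfl⟩ := exists_diagVec_add_smul (mul_ne_zero hd hd') w
  have h1 : MemLat g ((d * d') • r) := by
    rw [mul_smul]; exact hdg _ (hr.smul d')
  have h2 : MemLat g' ((d * d') • r) := by
    rw [mul_comm, mul_smul]; exact hdg' _ (hr.smul d)
  exact (h x (by simpa using hw.sub h1)).add h2

/-- `(R^n g⁻¹ + R^n g'⁻¹) ∩ K^n = (R^n g⁻¹ ∩ K^n) + (R^n g'⁻¹ ∩ K^n)`. -/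
lemma exists_add_of_memLat_add {g g' : GL (Fin n) (FiniteAdeleRing A K)} {y : Fin n → K}
    {w w' : Fin n → FiniteAdeleRing A K} (hw : MemLat g w) (hw' : MemLat g' w')
    (h : diagVec y = w + w') :
    ∃ x x' : Fin n → K, MemLat g (diagVec x) ∧ MemLat g' (diagVec x') ∧ y = x + x' := by
  obtain ⟨d, hd, hdg⟩ := exists_smul_memLat g
  obtain ⟨d', hd', hdg'⟩ := exists_smul_memLat g'
  obtain ⟨x, r, hr, rfl⟩ := exists_diagVec_add_smul (mul_ne_zero hd hd') w
  have h1 : MemLat g ((d * d') • r) := by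
    rw [mul_smul]; exact hdg _ (hr.smul d')
  have h2 : MemLat g' ((d * d') • r) := by
    rw [mul_comm, mul_smul]; exact hdg' _ (hr.smul d)
  refine ⟨x, y - x, by simpa using hw.sub h1, ?_, by abel⟩
  rw [diagVec_sub, h]
  convert hw'.add h2 using 1
  abel

/-- An adelic matrix mapping all of `K^n` to vectors with bounded denominators vanishes. -/
lemma eq_zero_of_isIntVec_smul {u : Matrix (Fin n) (Fin n) (FiniteAdeleRing A K)} {d : A}
    (hd : d ≠ 0) (h : ∀ x : Fin n → K, IsIntVec (d • (diagVec x ᵥ* u))) : u = 0 := by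
  have key : ∀ a : FiniteAdeleRing A K,
      (∀ x : K, d • (algebraMap K _ x * a) ∈ intAdeles A K) → a = 0 := by
    intro a ha
    refine FiniteAdeleRing.ext K fun v => ?_
    change a v = 0
    by_contra hav
    obtain ⟨x, hx⟩ := v.valuation_surjective K
      ((v.valuation K (algebraMap A K d) * Valued.v (a v))⁻¹ * WithZero.exp (1 : ℤ))
    have h1 := ha x v
    rw [Algebra.smul_def] at h1
    change algebraMap A (FiniteAdeleRing A K) d v *
      (algebraMap K (FiniteAdeleRing A K) x v * a v) ∈ _ at h1
    rw [mem_adicCompletionIntegers, map_mul, map_mul, algebraMap_A_apply, algebraMap_K_apply,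
      valued_algebraMap, valued_algebraMap, hx] at h1
    have hd1 : v.valuation K (algebraMap A K d) ≠ 0 := by simpa using hd
    have hd2 : Valued.v (a v) ≠ 0 := by simpa using hav
    have : v.valuation K (algebraMap A K d) * ((v.valuation K (algebraMap A K d) *
        Valued.v (a v))⁻¹ * WithZero.exp (1 : ℤ) * Valued.v (a v)) = WithZero.exp (1 : ℤ) := by
      field_simp
    rw [this, ← WithZero.exp_zero, WithZero.exp_le_exp] at h1
    omega
  ext1 i j
  refine key _ fun x => ?_
  have := h (Pi.single i x) j
  have hs : diagVec (A := A) (Pi.single i x) = Pi.single i (algebraMap K _ x) := by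
    funext k
    by_cases hk : k = i
    · subst hk; simp [diagVec]
    · simp [diagVec, hk]
  rw [hs, Pi.smul_apply, Matrix.single_vecMul] at this
  exact this

end FiniteAdeles

section EndomorphismsOfTorsion

open IsDedekindDomain HeightOneSpectrum Matrix

variable {A K : Type*} [CommRing A] [IsDedekindDomain A] [Field K] [Algebra A K]
  [IsFractionRing A K] {n : ℕ}

lemma isClosed_valued_le_exp (v : HeightOneSpectrum A) (k : ℕ) :
    IsClosed {x : v.adicCompletion K | Valued.v x ≤ WithZero.exp (-(k : ℤ))} := by
  obtain ⟨π, hπ⟩ := valuedAdicCompletion_surjective K v (WithZero.exp (k : ℤ))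
  have hcl : IsClosed (v.adicCompletionIntegers K : Set (v.adicCompletion K)) :=
    Valued.isClosed_valuationSubring _
  convert hcl.preimage (f := fun x => π * x) (by fun_prop) using 1
  ext x
  change Valued.v x ≤ WithZero.exp (-(k : ℤ)) ↔ Valued.v (π * x) ≤ 1
  rw [map_mul, hπ, WithZero.exp_neg, ← mul_one (WithZero.exp (k : ℤ))⁻¹, le_inv_mul_iff₀ (by simp)]

/-- A sequence with rapidly decreasing steps converges in the completion. -/
lemma exists_valued_sub_le_exp (v : HeightOneSpectrum A) (a : ℕ → v.adicCompletion K)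
    (h : ∀ k, Valued.v (a (k + 1) - a k) ≤ WithZero.exp (-(k : ℤ))) :
    ∃ L, ∀ k : ℕ, Valued.v (L - a k) ≤ WithZero.exp (-(k : ℤ)) := by
  have hstep : ∀ k m, k ≤ m → Valued.v (a m - a k) ≤ WithZero.exp (-(k : ℤ)) := by
    intro k m hkm
    induction m, hkm using Nat.le_induction with
    | base => simp
    | succ m hkm ih =>
      have : a (m + 1) - a k = (a (m + 1) - a m) + (a m - a k) := by ring
      rw [this]
      refine (Valuation.map_add _ _ _).trans (max_le ((h m).trans ?_) ih)
      rw [WithZero.exp_le_exp]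
      omega
  have hc : CauchySeq a := by
    rw [CauchySeq, Valued.cauchy_iff]
    refine ⟨inferInstance, fun γ => ?_⟩
    have hγ : MonoidWithZeroHom.ValueGroup₀.embedding γ.1 ≠ 0 := by simp
    obtain ⟨k, hk, -⟩ := WithZero.exists_exp_neg_natCast_lt_and_lt hγ hγ
    refine ⟨a '' Set.Ici k, Filter.image_mem_map (Filter.Ici_mem_atTop k), ?_⟩
    rintro _ ⟨i, hi, rfl⟩ _ ⟨j, hj, rfl⟩
    rw [Valuation.restrict_lt_iff_lt_embedding]
    refine lt_of_le_of_lt ?_ hk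
    have : a j - a i = (a j - a k) - (a i - a k) := by ring
    rw [this]
    exact (Valuation.map_sub _ _ _).trans (max_le (hstep k j hj) (hstep k i hi))
  obtain ⟨L, hL⟩ := cauchySeq_tendsto_of_complete hc
  refine ⟨L, fun k => ?_⟩
  exact (isClosed_valued_le_exp v k).mem_of_tendsto (hL.sub_const (a k))
    (Filter.eventually_atTop.2 ⟨k, fun m hm => hstep k m hm⟩)

lemma exists_notMem_mul_pow_eq (v : HeightOneSpectrum A) {π : A}
    (hπ : v.intValuation π = WithZero.exp (-1 : ℤ)) (x : K) :
    ∃ (k : ℕ) (s c : A), s ∉ v.asIdeal ∧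
      algebraMap A K s * x * algebraMap A K π ^ k = algebraMap A K c := by
  by_cases hx : x = 0
  · exact ⟨0, 1, 0, fun h => v.isPrime.ne_top ((Ideal.eq_top_iff_one _).2 h), by simp [hx]⟩
  have hx' : v.valuation K x ≠ 0 := by simpa using hx
  obtain ⟨k, hk, -⟩ := WithZero.exists_exp_neg_natCast_lt_and_lt (inv_ne_zero hx') (inv_ne_zero hx')
  have : v.valuation K (x * algebraMap A K π ^ k) ≤ 1 := by
    rw [map_mul, map_pow, valuation_of_algebraMap, hπ, ← WithZero.exp_nsmul]
    have h2 : (k • (-1 : ℤ)) = -(k : ℤ) := by simp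
    rw [h2]
    calc _ ≤ v.valuation K x * (v.valuation K x)⁻¹ := by gcongr
      _ = 1 := mul_inv_cancel₀ hx'
  obtain ⟨c, s, h⟩ := v.exists_primeCompl_mul_eq_of_integer _ this
  exact ⟨k, s, c, s.2, by rw [← h]; ring⟩

/-- Every `A`-linear map from `K/A` to `𝔸_f/R` is multiplication by an integral adele. -/
lemma exists_intAdele_of_linear_mod (f : K → FiniteAdeleRing A K)
    (hsmul : ∀ (a : A) x, f (a • x) - a • f x ∈ intAdeles A K)
    (hint : ∀ a : A, f (algebraMap A K a) ∈ intAdeles A K) :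
    ∃ ρ ∈ intAdeles A K, ∀ x, f x - algebraMap K _ x * ρ ∈ intAdeles A K := by
  have hloc : ∀ v : HeightOneSpectrum A, ∃ L : v.adicCompletion K,
      L ∈ v.adicCompletionIntegers K ∧ ∀ x : K,
        f x v - algebraMap K (v.adicCompletion K) x * L ∈ v.adicCompletionIntegers K := by
    intro v
    have hsm : ∀ (a : A) x, f (a • x) v -
        algebraMap K (v.adicCompletion K) (algebraMap A K a) * f x v ∈
          v.adicCompletionIntegers K := by
      intro a x
      have := hsmul a x v
      rw [Algebra.smul_def a (f x)] at this
      exact this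
    have hAint : ∀ a : A, algebraMap K (v.adicCompletion K) (algebraMap A K a) ∈
        v.adicCompletionIntegers K := fun a => algebraMap_mem_intAdeles (K := K) a v
    obtain ⟨π, hπ⟩ := v.intValuation_exists_uniformizer
    have hπ0 : algebraMap A K π ≠ 0 := by
      have : π ≠ 0 := by
        rintro rfl
        rw [map_zero] at hπ
        exact WithZero.exp_ne_zero hπ.symm
      simpa using this
    set p : v.adicCompletion K := algebraMap K _ (algebraMap A K π) with hp
    have hp0 : p ≠ 0 := by simpa [hp] using hπ0
    have hvp : ∀ k : ℕ, Valued.v (p ^ k) = WithZero.exp (-(k : ℤ)) := by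
      intro k
      rw [map_pow, hp, valued_algebraMap, valuation_of_algebraMap, hπ, ← WithZero.exp_nsmul]
      simp
    have hmul : ∀ (k : ℕ) (y : v.adicCompletion K), y ∈ v.adicCompletionIntegers K →
        Valued.v (p ^ k * y) ≤ WithZero.exp (-(k : ℤ)) := by
      intro k y hy
      rw [map_mul, hvp]
      exact mul_le_of_le_one_right' hy
    set α : ℕ → v.adicCompletion K := fun k => f ((algebraMap A K π ^ k)⁻¹) v with hα
    have hstep : ∀ k, p * α (k + 1) - α k ∈ v.adicCompletionIntegers K := by
      intro k
      have := neg_mem (hsm π ((algebraMap A K π ^ (k + 1))⁻¹))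
      have h2 : π • (algebraMap A K π ^ (k + 1))⁻¹ = (algebraMap A K π ^ k)⁻¹ := by
        rw [Algebra.smul_def, pow_succ]
        field_simp
      rw [h2, neg_sub] at this
      exact this
    obtain ⟨L, hL⟩ := exists_valued_sub_le_exp v (fun k => p ^ k * α k) (by
      intro k
      have : p ^ (k + 1) * α (k + 1) - p ^ k * α k = p ^ k * (p * α (k + 1) - α k) := by ring
      rw [this]
      exact hmul k _ (hstep k))
    have hα0 : α 0 ∈ v.adicCompletionIntegers K := by
      have := hint 1 v
      simpa [hα] using this
    have hLk : ∀ k : ℕ, (p ^ k)⁻¹ * L - α k ∈ v.adicCompletionIntegers K := by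
      intro k
      have : (p ^ k)⁻¹ * L - α k = (p ^ k)⁻¹ * (L - p ^ k * α k) := by
        field_simp
      rw [this, mem_adicCompletionIntegers, map_mul, map_inv₀, hvp]
      calc _ ≤ (WithZero.exp (-(k : ℤ)))⁻¹ * WithZero.exp (-(k : ℤ)) := by gcongr; exact hL k
        _ = 1 := inv_mul_cancel₀ (by simp)
    refine ⟨L, ?_, fun x => ?_⟩
    · have := add_mem (hLk 0) hα0
      simpa using this
    · obtain ⟨k, s, c, hs, hsc⟩ := exists_notMem_mul_pow_eq v hπ x
      set σ : v.adicCompletion K := algebraMap K _ (algebraMap A K s) with hσ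
      have hvσ : Valued.v σ = 1 := by
        rw [hσ, valued_algebraMap, valuation_of_algebraMap, intValuation_eq_one_iff]
        exact hs
      have h1 : s • x = c • (algebraMap A K π ^ k)⁻¹ := by
        rw [Algebra.smul_def, Algebra.smul_def, ← hsc]
        field_simp
      have h2 : σ * algebraMap K _ x =
          algebraMap K (v.adicCompletion K) (algebraMap A K c) * (p ^ k)⁻¹ := by
        rw [hσ, hp, ← map_mul, ← map_pow, ← map_inv₀, ← map_mul, ← Algebra.smul_def, h1,
          Algebra.smul_def]
      have h3 : σ * (f x v - algebraMap K (v.adicCompletion K) x * L) ∈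
          v.adicCompletionIntegers K := by
        have e : σ * (f x v - algebraMap K (v.adicCompletion K) x * L) =
            (f (c • (algebraMap A K π ^ k)⁻¹) v -
              algebraMap K (v.adicCompletion K) (algebraMap A K c) * α k) -
            (f (s • x) v - σ * f x v) -
            algebraMap K (v.adicCompletion K) (algebraMap A K c) * ((p ^ k)⁻¹ * L - α k) := by
          rw [mul_sub, ← mul_assoc, h2, h1]
          ring
        rw [e]
        exact sub_mem (sub_mem (hsm _ _) (hsm _ _)) (mul_mem (hAint c) (hLk k))
      rw [mem_adicCompletionIntegers, map_mul, hvσ, one_mul] at h3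
      exact h3
  choose L hL hL' using hloc
  exact ⟨⟨L, Filter.Eventually.of_forall hL⟩, hL, fun x v => hL' v x⟩

end EndomorphismsOfTorsion

section LatticesAndAdeles

open IsDedekindDomain HeightOneSpectrum Matrix

lemma exists_GL_of_linearEquiv {K : Type*} [Field K] {n : ℕ}
    (e : (Fin n → K) ≃ₗ[K] (Fin n → K)) : ∃ γ : GL (Fin n) K, ∀ x, x ᵥ* γ.val = e x := by
  refine ⟨⟨LinearMap.toMatrixRight' e.toLinearMap, LinearMap.toMatrixRight' e.symm.toLinearMap,
    ?_, ?_⟩, fun x => ?_⟩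
  · rw [← LinearMap.toMatrixRight'_comp, LinearEquiv.symm_comp, LinearMap.toMatrixRight'_id]
  · rw [← LinearMap.toMatrixRight'_comp, LinearEquiv.comp_symm, LinearMap.toMatrixRight'_id]
  · change x ᵥ* (LinearMap.toMatrixRight' e.toLinearMap) = e x
    rw [← Matrix.toLinearMapRight'_apply]
    simp

variable {A K : Type*} [CommRing A] [IsDedekindDomain A] [Field K] [Algebra A K]
  [IsFractionRing A K] {n : ℕ}

lemma exists_smul_mem_of_span_eq_top {V : Type*} [AddCommGroup V] [Module A V] [Module K V]
    [IsScalarTower A K V] {Λ : Submodule A V} {x : V}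
    (hx : x ∈ Submodule.span K (Λ : Set V)) : ∃ d : A, d ≠ 0 ∧ d • x ∈ Λ := by
  induction hx using Submodule.span_induction with
  | mem x h => exact ⟨1, one_ne_zero, by simpa using h⟩
  | zero => exact ⟨1, one_ne_zero, by simp⟩
  | add x y _ _ hx hy =>
    obtain ⟨d, hd, h⟩ := hx
    obtain ⟨d', hd', h'⟩ := hy
    refine ⟨d * d', mul_ne_zero hd hd', ?_⟩
    rw [smul_add]
    refine add_mem ?_ ?_
    · rw [mul_comm, mul_smul]
      exact Λ.smul_mem _ h
    · rw [mul_smul]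
      exact Λ.smul_mem _ h'
  | smul a x _ hx =>
    obtain ⟨d, hd, h⟩ := hx
    obtain ⟨c, s, hs, rfl⟩ := IsFractionRing.div_surjective (A := A) a
    have hs0 := nonZeroDivisors.ne_zero hs
    refine ⟨s * d, mul_ne_zero hs0 hd, ?_⟩
    have : (s * d) • (algebraMap A K c / algebraMap A K s) • x = c • d • x := by
      have hsK : algebraMap A K s ≠ 0 := by simpa using hs0
      rw [← algebraMap_smul K (s * d), ← algebraMap_smul K c, ← algebraMap_smul K d, smul_smul,
        smul_smul, map_mul]
      congr 1
      field_simp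
    rw [this]
    exact Λ.smul_mem _ h

lemma exists_common_smul_mem_of_span_eq_top {ι V : Type*} [Finite ι] [AddCommGroup V] [Module A V]
    [Module K V] [IsScalarTower A K V] {Λ : Submodule A V}
    (hΛ : Submodule.span K (Λ : Set V) = ⊤) (x : ι → V) :
    ∃ d : A, d ≠ 0 ∧ ∀ i, d • x i ∈ Λ := by
  classical
  have := Fintype.ofFinite ι
  choose d hd hd' using fun i => exists_smul_mem_of_span_eq_top (A := A) (K := K) (Λ := Λ)
    (x := x i) (by rw [hΛ]; trivial)
  refine ⟨∏ i, d i, Finset.prod_ne_zero_iff.2 fun i _ => hd i, fun i => ?_⟩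
  rw [← Finset.prod_erase_mul _ _ (Finset.mem_univ i), mul_smul]
  exact Λ.smul_mem _ (hd' i)

variable (A K n) in
/-- The standard lattice `A^n` in `K^n`. -/
def stdLattice : Submodule A (Fin n → K) :=
  LinearMap.range ((Algebra.linearMap A K).compLeft (Fin n))

omit [IsDedekindDomain A] [IsFractionRing A K] in
lemma mem_stdLattice {x : Fin n → K} :
    x ∈ stdLattice A K n ↔ ∀ i, ∃ a, algebraMap A K a = x i := by
  constructor
  · rintro ⟨a, rfl⟩ i
    exact ⟨a i, rfl⟩
  · intro h
    choose a ha using h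
    exact ⟨a, funext ha⟩

omit [IsDedekindDomain A] [IsFractionRing A K] in
lemma stdLattice_fg : (stdLattice A K n).FG := by
  rw [stdLattice, LinearMap.range_eq_map]
  exact Submodule.FG.map _ Module.Finite.fg_top

lemma mem_stdLattice_iff_isIntVec {x : Fin n → K} :
    x ∈ stdLattice A K n ↔ IsIntVec (diagVec (A := A) x) := by
  rw [mem_stdLattice]
  exact forall_congr' fun i => algebraMap_mem_intAdeles_iff.symm

omit [IsDedekindDomain A] [IsFractionRing A K] in
lemma single_mem_stdLattice (i : Fin n) : (Pi.single i 1 : Fin n → K) ∈ stdLattice A K n := by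
  rw [mem_stdLattice]
  intro j
  by_cases h : j = i
  · subst h
    exact ⟨1, by simp⟩
  · exact ⟨0, by simp [h]⟩

omit [IsDedekindDomain A] in
lemma span_eq_top_of_single_mem {Λ : Submodule A (Fin n → K)} {d : A} (hd : d ≠ 0)
    (h : ∀ i, d • (Pi.single i 1 : Fin n → K) ∈ Λ) : Submodule.span K (Λ : Set (Fin n → K)) = ⊤ := by
  rw [eq_top_iff, ← (Pi.basisFun K (Fin n)).span_eq, Submodule.span_le]
  rintro _ ⟨i, rfl⟩
  rw [Pi.basisFun_apply]
  have hdK : algebraMap A K d ≠ 0 := by simpa using hd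
  have : (Pi.single i 1 : Fin n → K) = (algebraMap A K d)⁻¹ • d • (Pi.single i 1 : Fin n → K) := by
    rw [← algebraMap_smul K d, smul_smul, inv_mul_cancel₀ hdK, one_smul]
  rw [this]
  exact Submodule.smul_mem _ _ (Submodule.subset_span (h i))

/-- `x` lies in the localization of `Λ` at `v`. -/
def MemLocal (Λ : Submodule A (Fin n → K)) (v : HeightOneSpectrum A) (x : Fin n → K) : Prop :=
  ∃ s : A, s ∉ v.asIdeal ∧ s • x ∈ Λ

lemma mem_of_forall_memLocal {Λ : Submodule A (Fin n → K)}
    (hΛ : Submodule.span K (Λ : Set (Fin n → K)) = ⊤) {x : Fin n → K}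
    (h : ∀ v, MemLocal Λ v x) : x ∈ Λ := by
  set I : Ideal A := Λ.comap (LinearMap.toSpanSingleton A _ x) with hI
  have hmem : ∀ s, s ∈ I ↔ s • x ∈ Λ := fun s => Iff.rfl
  obtain ⟨d, hd, hdx⟩ := exists_smul_mem_of_span_eq_top (A := A) (K := K) (Λ := Λ) (x := x)
    (by rw [hΛ]; trivial)
  by_contra hx
  have hI1 : I ≠ ⊤ := fun h1 => hx <| by
    have : (1 : A) ∈ I := h1 ▸ Submodule.mem_top
    simpa [hmem] using this
  obtain ⟨m, hm, hIm⟩ := I.exists_le_maximal hI1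
  have hm0 : m ≠ ⊥ := by
    rintro rfl
    exact hd (hIm ((hmem d).2 hdx))
  obtain ⟨s, hs, hsx⟩ := h ⟨m, hm.isPrime, hm0⟩
  exact hs (hIm ((hmem s).2 hsx))

lemma mem_valuationSubringAtPrime {v : HeightOneSpectrum A} {x : K} :
    x ∈ valuationSubringAtPrime K v ↔ v.valuation K x ≤ 1 := by
  rw [valuationSubringAtPrime_eq_valuationSubring]
  rfl

lemma memLocal_iff_mem_span {Λ : Submodule A (Fin n → K)} {v : HeightOneSpectrum A}
    {x : Fin n → K} : MemLocal Λ v x ↔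
      x ∈ Submodule.span (valuationSubringAtPrime K v) (Λ : Set (Fin n → K)) := by
  constructor
  · rintro ⟨s, hs, hsx⟩
    have hs1 : v.valuation K (algebraMap A K s) = 1 := by
      rw [valuation_of_algebraMap, intValuation_eq_one_iff]
      exact hs
    have hs0 : algebraMap A K s ≠ 0 := by
      intro h
      simp [h] at hs1
    let t : valuationSubringAtPrime K v :=
      ⟨(algebraMap A K s)⁻¹, by rw [mem_valuationSubringAtPrime, map_inv₀, hs1, inv_one]⟩
    have : x = t • s • x := by
      change x = (algebraMap A K s)⁻¹ • s • x
      rw [← algebraMap_smul K s, smul_smul, inv_mul_cancel₀ hs0, one_smul]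
    rw [this]
    exact Submodule.smul_mem _ _ (Submodule.subset_span hsx)
  · intro hx
    induction hx using Submodule.span_induction with
    | mem x h => exact ⟨1, fun h => v.isPrime.ne_top ((Ideal.eq_top_iff_one _).2 h), by simpa⟩
    | zero => exact ⟨1, fun h => v.isPrime.ne_top ((Ideal.eq_top_iff_one _).2 h), by simp⟩
    | add x y _ _ hx hy =>
      obtain ⟨s, hs, h⟩ := hx
      obtain ⟨s', hs', h'⟩ := hy
      refine ⟨s * s', fun hmem => (v.isPrime.mem_or_mem hmem).elim hs hs', ?_⟩
      rw [smul_add]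
      refine add_mem ?_ ?_
      · rw [mul_comm, mul_smul]
        exact Λ.smul_mem _ h
      · rw [mul_smul]
        exact Λ.smul_mem _ h'
    | smul a x _ hx =>
      obtain ⟨s, hs, h⟩ := hx
      obtain ⟨c, t, hct⟩ := v.exists_primeCompl_mul_eq_of_integer _
        (mem_valuationSubringAtPrime.1 a.2)
      refine ⟨t * s, fun hmem => (v.isPrime.mem_or_mem hmem).elim t.2 hs, ?_⟩
      have : ((t : A) * s) • a • x = c • s • x := by
        change ((t : A) * s) • (a : K) • x = c • s • x
        rw [← algebraMap_smul K ((t : A) * s), ← algebraMap_smul K c, ← algebraMap_smul K s,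
          smul_smul, smul_smul, ← hct, map_mul]
        congr 1
        ring
      rw [this]
      exact Λ.smul_mem _ h

instance (v : HeightOneSpectrum A) : IsPrincipalIdealRing (valuationSubringAtPrime K v) :=
  have h : IsNoetherianRing (valuationSubringAtPrime K v) ↔
    IsPrincipalIdealRing (valuationSubringAtPrime K v) := IsBezout.TFAE.out 0 1
  h.1 inferInstance

/-- The localization of a lattice at `v` is free. -/
lemma exists_memLocal_iff {Λ : Submodule A (Fin n → K)} (hΛ : Submodule.IsLattice K Λ)
    (v : HeightOneSpectrum A) :
    ∃ γ : GL (Fin n) K, ∀ x, MemLocal Λ v x ↔ ∀ i, v.valuation K ((x ᵥ* γ.val) i) ≤ 1 := by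
  set O := valuationSubringAtPrime K v
  set M : Submodule O (Fin n → K) := Submodule.span O (Λ : Set (Fin n → K)) with hM
  have hlat : Submodule.IsLattice K M := by
    constructor
    · obtain ⟨S, hS⟩ := hΛ.fg
      exact ⟨S, by rw [hM, ← hS, Submodule.span_span_of_tower]⟩
    · rw [eq_top_iff, ← hΛ.span_eq_top]
      exact Submodule.span_mono Submodule.subset_span
  have : Module.Finite O M := Module.Finite.iff_fg.2 hlat.fg
  have hrank : Module.finrank O M = n := by
    simpa using Submodule.IsLattice.finrank_of_pi K M
  let b : Module.Basis (Fin n) O M := Module.finBasisOfFinrankEq O M hrank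
  let B : Module.Basis (Fin n) K (Fin n → K) := b.extendOfIsLattice K
  obtain ⟨γ, hγ⟩ := exists_GL_of_linearEquiv B.equivFun
  refine ⟨γ, fun x => ?_⟩
  rw [memLocal_iff_mem_span, hγ]
  have hsum : ∀ y : M, ∀ i, B.equivFun (y : Fin n → K) i = (b.equivFun y i : K) := by
    intro y i
    have h1 : (y : Fin n → K) = ∑ i, (b.equivFun y i : K) • B i := by
      conv_lhs => rw [← b.sum_equivFun y]
      rw [Submodule.coe_sum]
      refine Finset.sum_congr rfl fun i _ => ?_
      rw [Module.Basis.extendOfIsLattice_apply]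
      rfl
    rw [h1, ← Module.Basis.equivFun_symm_apply, LinearEquiv.apply_symm_apply]
  constructor
  · intro hx i
    rw [hsum ⟨x, hx⟩ i, ← mem_valuationSubringAtPrime]
    exact (b.equivFun ⟨x, hx⟩ i).2
  · intro h
    rw [← B.sum_equivFun x]
    refine Submodule.sum_mem _ fun i _ => ?_
    have : B.equivFun x i • B i =
        (⟨B.equivFun x i, mem_valuationSubringAtPrime.2 (h i)⟩ : O) • B i := rfl
    rw [this, Module.Basis.extendOfIsLattice_apply]
    exact Submodule.smul_mem _ _ (b i).2

lemma exists_smul_mem_stdLattice {Λ : Submodule A (Fin n → K)} (hΛ : Λ.FG) :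
    ∃ d : A, d ≠ 0 ∧ ∀ x ∈ Λ, d • x ∈ stdLattice A K n := by
  obtain ⟨S, hS⟩ := hΛ
  have hstd : Submodule.span K (stdLattice A K n : Set (Fin n → K)) = ⊤ :=
    span_eq_top_of_single_mem one_ne_zero fun i => by simpa using single_mem_stdLattice i
  obtain ⟨d, hd, hdS⟩ := exists_common_smul_mem_of_span_eq_top hstd (fun s : S => (s : Fin n → K))
  refine ⟨d, hd, fun x hx => ?_⟩
  rw [← hS] at hx
  have : Submodule.span A (S : Set (Fin n → K)) ≤
      (stdLattice A K n).comap (LinearMap.lsmul A _ d) :=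
    Submodule.span_le.2 fun s hs => hdS ⟨s, hs⟩
  exact this hx

/-- At almost all places a lattice coincides with the standard lattice. -/
lemma finite_not_memLocal_iff {Λ : Submodule A (Fin n → K)} (hΛ : Submodule.IsLattice K Λ) :
    {v : HeightOneSpectrum A |
      ¬ ∀ x, MemLocal Λ v x ↔ ∀ i, v.valuation K (x i) ≤ 1}.Finite := by
  obtain ⟨d, hd, hdΛ⟩ := exists_common_smul_mem_of_span_eq_top (A := A) hΛ.span_eq_top
    (fun i : Fin n => (Pi.single i 1 : Fin n → K))
  obtain ⟨d', hd', hdS'⟩ := exists_smul_mem_stdLattice hΛ.fg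
  refine (Ideal.finite_factors (I := Ideal.span {d * d'})
    (by simpa using ⟨hd, hd'⟩)).subset fun v hv => ?_
  by_contra hdvd
  have hnot : d * d' ∉ v.asIdeal := fun h => hdvd (Ideal.dvd_span_singleton.2 h)
  have hvd : d ∉ v.asIdeal := fun h => hnot (Ideal.mul_mem_right _ _ h)
  have hvd' : d' ∉ v.asIdeal := fun h => hnot (Ideal.mul_mem_left _ _ h)
  refine hv fun x => ⟨?_, fun hx => ?_⟩
  · rintro ⟨s, hs, hsx⟩ i
    obtain ⟨a, ha⟩ := mem_stdLattice.1 (hdS' _ hsx) i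
    have h1 : v.valuation K (algebraMap A K (d' * s)) = 1 := by
      rw [valuation_of_algebraMap, intValuation_eq_one_iff]
      exact fun hmem => (v.isPrime.mem_or_mem hmem).elim hvd' hs
    have h2 : algebraMap A K (d' * s) * x i = algebraMap A K a := by
      rw [ha, ← Algebra.smul_def, mul_smul]
      rfl
    have h3 : v.valuation K (x i) = v.valuation K (algebraMap A K a) := by
      rw [← h2, map_mul, h1, one_mul]
    rw [h3]
    exact v.valuation_le_one a
  · choose c t hct using fun i => v.exists_primeCompl_mul_eq_of_integer _ (hx i)
    refine ⟨d * ∏ i, (t i : A), ?_, ?_⟩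
    · intro hmem
      rcases v.isPrime.mem_or_mem hmem with h | h
      · exact hvd h
      · have := v.isPrime
        obtain ⟨i, -, hi⟩ := (Ideal.IsPrime.prod_mem_iff).1 h
        exact (t i).2 hi
    · have hx1 : (d * ∏ i, (t i : A)) • x = ∑ i, ((∏ j ∈ Finset.univ.erase i, (t j : A)) * c i) •
          d • (Pi.single i 1 : Fin n → K) := by
        funext k
        rw [Finset.sum_apply, Finset.sum_eq_single k]
        · simp only [Pi.smul_apply, Pi.single_eq_same]
          rw [← Finset.prod_erase_mul _ _ (Finset.mem_univ k)]
          simp only [Algebra.smul_def, map_mul, ← hct]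
          ring
        · intro i _ hik
          simp [hik.symm]
        · simp
      rw [hx1]
      exact Submodule.sum_mem _ fun i _ => Λ.smul_mem _ (hdΛ i)

/-- A family of matrices over `K`, almost all of them the identity, as an adelic matrix. -/
lemma exists_GL_of_family (γ : HeightOneSpectrum A → GL (Fin n) K) (hγ : {v | γ v ≠ 1}.Finite) :
    ∃ g : GL (Fin n) (FiniteAdeleRing A K), ∀ (v : HeightOneSpectrum A) i j,
      g.val i j v = algebraMap K (v.adicCompletion K) ((γ v).val i j) := by
  have hmem : ∀ γ : HeightOneSpectrum A → GL (Fin n) K, {v | γ v ≠ 1}.Finite → ∀ i j,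
      ∀ᶠ v in Filter.cofinite, algebraMap K (v.adicCompletion K) ((γ v).val i j) ∈
        v.adicCompletionIntegers K := by
    intro γ hγ i j
    refine hγ.subset fun v hv => ?_
    intro h1
    apply hv
    change algebraMap K (v.adicCompletion K) ((γ v).val i j) ∈ v.adicCompletionIntegers K
    rw [h1, Units.val_one, Matrix.one_apply]
    split_ifs
    · rw [map_one]; exact one_mem _
    · rw [map_zero]; exact zero_mem _
  have hγ' : {v | (γ v)⁻¹ ≠ 1}.Finite := by simpa using hγ
  let G : Matrix (Fin n) (Fin n) (FiniteAdeleRing A K) := fun i j =>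
    (⟨fun v => algebraMap K (v.adicCompletion K) ((γ v).val i j), hmem γ hγ i j⟩ :
      FiniteAdeleRing A K)
  let G' : Matrix (Fin n) (Fin n) (FiniteAdeleRing A K) := fun i j =>
    (⟨fun v => algebraMap K (v.adicCompletion K) (((γ v)⁻¹).val i j), hmem _ hγ' i j⟩ :
      FiniteAdeleRing A K)
  let ev : ∀ v : HeightOneSpectrum A, FiniteAdeleRing A K →+* v.adicCompletion K := fun v =>
    { toFun := fun a => a v
      map_one' := rfl
      map_mul' := fun _ _ => rfl
      map_zero' := rfl
      map_add' := fun _ _ => rfl }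
  have hev : ∀ M N : Matrix (Fin n) (Fin n) (FiniteAdeleRing A K),
      (∀ v, M.map (ev v) = N.map (ev v)) → M = N := by
    intro M N h
    ext1 i j
    exact FiniteAdeleRing.ext K fun v => congrFun (congrFun (h v) i) j
  have hG : ∀ v, G.map (ev v) = (γ v).val.map (algebraMap K (v.adicCompletion K)) := fun v => rfl
  have hG' : ∀ v, G'.map (ev v) = ((γ v)⁻¹).val.map (algebraMap K (v.adicCompletion K)) :=
    fun v => rfl
  have hone : ∀ v, (1 : Matrix (Fin n) (Fin n) (FiniteAdeleRing A K)).map (ev v) = 1 :=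
    fun v => Matrix.map_one _ (map_zero _) (map_one _)
  refine ⟨⟨G, G', hev _ _ fun v => ?_, hev _ _ fun v => ?_⟩, fun v i j => rfl⟩
  · rw [Matrix.map_mul, hG, hG', hone, ← Matrix.map_mul, ← Units.val_mul, mul_inv_cancel,
      Units.val_one, Matrix.map_one _ (map_zero _) (map_one _)]
  · rw [Matrix.map_mul, hG, hG', hone, ← Matrix.map_mul, ← Units.val_mul, inv_mul_cancel,
      Units.val_one, Matrix.map_one _ (map_zero _) (map_one _)]

/-- Every lattice in `K^n` is of the form `R^n g⁻¹ ∩ K^n`. -/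
lemma exists_mem_iff_memLat {Λ : Submodule A (Fin n → K)} (hΛ : Submodule.IsLattice K Λ) :
    ∃ g : GL (Fin n) (FiniteAdeleRing A K), ∀ x, x ∈ Λ ↔ MemLat g (diagVec x) := by
  classical
  choose γ₀ hγ₀ using exists_memLocal_iff hΛ
  have hfin := finite_not_memLocal_iff hΛ
  set γ : HeightOneSpectrum A → GL (Fin n) K := fun v => if v ∈ hfin.toFinset then γ₀ v else 1
    with hγdef
  have hγ : ∀ v x, MemLocal Λ v x ↔ ∀ i, v.valuation K ((x ᵥ* (γ v).val) i) ≤ 1 := by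
    intro v x
    by_cases hv : v ∈ hfin.toFinset
    · simp only [hγdef, if_pos hv]
      exact hγ₀ v x
    · simp only [hγdef, if_neg hv, Units.val_one, Matrix.vecMul_one]
      simp only [Set.Finite.mem_toFinset, Set.mem_ofPred_eq, not_not] at hv
      exact hv x
  obtain ⟨g, hg⟩ := exists_GL_of_family γ (hfin.subset fun v hv => by
    by_contra h
    refine hv ?_
    have : v ∉ hfin.toFinset := by simpa using h
    simp only [hγdef, if_neg this])
  refine ⟨g, fun x => ?_⟩
  have hv : MemLat g (diagVec x) ↔ ∀ v, MemLocal Λ v x := by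
    rw [memLat_iff]
    simp only [hγ]
    have hval : ∀ (v : HeightOneSpectrum A) i, (diagVec (A := A) x ᵥ* g.val) i v =
        algebraMap K (v.adicCompletion K) ((x ᵥ* (γ v).val) i) := by
      intro v i
      let ev : FiniteAdeleRing A K →+* v.adicCompletion K :=
        { toFun := fun a => a v
          map_one' := rfl
          map_mul' := fun _ _ => rfl
          map_zero' := rfl
          map_add' := fun _ _ => rfl }
      have h1 : ev ((diagVec (A := A) x ᵥ* g.val) i) =
          ((ev ∘ diagVec (A := A) x) ᵥ* g.val.map ev) i := RingHom.map_vecMul ev _ _ _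
      have h2 : g.val.map ev = (γ v).val.map (algebraMap K (v.adicCompletion K)) :=
        Matrix.ext fun i j => hg v i j
      rw [RingHom.map_vecMul, ← h2]
      exact h1
    constructor
    · intro h v i
      have := h i v
      rw [hval, mem_adicCompletionIntegers, valued_algebraMap] at this
      exact this
    · intro h i v
      rw [hval, mem_adicCompletionIntegers, valued_algebraMap]
      exact h v i
  rw [hv]
  exact ⟨fun hx v => ⟨1, fun h => v.isPrime.ne_top ((Ideal.eq_top_iff_one _).2 h), by simpa⟩,
    mem_of_forall_memLocal hΛ.span_eq_top⟩

end LatticesAndAdeles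

section Labels

variable {A K : Type*} [CommRing A] [Field K] [Algebra A K]
  {V : Type*} [AddCommGroup V] [Module A V] [Module K V] [IsScalarTower A K V] {n : ℕ}

variable (A K n) in
/-- The projection `K^n → (K/A)^n`. -/
def torsionMk : (Fin n → K) →ₗ[A] TorsionPts A K n :=
  LinearMap.pi fun i => (LinearMap.range (Algebra.linearMap A K)).mkQ ∘ₗ LinearMap.proj i

lemma torsionMk_apply (x : Fin n → K) :
    torsionMk A K n x = fun i => Submodule.Quotient.mk (x i) := rfl

lemma torsionMk_surjective : Function.Surjective (torsionMk A K n) := by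
  intro t
  choose x hx using fun i => Submodule.Quotient.mk_surjective _ (t i)
  exact ⟨x, funext hx⟩

lemma torsionMk_eq_zero_iff {x : Fin n → K} : torsionMk A K n x = 0 ↔ x ∈ stdLattice A K n := by
  rw [torsionMk_apply, funext_iff, stdLattice]
  simp only [Pi.zero_apply, Submodule.Quotient.mk_eq_zero]
  constructor
  · intro h
    choose a ha using h
    exact ⟨a, funext ha⟩
  · rintro ⟨a, rfl⟩ i
    exact ⟨a i, rfl⟩

lemma exists_labelling {Λ : Submodule A V} (F : (Fin n → K) →ₗ[A] V ⧸ Λ)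
    (hA : ∀ x ∈ stdLattice A K n, F x = 0) (hF : ∀ x, F x ∈ spanQuot K Λ) :
    ∃ φ : TorsionPts A K n →ₗ[A] spanQuot K Λ, ∀ x, (φ (torsionMk A K n x) : V ⧸ Λ) = F x := by
  let G : (Fin n → K) →ₗ[A] spanQuot K Λ := F.codRestrict _ hF
  have hker : LinearMap.ker (torsionMk A K n) ≤ LinearMap.ker G := by
    intro x hx
    exact Subtype.ext (hA x (torsionMk_eq_zero_iff.1 hx))
  refine ⟨(LinearMap.ker (torsionMk A K n)).liftQ G hker ∘ₗ
    ((torsionMk A K n).quotKerEquivOfSurjective torsionMk_surjective).symm.toLinearMap,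
    fun x => ?_⟩
  have : ((torsionMk A K n).quotKerEquivOfSurjective torsionMk_surjective).symm
      (torsionMk A K n x) = Submodule.Quotient.mk x := by
    rw [LinearEquiv.symm_apply_eq]
    rfl
  rw [LinearMap.comp_apply, LinearEquiv.coe_coe, this, Submodule.liftQ_apply]
  rfl

namespace LabelledModule

variable {L : LabelledModule A K V n} {t t' : TorsionPts A K n} {v v' : V}

lemma Maps.iff_sub_mem (h : L.Maps t v) : L.Maps t v' ↔ v - v' ∈ L.lat := by
  rw [LabelledModule.Maps] at *
  rw [h, Submodule.Quotient.eq]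

lemma Maps.add (h : L.Maps t v) (h' : L.Maps t' v') : L.Maps (t + t') (v + v') := by
  rw [LabelledModule.Maps] at *
  rw [map_add, Submodule.coe_add, h, h', Submodule.Quotient.mk_add]

lemma Maps.smul (a : A) (h : L.Maps t v) : L.Maps (a • t) (a • v) := by
  rw [LabelledModule.Maps] at *
  rw [map_smul, Submodule.coe_smul, h, Submodule.Quotient.mk_smul]

lemma maps_zero_iff : L.Maps 0 v ↔ v ∈ L.lat := by
  rw [LabelledModule.Maps, map_zero, Submodule.coe_zero, eq_comm, Submodule.Quotient.mk_eq_zero]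

lemma Maps.sum {ι : Type*} (s : Finset ι) {t : ι → TorsionPts A K n} {v : ι → V}
    (h : ∀ i ∈ s, L.Maps (t i) (v i)) : L.Maps (∑ i ∈ s, t i) (∑ i ∈ s, v i) := by
  classical
  induction s using Finset.induction_on with
  | empty => simpa using maps_zero_iff.2 (zero_mem _)
  | insert i s hi ih =>
    rw [Finset.sum_insert hi, Finset.sum_insert hi]
    exact (h i (Finset.mem_insert_self _ _)).add
      (ih fun j hj => h j (Finset.mem_insert_of_mem hj))

end LabelledModule

end Labels

section Representations

open IsDedekindDomain Matrix LabelledModule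

variable {A K : Type*} [CommRing A] [IsDedekindDomain A] [Field K] [Algebra A K]
  [IsFractionRing A K] {n : ℕ}

lemma rhoInv_mul (g : GL (Fin n) (FiniteAdeleRing A K))
    (ρ : Matrix (Fin n) (Fin n) (intAdeles A K)) : rhoInv g ρ * g.val = inclMat ρ := by
  rw [rhoInv, Matrix.mul_assoc, ← Units.val_mul, inv_mul_cancel, Units.val_one, Matrix.mul_one]

variable {g g' : GL (Fin n) (FiniteAdeleRing A K)}
  {ρ ρ' : Matrix (Fin n) (Fin n) (intAdeles A K)} {L L' : LabelledModule A K (Fin n → K) n}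

lemma Represents.maps_iff (h : Represents g ρ L) {x y : Fin n → K} :
    L.Maps (torsionMk A K n x) y ↔ MemLat g (diagVec y - diagVec x ᵥ* rhoInv g ρ) := by
  refine ⟨h.2 x y, fun hy => ?_⟩
  obtain ⟨y₀, hy₀⟩ := L.exists_maps (torsionMk A K n x)
  rw [hy₀.iff_sub_mem, h.1, diagVec_sub]
  convert (h.2 x y₀ hy₀).sub hy using 1
  abel

/-- The lattice `R^n g⁻¹ ∩ K^n`. -/
def adelicLattice (g : GL (Fin n) (FiniteAdeleRing A K)) : Submodule A (Fin n → K) where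
  carrier := {y | MemLat g (diagVec y)}
  add_mem' h h' := by
    rw [Set.mem_ofPred_eq, diagVec_add]
    exact MemLat.add h h'
  zero_mem' := by
    rw [Set.mem_ofPred_eq, diagVec_zero]
    exact MemLat.zero
  smul_mem' a x h := by
    rw [Set.mem_ofPred_eq, diagVec_smul]
    exact MemLat.smul a h

lemma mem_adelicLattice {y : Fin n → K} : y ∈ adelicLattice g ↔ MemLat g (diagVec y) := Iff.rfl

lemma isLattice_adelicLattice (g : GL (Fin n) (FiniteAdeleRing A K)) :
    Submodule.IsLattice K (adelicLattice g) := by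
  obtain ⟨d, hd, hdg⟩ := exists_smul_memLat g
  obtain ⟨d', hd', hdg'⟩ := exists_smul_isIntVec g
  constructor
  · have hd'K : algebraMap A K d' ≠ 0 := by simpa using hd'
    let f : (Fin n → K) →ₗ[A] (Fin n → K) :=
      (LinearMap.lsmul K (Fin n → K) (algebraMap A K d')⁻¹).restrictScalars A
    refine Submodule.FG.of_le (stdLattice_fg.map f) fun y hy => ⟨d' • y, ?_, ?_⟩
    · have := hdg' _ (mem_adelicLattice.1 hy)
      rw [← diagVec_smul] at this
      exact mem_stdLattice_iff_isIntVec.2 this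
    · change (algebraMap A K d')⁻¹ • d' • y = y
      rw [← algebraMap_smul K d', smul_smul, inv_mul_cancel₀ hd'K, one_smul]
  · refine span_eq_top_of_single_mem hd fun i => ?_
    rw [mem_adelicLattice, diagVec_smul]
    exact hdg _ (mem_stdLattice_iff_isIntVec.1 (single_mem_stdLattice i))

omit [IsDedekindDomain A] [IsFractionRing A K] in
lemma spanQuot_eq_top {Λ : Submodule A (Fin n → K)}
    (h : Submodule.span K (Λ : Set (Fin n → K)) = ⊤) : spanQuot K Λ = ⊤ := by
  rw [spanQuot, h, Submodule.restrictScalars_top, Submodule.map_top, Submodule.range_mkQ]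

lemma exists_represents (g : GL (Fin n) (FiniteAdeleRing A K))
    (ρ : Matrix (Fin n) (Fin n) (intAdeles A K)) :
    ∃ L : RationalLattice A K n, Represents g ρ L.1 := by
  have hlat := isLattice_adelicLattice g
  choose Y hY using fun x : Fin n → K => exists_sub_diagVec_memLat g (diagVec x ᵥ* rhoInv g ρ)
  have hYeq : ∀ x y, MemLat g (diagVec x ᵥ* rhoInv g ρ - diagVec y) →
      (Submodule.Quotient.mk (Y x) : _ ⧸ adelicLattice g) = Submodule.Quotient.mk y := by
    intro x y h
    rw [Submodule.Quotient.eq, mem_adelicLattice, diagVec_sub]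
    convert h.sub (hY x) using 1
    abel
  let F : (Fin n → K) →ₗ[A] (Fin n → K) ⧸ adelicLattice g :=
    { toFun := fun x => Submodule.Quotient.mk (Y x)
      map_add' := fun x x' => by
        rw [← Submodule.Quotient.mk_add]
        refine hYeq _ _ ?_
        rw [diagVec_add, diagVec_add, Matrix.add_vecMul]
        convert (hY x).add (hY x') using 1
        abel
      map_smul' := fun a x => by
        rw [RingHom.id_apply, ← Submodule.Quotient.mk_smul]
        refine hYeq _ _ ?_
        rw [diagVec_smul, diagVec_smul, Matrix.smul_vecMul, ← smul_sub]
        exact (hY x).smul a }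
  obtain ⟨φ, hφ⟩ := exists_labelling F (fun x hx => by
    refine (hYeq x 0 ?_).trans (Submodule.Quotient.mk_zero _)
    rw [diagVec_zero, sub_zero, memLat_iff, Matrix.vecMul_vecMul, rhoInv_mul]
    exact (mem_stdLattice_iff_isIntVec.1 hx).vecMul (isIntMat_inclMat ρ))
    (fun x => by rw [spanQuot_eq_top hlat.span_eq_top]; trivial)
  refine ⟨⟨⟨adelicLattice g, φ⟩, hlat⟩, fun y => Iff.rfl, fun x y hxy => ?_⟩
  have h1 : (Submodule.Quotient.mk (Y x) : _ ⧸ adelicLattice g) = Submodule.Quotient.mk y :=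
    (hφ x).symm.trans hxy
  rw [eq_comm, Submodule.Quotient.eq, mem_adelicLattice, diagVec_sub] at h1
  convert h1.sub (hY x) using 1
  abel

lemma exists_represents_of_lattice (L : RationalLattice A K n) :
    ∃ g ρ, Represents g ρ L.1 := by
  obtain ⟨L, hL⟩ := L
  obtain ⟨g, hg⟩ := exists_mem_iff_memLat hL
  choose Y hY using fun x : Fin n → K => L.exists_maps (torsionMk A K n x)
  have hint : ∀ y ∈ L.lat, IsIntVec (diagVec y ᵥ* g.val) := fun y hy =>
    memLat_iff.1 ((hg y).1 hy)
  have hρ : ∀ i j, ∃ r ∈ intAdeles A K, ∀ x : K, (diagVec (Y (Pi.single i x)) ᵥ* g.val) j -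
      algebraMap K _ x * r ∈ intAdeles A K := by
    intro i j
    refine exists_intAdele_of_linear_mod
      (fun x => (diagVec (Y (Pi.single i x)) ᵥ* g.val) j) (fun a x => ?_) (fun a => ?_)
    · have h1 := ((hY (Pi.single i x)).smul a)
      have h2 := hY (Pi.single i (a • x))
      rw [← map_smul, ← Pi.single_smul, h2.iff_sub_mem] at h1
      have h3 := hint _ h1 j
      rw [diagVec_sub, diagVec_smul, Matrix.sub_vecMul, Matrix.smul_vecMul] at h3
      exact h3
    · refine hint _ ?_ j
      rw [← maps_zero_iff]
      have : torsionMk A K n (Pi.single i (algebraMap A K a)) = 0 := by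
        rw [torsionMk_eq_zero_iff, mem_stdLattice]
        intro k
        by_cases hk : k = i
        · subst hk
          exact ⟨a, by simp⟩
        · exact ⟨0, by simp [hk]⟩
      rw [← this]
      exact hY _
  choose r hr hr' using hρ
  refine ⟨g, Matrix.of fun i j => ⟨r i j, hr i j⟩, hg, fun x y hxy => ?_⟩
  rw [memLat_iff, Matrix.sub_vecMul, Matrix.vecMul_vecMul, rhoInv_mul]
  have hsum : L.Maps (torsionMk A K n x) (∑ i, Y (Pi.single i (x i))) := by
    have h1 : torsionMk A K n x = ∑ i, torsionMk A K n (Pi.single i (x i)) := by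
      rw [← map_sum, Finset.univ_sum_single]
    rw [h1]
    exact Maps.sum _ fun i _ => hY _
  have h2 := hint _ ((Maps.iff_sub_mem hxy).1 hsum)
  have hdsum : ∀ z : Fin n → Fin n → K, diagVec (A := A) (∑ i, z i) = ∑ i, diagVec (z i) := by
    intro z
    funext k
    simp [diagVec]
  rw [diagVec_sub, Matrix.sub_vecMul, hdsum, Matrix.sum_vecMul] at h2
  have h3 : IsIntVec (∑ i, diagVec (Y (Pi.single i (x i))) ᵥ* g.val -
      diagVec x ᵥ* inclMat (Matrix.of fun i j => ⟨r i j, hr i j⟩)) := by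
    intro j
    rw [Pi.sub_apply, Finset.sum_apply]
    change _ - ∑ i, diagVec x i * r i j ∈ _
    rw [← Finset.sum_sub_distrib]
    exact sum_mem fun i _ => hr' i j (x i)
  have := h2.add h3
  rw [sub_add_sub_cancel] at this
  exact this

lemma memLat_mul_inclGL (m : GL (Fin n) (intAdeles A K)) {w : Fin n → FiniteAdeleRing A K} :
    MemLat (g * inclGL m) w ↔ MemLat g w := by
  rw [memLat_iff, memLat_iff, Units.val_mul, ← Matrix.vecMul_vecMul]
  refine ⟨fun h => ?_, fun h => h.vecMul (isIntMat_inclGL m)⟩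
  have := h.vecMul (isIntMat_inclGL m⁻¹)
  rwa [inclGL_inv, Matrix.vecMul_vecMul, ← Units.val_mul, mul_inv_cancel, Units.val_one,
    Matrix.vecMul_one] at this

lemma isIntMat_inv_mul (h : ∀ w, MemLat g w → MemLat g' w) : IsIntMat (g⁻¹ * g').val := by
  intro i
  have h1 : MemLat g (Pi.single i 1 ᵥ* (g⁻¹).val) := by
    rw [memLat_iff, Matrix.vecMul_vecMul, ← Units.val_mul, inv_mul_cancel, Units.val_one,
      Matrix.vecMul_one]
    intro j
    by_cases hj : j = i
    · subst hj
      simp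
    · simp [hj]
  have h2 := memLat_iff.1 (h _ h1)
  rw [Matrix.vecMul_vecMul, ← Units.val_mul, Matrix.single_one_vecMul] at h2
  exact h2

lemma exists_eq_mul_inclGL (h : ∀ w, MemLat g' w ↔ MemLat g w) : ∃ m, g' = g * inclGL m := by
  obtain ⟨m, hm⟩ := exists_inclGL (g := g⁻¹ * g') (isIntMat_inv_mul fun w => (h w).2)
    (by
      rw [_root_.mul_inv_rev, inv_inv]
      exact isIntMat_inv_mul fun w => (h w).1)
  exact ⟨m, by rw [hm, mul_inv_cancel_left]⟩

/-- The data `(γ, m)` relating two pairs `(g, ρ)`, with `m` eliminated. -/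
lemma exists_inclGL_iff {γ : GL (Fin n) K} :
    (∃ m : GL (Fin n) (intAdeles A K), g' = diagGL γ * g * inclGL m ∧ ρ' = ρ * m.val) ↔
      (∀ w, MemLat g' w ↔ MemLat (diagGL γ * g) w) ∧
        rhoInv g' ρ' = rhoInv g ρ * ((diagGL γ)⁻¹ : GL (Fin n) (FiniteAdeleRing A K)).val := by
  constructor
  · rintro ⟨m, rfl, rfl⟩
    exact ⟨fun w => memLat_mul_inclGL m, rhoInv_act γ m g ρ⟩
  · rintro ⟨h, h'⟩
    obtain ⟨m, rfl⟩ := exists_eq_mul_inclGL h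
    refine ⟨m, rfl, inclMat_injective ?_⟩
    rw [← rhoInv_mul (diagGL γ * g * inclGL m), h', inclMat_mul_val, ← rhoInv_mul g,
      Matrix.mul_assoc, Matrix.mul_assoc, ← Units.val_mul, ← Units.val_mul]
    congr 2
    group

omit [IsDedekindDomain A] [IsFractionRing A K] in
lemma mem_map_rowMul_iff (γ : GL (Fin n) K) {Λ : Submodule A (Fin n → K)} {y : Fin n → K} :
    y ∈ Λ.map ((rowMul γ).restrictScalars A) ↔ y ᵥ* (γ⁻¹).val ∈ Λ := by
  constructor
  · rintro ⟨x, hx, rfl⟩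
    change (x ᵥ* γ.val) ᵥ* (γ⁻¹).val ∈ Λ
    rwa [Matrix.vecMul_vecMul, ← Units.val_mul, mul_inv_cancel, Units.val_one, Matrix.vecMul_one]
  · intro h
    refine ⟨_, h, ?_⟩
    change (y ᵥ* (γ⁻¹).val) ᵥ* γ.val = y
    rw [Matrix.vecMul_vecMul, ← Units.val_mul, inv_mul_cancel, Units.val_one, Matrix.vecMul_one]

lemma Represents.mem_map_iff (h : Represents g ρ L) (γ : GL (Fin n) K) {y : Fin n → K} :
    y ∈ L.lat.map ((rowMul γ).restrictScalars A) ↔ MemLat (diagGL γ⁻¹ * g) (diagVec y) := by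
  rw [mem_map_rowMul_iff, h.1, memLat_mul_iff, diagVec_vecMul]

lemma memLat_vecMul_diagGL (γ : GL (Fin n) K) {w : Fin n → FiniteAdeleRing A K} :
    MemLat (diagGL γ⁻¹ * g) (w ᵥ* (diagGL γ).val) ↔ MemLat g w := by
  rw [memLat_mul_iff, Matrix.vecMul_vecMul, ← Units.val_mul, ← diagGL_mul, mul_inv_cancel,
    diagGL_one, Units.val_one, Matrix.vecMul_one]

lemma eq_of_forall_memLat_add {u u' : Matrix (Fin n) (Fin n) (FiniteAdeleRing A K)}
    (h : ∀ x : Fin n → K, ∃ w w', MemLat g w ∧ MemLat g' w' ∧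
      diagVec x ᵥ* u - diagVec x ᵥ* u' = w + w') : u = u' := by
  obtain ⟨d, hd, hdg⟩ := exists_smul_isIntVec g
  obtain ⟨d', hd', hdg'⟩ := exists_smul_isIntVec g'
  refine sub_eq_zero.1 (eq_zero_of_isIntVec_smul (mul_ne_zero hd hd') fun x => ?_)
  obtain ⟨w, w', hw, hw', h⟩ := h x
  rw [Matrix.vecMul_sub, h, smul_add]
  refine IsIntVec.add ?_ ?_
  · rw [mul_comm, mul_smul]
    exact (hdg _ hw).smul d'
  · rw [mul_smul]
    exact (hdg' _ hw').smul d

lemma Represents.carries_iff (h : Represents g ρ L) (h' : Represents g' ρ' L')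
    (γ : GL (Fin n) K) : Carries (rowMul γ) L L' ↔
      (∀ w, MemLat g' w ↔ MemLat (diagGL γ⁻¹ * g) w) ∧
        rhoInv g' ρ' = rhoInv g ρ * (diagGL γ).val := by
  constructor
  · rintro ⟨hlat, hmaps⟩
    have hK : ∀ y : Fin n → K, MemLat g' (diagVec y) ↔ MemLat (diagGL γ⁻¹ * g) (diagVec y) := by
      intro y
      rw [← h'.1, hlat, h.mem_map_iff]
    have hw : ∀ w, MemLat g' w ↔ MemLat (diagGL γ⁻¹ * g) w := fun w =>
      ⟨memLat_of_forall_diagVec fun x => (hK x).1, memLat_of_forall_diagVec fun x => (hK x).2⟩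
    refine ⟨hw, eq_of_forall_memLat_add (g := g') (g' := g') fun x => ?_⟩
    obtain ⟨y, hy⟩ := L.exists_maps (torsionMk A K n x)
    have h1 := h'.maps_iff.1 (hmaps _ _ hy)
    have h2 := (hw _).2 ((memLat_vecMul_diagGL γ).2 (h.maps_iff.1 hy))
    refine ⟨_, 0, h2.sub h1, MemLat.zero, ?_⟩
    have h3 : diagVec (A := A) (rowMul γ y) = diagVec y ᵥ* (diagGL γ).val := diagVec_vecMul y γ
    rw [h3, Matrix.sub_vecMul, Matrix.vecMul_vecMul]
    abel
  · rintro ⟨hw, hu⟩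
    constructor
    · ext y
      rw [h'.1, hw, h.mem_map_iff]
    · intro t y hy
      obtain ⟨x, rfl⟩ := torsionMk_surjective t
      rw [h'.maps_iff, hw]
      have h3 : diagVec (A := A) (rowMul γ y) = diagVec y ᵥ* (diagGL γ).val := diagVec_vecMul y γ
      rw [h3, hu, ← Matrix.vecMul_vecMul, ← Matrix.sub_vecMul, memLat_vecMul_diagGL]
      exact h.maps_iff.1 hy

omit [IsDedekindDomain A] [IsFractionRing A K] in
lemma span_map_rowMul {Λ : Submodule A (Fin n → K)}
    (hΛ : Submodule.span K (Λ : Set (Fin n → K)) = ⊤) (γ : GL (Fin n) K) :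
    Submodule.span K (Λ.map ((rowMul γ).restrictScalars A) : Set (Fin n → K)) = ⊤ := by
  rw [Submodule.map_coe]
  change Submodule.span K (rowMul γ '' Λ) = ⊤
  rw [← Submodule.map_span, hΛ, Submodule.map_top, LinearMap.range_eq_top]
  intro y
  refine ⟨y ᵥ* (γ⁻¹).val, ?_⟩
  change (y ᵥ* (γ⁻¹).val) ᵥ* γ.val = y
  rw [Matrix.vecMul_vecMul, ← Units.val_mul, inv_mul_cancel, Units.val_one, Matrix.vecMul_one]

lemma Represents.commVia_iff (h : Represents g ρ L) (h' : Represents g' ρ' L')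
    (hL : Submodule.IsLattice K L.lat) (hL' : Submodule.IsLattice K L'.lat)
    (γ : GL (Fin n) K) : CommVia (rowMul γ) L L' ↔
        rhoInv g' ρ' = rhoInv g ρ * (diagGL γ).val := by
  have hd : ∀ y, diagVec (A := A) (rowMul γ y) = diagVec y ᵥ* (diagGL γ).val :=
    fun y => diagVec_vecMul y γ
  constructor
  · rintro ⟨-, hmaps⟩
    symm
    refine eq_of_forall_memLat_add (g := diagGL γ⁻¹ * g) (g' := g') fun x => ?_
    obtain ⟨y, hy⟩ := L.exists_maps (torsionMk A K n x)
    obtain ⟨y', hy'⟩ := L'.exists_maps (torsionMk A K n x)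
    obtain ⟨z, hz, z', hz', hzz⟩ := Submodule.mem_sup.1 (hmaps _ _ _ hy hy')
    have h1 := h'.maps_iff.1 hy'
    have h2 := (memLat_vecMul_diagGL γ).2 (h.maps_iff.1 hy)
    have h3 := (h.mem_map_iff γ).1 hz
    have h4 := (h'.1 _).1 hz'
    refine ⟨_, _, h3.sub h2, h4.add h1, ?_⟩
    have h5 := congrArg (diagVec (A := A)) hzz
    rw [diagVec_add, diagVec_sub, hd] at h5
    rw [Matrix.sub_vecMul, Matrix.vecMul_vecMul, eq_sub_iff_add_eq'.2 h5]
    abel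
  · intro hu
    refine ⟨by rw [span_map_rowMul hL.span_eq_top, hL'.span_eq_top], fun t y y' hy hy' => ?_⟩
    obtain ⟨x, rfl⟩ := torsionMk_surjective t
    have h1 := h'.maps_iff.1 hy'
    have h2 := (memLat_vecMul_diagGL γ).2 (h.maps_iff.1 hy)
    obtain ⟨z, z', hz, hz', hzz⟩ := exists_add_of_memLat_add (y := rowMul γ y - y') h2
      (g' := g') (w' := -(diagVec y' - diagVec x ᵥ* rhoInv g' ρ'))
      (by simpa using MemLat.zero.sub h1) (by
        rw [diagVec_sub, hd, hu, Matrix.sub_vecMul, Matrix.vecMul_vecMul]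
        abel)
    rw [hzz]
    exact Submodule.add_mem_sup ((h.mem_map_iff γ).2 hz) ((h'.1 _).2 hz')

lemma exists_rhoInv_eq (u : Matrix (Fin n) (Fin n) (FiniteAdeleRing A K)) :
    ∃ g ρ, rhoInv g ρ = u := by
  obtain ⟨d, hd, hdu⟩ := exists_smul_isIntMat u
  obtain ⟨ρ, hρ⟩ := hdu.exists_inclMat
  obtain ⟨a, ha⟩ := isUnit_algebraMap (K := K) hd
  refine ⟨Units.map (Matrix.scalar (Fin n)).toMonoidHom a, ρ, ?_⟩
  have h1 : (Units.map (Matrix.scalar (Fin n)).toMonoidHom a).val =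
      d • (1 : Matrix (Fin n) (Fin n) (FiniteAdeleRing A K)) := by
    change Matrix.scalar (Fin n) a.val = _
    rw [ha]
    ext i j
    by_cases hij : i = j
    · subst hij
      simp [Matrix.scalar_apply, Algebra.smul_def]
    · simp [Matrix.scalar_apply, hij]
  rw [rhoInv, hρ, Units.mul_inv_eq_iff_eq_mul, h1, Matrix.mul_smul, Matrix.mul_one]

end Representations

section Abstract

/-- A correspondence compatible with two equivalence relations induces a bijection of the
quotients. -/
lemma exists_quotient_equiv {X Y : Type*} [sX : Setoid X] [sY : Setoid Y] (Rep : X → Y → Prop)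
    (hl : ∀ x, ∃ y, Rep x y) (hr : ∀ y, ∃ x, Rep x y)
    (h : ∀ x x' y y', Rep x y → Rep x' y' → (x ≈ x' ↔ y ≈ y')) :
    ∃ p : Quotient sX ≃ Quotient sY, ∀ x y, Rep x y → p ⟦x⟧ = ⟦y⟧ := by
  choose f hf using hl
  let F : Quotient sX → Quotient sY :=
    Quotient.map f fun x x' hx => (h x x' _ _ (hf x) (hf x')).1 hx
  have hF : ∀ x y, Rep x y → F ⟦x⟧ = ⟦y⟧ := fun x y hxy =>
    Quotient.sound ((h x x _ _ (hf x) hxy).1 (Setoid.refl x))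
  have hbij : Function.Bijective F := by
    constructor
    · intro a b hab
      induction a using Quotient.inductionOn with | h x =>
      induction b using Quotient.inductionOn with | h x' =>
      exact Quotient.sound ((h x x' _ _ (hf x) (hf x')).2 (Quotient.exact hab))
    · intro b
      induction b using Quotient.inductionOn with | h y =>
      obtain ⟨x, hx⟩ := hr y
      exact ⟨⟦x⟧, hF x y hx⟩
  exact ⟨Equiv.ofBijective F hbij, hF⟩

/-- A relation that is the kernel of a surjection is an equivalence relation, and the surjection
induces a bijection of the quotient. -/
lemma equivalence_and_exists_equiv {Q Y Z : Type*} (p : Q ≃ Y) (r : Y → Y → Prop) (T : Q → Z)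
    (hT : Function.Surjective T) (h : ∀ a b, r (p a) (p b) ↔ T a = T b) :
    Equivalence r ∧ ∃ e : Quot r ≃ Z, ∀ d, e (Quot.mk _ (p d)) = T d := by
  have h' : ∀ a b, r a b ↔ T (p.symm a) = T (p.symm b) := fun a b => by
    rw [← h, p.apply_symm_apply, p.apply_symm_apply]
  have heq : Equivalence r :=
    ⟨fun a => (h' a a).2 rfl, fun {a b} hab => (h' b a).2 ((h' a b).1 hab).symm,
      fun {a b c} hab hbc => (h' a c).2 (((h' a b).1 hab).trans ((h' b c).1 hbc))⟩
  refine ⟨heq, ?_⟩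
  let E : Quot r → Z := Quot.lift (fun a => T (p.symm a)) fun a b => (h' a b).1
  have hE : Function.Bijective E := by
    constructor
    · intro a b hab
      induction a using Quot.inductionOn with | h a =>
      induction b using Quot.inductionOn with | h b =>
      exact Quot.sound ((h' a b).2 hab)
    · intro z
      obtain ⟨q, hq⟩ := hT z
      exact ⟨Quot.mk _ (p q), by change T (p.symm (p q)) = z; rw [p.symm_apply_apply, hq]⟩
  refine ⟨Equiv.ofBijective E hE, fun d => ?_⟩
  change T (p.symm (p d)) = T d
  rw [p.symm_apply_apply]

end Abstract

section RationalPart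

open IsDedekindDomain

variable (A K : Type*) [CommRing A] [IsDedekindDomain A] [Field K] [Algebra A K]
  [IsFractionRing A K] (n : ℕ)

lemma Theta_surjective : Function.Surjective (Theta A K n) := by
  intro z
  induction z using Quotient.inductionOn with | h u =>
  obtain ⟨g, ρ, h⟩ := exists_rhoInv_eq u
  exact ⟨⟦(g, ρ)⟧, congrArg (Quotient.mk _) h⟩

theorem rational_classification :
    Equivalence (RationalComm (A := A) (K := K) (n := n)) ∧
      ∃ p : DoubleQuot A K n ≃ RationalClass A K n,
        (∀ g ρ, ∃ L : RationalLattice A K n, Represents g ρ L.1 ∧ p ⟦(g, ρ)⟧ = ⟦L⟧) ∧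
        ∃ e : RationalCommClass A K n ≃ MatQuot A K n,
          ∀ d, e (Quot.mk _ (p d)) = Theta A K n d := by
  obtain ⟨p, hp⟩ := exists_quotient_equiv
    (fun (x : GL (Fin n) (FiniteAdeleRing A K) × Matrix (Fin n) (Fin n) (intAdeles A K))
      (L : RationalLattice A K n) => Represents x.1 x.2 L.1)
    (fun x => exists_represents x.1 x.2)
    (fun L => by
      obtain ⟨g, ρ, h⟩ := exists_represents_of_lattice L
      exact ⟨(g, ρ), h⟩)
    (fun x x' L L' h h' => by
      constructor
      · rintro ⟨γ, hγ⟩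
        refine ⟨γ⁻¹, (h.carries_iff h' _).2 ?_⟩
        rw [inv_inv, diagGL_inv]
        exact exists_inclGL_iff.1 hγ
      · rintro ⟨γ, hγ⟩
        refine ⟨γ⁻¹, exists_inclGL_iff.2 ?_⟩
        rw [diagGL_inv, inv_inv, ← diagGL_inv]
        exact (h.carries_iff h' _).1 hγ)
  have hcomm : ∀ a b, RationalComm (p a) (p b) ↔ Theta A K n a = Theta A K n b := by
    intro a b
    constructor
    · rintro ⟨L, L', γ, hL, hL', hγ⟩
      obtain ⟨g, ρ, h⟩ := exists_represents_of_lattice L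
      obtain ⟨g', ρ', h'⟩ := exists_represents_of_lattice L'
      have ha : a = ⟦(g, ρ)⟧ := p.injective (by rw [hp (g, ρ) L h, hL])
      have hb : b = ⟦(g', ρ')⟧ := p.injective (by rw [hp (g', ρ') L' h', hL'])
      rw [ha, hb]
      refine Quotient.sound ⟨γ⁻¹, ?_⟩
      rw [diagGL_inv, inv_inv]
      exact (h.commVia_iff h' L.2 L'.2 γ).1 hγ
    · intro hab
      induction a using Quotient.inductionOn with | h x =>
      induction b using Quotient.inductionOn with | h x' =>
      obtain ⟨L, hL⟩ := exists_represents x.1 x.2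
      obtain ⟨L', hL'⟩ := exists_represents x'.1 x'.2
      obtain ⟨γ, hγ⟩ := Quotient.exact hab
      refine ⟨L, L', γ⁻¹, (hp x L hL).symm, (hp x' L' hL').symm, ?_⟩
      rw [hL.commVia_iff hL' L.2 L'.2, diagGL_inv]
      exact hγ
  obtain ⟨heq, e, he⟩ := equivalence_and_exists_equiv p _ _ (Theta_surjective A K n) hcomm
  refine ⟨heq, p, fun g ρ => ?_, e, he⟩
  obtain ⟨L, hL⟩ := exists_represents g ρ
  exact ⟨L, hL, hp (g, ρ) L hL⟩

end RationalPart

section FunctionField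

open Polynomial
open scoped IntermediateField.algebraAdjoinAdjoin

variable {Fq K : Type*} [Field Fq] [Field K] [Algebra Fq K]

/-- A function field is finite over the subfield generated by any transcendental element. -/
lemma IsFunctionField.finiteDimensional (hK : IsFunctionField Fq K) {a : K}
    (ha : Transcendental Fq a) :
    FiniteDimensional (IntermediateField.adjoin Fq ({a} : Set K)) K := by
  obtain ⟨T, hT, hfin⟩ := hK.exists_finite
  have h1 : Algebra.IsAlgebraic (Algebra.adjoin Fq ({T} : Set K)) K :=
    (IsFractionRing.comap_isAlgebraic_iff (A := Algebra.adjoin Fq ({T} : Set K))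
      (K := IntermediateField.adjoin Fq ({T} : Set K))).2 inferInstance
  have htr : Algebra.trdeg Fq K ≤ 1 := by
    simpa using Algebra.IsAlgebraic.trdeg_le_cardinalMk Fq ({T} : Set K)
  have hai : AlgebraicIndependent Fq (fun _ : Unit => a) :=
    algebraicIndependent_unique_type_iff.2 ha
  have hbasis := hai.isTranscendenceBasis_of_lift_trdeg_le_of_finite (by simpa using htr)
  have halg : Algebra.IsAlgebraic (IntermediateField.adjoin Fq ({a} : Set K)) K := by
    have := hbasis.isAlgebraic_field
    rwa [Set.range_const] at this
  have h2 : Algebra.EssFiniteType Fq (IntermediateField.adjoin Fq ({T} : Set K)) :=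
    IntermediateField.essFiniteType_iff.2 ⟨{T}, by simp⟩
  have h3 : Algebra.EssFiniteType Fq K :=
    Algebra.EssFiniteType.comp Fq (IntermediateField.adjoin Fq ({T} : Set K)) K
  have h4 : Algebra.EssFiniteType (IntermediateField.adjoin Fq ({a} : Set K)) K :=
    Algebra.EssFiniteType.of_comp Fq _ K
  exact Algebra.finite_of_essFiniteType_of_isAlgebraic

/-- Many elements of a function field satisfy a linear relation with polynomial coefficients in
`a`, not all of them divisible by `a`. -/
lemma IsFunctionField.exists_relation (hK : IsFunctionField Fq K) {a : K}
    (ha : Transcendental Fq a) :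
    ∃ d : ℕ, ∀ y : Fin d → K, ∃ P : Fin d → Fq[X],
      ∑ i, aeval a (P i) * y i = 0 ∧ ∃ i, (P i).coeff 0 ≠ 0 := by
  have := hK.finiteDimensional ha
  set F := IntermediateField.adjoin Fq ({a} : Set K)
  have ha0 : a ≠ 0 := by
    rintro rfl
    exact ha (isAlgebraic_zero)
  refine ⟨Module.finrank F K + 1, fun y => ?_⟩
  have hnot : ¬ LinearIndependent F y := fun h => by
    have := h.fintype_card_le_finrank
    simp at this
  rw [← LinearIndependent.iff_fractionRing (R := Algebra.adjoin Fq ({a} : Set K)),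
    Fintype.not_linearIndependent_iff] at hnot
  obtain ⟨c, hc, i₀, hi₀⟩ := hnot
  have hP : ∀ i, ∃ P : Fq[X], aeval a P = (c i : K) := fun i => by
    have h := Algebra.adjoin_singleton_eq_range_aeval Fq a
    exact h.le (c i).2
  choose P hP using hP
  have hP0 : P i₀ ≠ 0 := fun h => hi₀ (Subtype.ext (by rw [← hP, h]; simp))
  have hrel : ∑ i, aeval a (P i) * y i = 0 := by
    rw [← hc]
    exact Finset.sum_congr rfl fun i _ => by rw [hP]; rfl
  clear hP hc hi₀
  obtain ⟨m, hm⟩ : ∃ m, (P i₀).natDegree = m := ⟨_, rfl⟩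
  induction m using Nat.strong_induction_on generalizing P with
  | _ m ih =>
    by_cases hex : ∃ i, (P i).coeff 0 ≠ 0
    · exact ⟨P, hrel, hex⟩
    · push Not at hex
      have hdvd : ∀ i, ∃ Q, P i = X * Q := fun i => X_dvd_iff.2 (hex i)
      choose Q hQ using hdvd
      have hQ0 : Q i₀ ≠ 0 := fun h => hP0 (by rw [hQ, h, mul_zero])
      refine ih (Q i₀).natDegree ?_ Q hQ0 ?_ rfl
      · rw [← hm, hQ i₀, natDegree_X_mul hQ0]
        omega
      · refine (mul_eq_zero.1 (?_ : a * _ = 0)).resolve_left ha0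
        rw [← hrel, Finset.mul_sum]
        exact Finset.sum_congr rfl fun i _ => by rw [hQ i]; simp [mul_assoc]

lemma algebraMap_mem_valuationSubring [Finite Fq] (V : ValuationSubring K) (c : Fq) :
    algebraMap Fq K c ∈ V := by
  by_cases hc : c = 0
  · subst hc
    simp
  have := Fintype.ofFinite Fq
  rw [← V.valuation_le_one_iff]
  have h1 : V.valuation (algebraMap Fq K c) ^ (Fintype.card Fq - 1) = 1 := by
    rw [← map_pow, ← map_pow, FiniteField.pow_card_sub_one_eq_one c hc, map_one, map_one]
  have h2 : Fintype.card Fq - 1 ≠ 0 := by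
    have := Fintype.one_lt_card (α := Fq)
    omega
  exact ((pow_eq_one_iff_of_nonneg zero_le h2).1 h1).le

lemma valuation_algebraMap_of_ne_zero [Finite Fq] (V : ValuationSubring K) {c : Fq} (hc : c ≠ 0) :
    V.valuation (algebraMap Fq K c) = 1 := by
  refine le_antisymm ((V.valuation_le_one_iff _).2 (algebraMap_mem_valuationSubring V c)) ?_
  have h := (V.valuation_le_one_iff _).2 (algebraMap_mem_valuationSubring V c⁻¹)
  rw [map_inv₀, map_inv₀] at h
  exact (inv_le_one₀ (zero_lt_iff.2 (by simpa using hc))).1 h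

lemma aeval_mem_valuationSubring [Finite Fq] {V : ValuationSubring K} {x : K} (hx : x ∈ V)
    (P : Fq[X]) : aeval x P ∈ V := by
  rw [aeval_eq_sum_range]
  refine sum_mem fun i _ => ?_
  rw [Algebra.smul_def]
  exact mul_mem (algebraMap_mem_valuationSubring V _) (pow_mem hx _)

lemma aeval_eq_add_mul_divX (x : K) (P : Fq[X]) :
    aeval x P = algebraMap Fq K (P.coeff 0) + x * aeval x (divX P) := by
  conv_lhs => rw [← divX_mul_X_add P]
  simp only [map_add, map_mul, aeval_X, aeval_C]
  ring

/-- A polynomial with nonzero constant term takes unit values on the nonunits of a valuation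
ring. -/
lemma valuation_aeval [Finite Fq] (V : ValuationSubring K) {x : K} (hx : V.valuation x < 1)
    {P : Fq[X]} (hP : P.coeff 0 ≠ 0) : V.valuation (aeval x P) = 1 := by
  have h2 : V.valuation (aeval x (divX P)) ≤ 1 := (V.valuation_le_one_iff _).2
    (aeval_mem_valuationSubring ((V.valuation_le_one_iff _).1 hx.le) _)
  rw [aeval_eq_add_mul_divX, Valuation.map_add_eq_of_lt_left, valuation_algebraMap_of_ne_zero V hP]
  rw [valuation_algebraMap_of_ne_zero V hP, map_mul]
  exact mul_lt_one_of_lt_of_le hx h2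

lemma exists_valuationSubring_notMem {a : K} (ha : Transcendental Fq a) :
    ∃ V : ValuationSubring K, a ∉ V := by
  have : IsIntegrallyClosedIn (integralClosure Fq K).toSubring K :=
    inferInstanceAs (IsIntegrallyClosedIn (integralClosure Fq K) K)
  obtain ⟨V, -, h⟩ := Subring.exists_le_valuationSubring_of_isIntegrallyClosedIn
    (R := (integralClosure Fq K).toSubring) (x := a)
    (fun h => ha (IsIntegral.isAlgebraic h))
  exact ⟨V, h⟩

lemma transcendental_of_valuation_lt_one [Finite Fq] (V : ValuationSubring K) {x : K} (hx0 : x ≠ 0)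
    (hx : V.valuation x < 1) : Transcendental Fq x := by
  intro halg
  have h1 : (minpoly Fq x).coeff 0 ≠ 0 :=
    minpoly.coeff_zero_ne_zero halg.isIntegral hx0
  have h2 := valuation_aeval V hx h1
  rw [minpoly.aeval, map_zero] at h2
  exact zero_ne_one h2

lemma IsFunctionField.exists_forall_not_lt_valuation [Finite Fq] (hK : IsFunctionField Fq K)
    {V : ValuationSubring K} {x : K} (hx0 : x ≠ 0) (hx : V.valuation x < 1) :
    ∃ d : ℕ, ∀ y : Fin d → K, Function.Injective (fun i => V.valuation (y i)) →
      (∀ i, V.valuation (y i) ≤ 1) → ∃ i, V.valuation (y i) ≤ V.valuation x := by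
  classical
  obtain ⟨d, hd⟩ := hK.exists_relation (transcendental_of_valuation_lt_one V hx0 hx)
  refine ⟨d, fun y hinj hy => ?_⟩
  by_contra! hlt
  obtain ⟨P, hrel, i₀, hi₀⟩ := hd y
  obtain ⟨i, hi, hmax⟩ := Finset.exists_max_image
    (Finset.univ.filter fun i => (P i).coeff 0 ≠ 0) (fun i => V.valuation (y i))
    ⟨i₀, by simpa using hi₀⟩
  simp only [Finset.mem_filter, Finset.mem_univ, true_and] at hi hmax
  have hyi : V.valuation (y i) ≠ 0 := (zero_le.trans_lt (hlt i)).ne'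
  rw [← Finset.add_sum_erase _ _ (Finset.mem_univ i)] at hrel
  have h1 : V.valuation (aeval x (P i) * y i) = V.valuation (y i) := by
    rw [map_mul, valuation_aeval V hx hi, one_mul]
  have h2 : V.valuation (∑ j ∈ Finset.univ.erase i, aeval x (P j) * y j) < V.valuation (y i) := by
    refine Valuation.map_sum_lt _ hyi fun j hj => ?_
    by_cases hj0 : (P j).coeff 0 = 0
    · obtain ⟨Q, hQ⟩ := X_dvd_iff.2 hj0
      refine lt_of_le_of_lt ?_ (hlt i)
      have hQ1 : V.valuation (aeval x Q) ≤ 1 := (V.valuation_le_one_iff _).2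
        (aeval_mem_valuationSubring ((V.valuation_le_one_iff _).1 hx.le) Q)
      rw [hQ, map_mul, map_mul, aeval_X, map_mul, mul_assoc]
      exact mul_le_of_le_one_right' (mul_le_one' hQ1 (hy j))
    · rw [map_mul, valuation_aeval V hx hj0, one_mul]
      exact lt_of_le_of_ne (hmax j hj0) fun h => (Finset.ne_of_mem_erase hj) (hinj h)
  rw [add_eq_zero_iff_eq_neg] at hrel
  rw [← h1, hrel, Valuation.map_neg] at h2
  exact lt_irrefl _ h2

/-- The valuation of a function field defined by a valuation ring is archimedean. -/
lemma IsFunctionField.exists_pow_valuation_le [Finite Fq] (hK : IsFunctionField Fq K)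
    {V : ValuationSubring K} {x : K} (hx0 : x ≠ 0) (hx : V.valuation x < 1) {z : K}
    (hz : V.valuation z < 1) : ∃ d : ℕ, V.valuation z ^ d ≤ V.valuation x := by
  by_cases hz0 : z = 0
  · exact ⟨1, by simp [hz0]⟩
  obtain ⟨d, hd⟩ := hK.exists_forall_not_lt_valuation hx0 hx
  obtain ⟨i, hi⟩ := hd (fun i => z ^ (i : ℕ))
    (fun i j hij => by
      simp only [map_pow] at hij
      exact Fin.ext (pow_right_injective₀ (zero_lt_iff.2 (by simpa using hz0)) hz.ne hij))
    (fun i => by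
      rw [map_pow]
      exact pow_le_one₀ zero_le hz.le)
  exact ⟨i, by rwa [map_pow] at hi⟩

/-- A nontrivial valuation ring of a function field is discrete. -/
lemma IsFunctionField.isDiscreteValuationRing [Finite Fq] (hK : IsFunctionField Fq K)
    {V : ValuationSubring K} {x : K} (hx0 : x ≠ 0) (hx : V.valuation x < 1) :
    IsDiscreteValuationRing V := by
  obtain ⟨d, hd⟩ := hK.exists_forall_not_lt_valuation hx0 hx
  set S : Set V.ValueGroup := {γ | V.valuation x ≤ γ ∧ γ < 1} with hS
  have hSfin : S.Finite := by
    have : (S \ {V.valuation x}).Finite := by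
      by_contra hinf
      have hinf : (S \ {V.valuation x}).Infinite := hinf
      let f := hinf.natEmbedding
      choose y hy using fun i : Fin d => V.valuation_surjective (f i : V.ValueGroup)
      obtain ⟨i, hi⟩ := hd y
        (fun i j hij => by
          simp only [hy] at hij
          exact Fin.ext (f.injective (Subtype.ext hij)))
        (fun i => by
          rw [hy]
          exact (f i).2.1.2.le)
      rw [hy] at hi
      exact (f i).2.2 (le_antisymm hi (f i).2.1.1)
    exact (this.insert (V.valuation x)).subset fun γ hγ => by
      by_cases h : γ = V.valuation x
      · exact Or.inl h
      · exact Or.inr ⟨hγ, h⟩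
  obtain ⟨γ, hγS, hγmax⟩ := S.exists_max_image id hSfin ⟨V.valuation x, le_rfl, hx⟩
  obtain ⟨π, rfl⟩ := V.valuation_surjective γ
  have hπ1 : V.valuation π < 1 := hγS.2
  have hmax : ∀ z, V.valuation z < 1 → V.valuation z ≤ V.valuation π := by
    intro z hz
    rcases le_total (V.valuation x) (V.valuation z) with h | h
    · exact hγmax _ ⟨h, hz⟩
    · exact h.trans hγS.1
  have hπ0 : π ≠ 0 := by
    rintro rfl
    have := hγS.1
    rw [map_zero] at this
    exact hx0 ((Valuation.zero_iff _).1 (le_antisymm this zero_le))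
  have hπv : 0 < V.valuation π := zero_lt_iff.2 (by simpa using hπ0)
  let p : V := ⟨π, (V.valuation_le_one_iff _).1 hπ1.le⟩
  refine IsDiscreteValuationRing.ofHasUnitMulPowIrreducibleFactorization ⟨p, ⟨?_, ?_⟩, ?_⟩
  · rw [V.valuation_eq_one_iff]
    exact hπ1.ne
  · intro a b hab
    by_contra! hcon
    rw [V.valuation_eq_one_iff, V.valuation_eq_one_iff] at hcon
    have ha : V.valuation (a : K) ≤ V.valuation π :=
      hmax _ (lt_of_le_of_ne (V.valuation_le_one a) hcon.1)
    have hb : V.valuation (b : K) < 1 := lt_of_le_of_ne (V.valuation_le_one b) hcon.2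
    have h : V.valuation π = V.valuation (a : K) * V.valuation (b : K) := by
      rw [← map_mul]
      exact congrArg (fun t : V => V.valuation (t : K)) hab
    have h2 : V.valuation (a : K) * V.valuation (b : K) ≤ V.valuation π * V.valuation (b : K) := by
      gcongr
    have h3 : V.valuation π * V.valuation (b : K) < V.valuation π * 1 := by
      gcongr
    rw [mul_one, h] at h3
    exact absurd (h2.trans_lt (h ▸ h3)) (by rw [← h]; exact lt_irrefl _)
  · intro y hy
    have hy0 : (y : K) ≠ 0 := by simpa using hy
    have hex : ∃ m : ℕ, V.valuation π ^ m < V.valuation (y : K) := by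
      rcases (V.valuation_le_one y).lt_or_eq with h | h
      · obtain ⟨m, hm⟩ := hK.exists_pow_valuation_le hy0 h hπ1
        refine ⟨m + 1, lt_of_lt_of_le ?_ hm⟩
        exact pow_lt_pow_right_of_lt_one₀ hπv hπ1 (Nat.lt_succ_self m)
      · exact ⟨1, by rw [h, pow_one]; exact hπ1⟩
    classical
    obtain ⟨m, hm, hmin⟩ : ∃ m, V.valuation π ^ (m + 1) < V.valuation (y : K) ∧
        V.valuation (y : K) ≤ V.valuation π ^ m := by
      have h0 : Nat.find hex ≠ 0 := by
        intro h
        have := Nat.find_spec hex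
        rw [h, pow_zero] at this
        exact absurd (V.valuation_le_one y) (not_le.2 this)
      obtain ⟨m, hm⟩ := Nat.exists_eq_succ_of_ne_zero h0
      exact ⟨m, by simpa [hm] using Nat.find_spec hex,
        not_lt.1 (Nat.find_min hex (by omega))⟩
    have hpm : 0 < V.valuation π ^ m := pow_pos hπv m
    have hu : V.valuation ((y : K) / π ^ m) = 1 := by
      by_contra hne
      have hle : V.valuation ((y : K) / π ^ m) ≤ 1 := by
        rw [map_div₀, map_pow]
        exact div_le_one_of_le₀ hmin zero_le
      have := hmax _ (lt_of_le_of_ne hle hne)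
      rw [map_div₀, map_pow, div_le_iff₀ hpm, ← pow_succ'] at this
      exact absurd hm (not_lt.2 this)
    let u : V := ⟨(y : K) / π ^ m, (V.valuation_le_one_iff _).1 hu.le⟩
    have hunit : IsUnit u := (V.valuation_eq_one_iff u).2 hu
    obtain ⟨w, hw⟩ := hunit
    refine ⟨m, w, Subtype.ext ?_⟩
    rw [hw]
    change π ^ m * ((y : K) / π ^ m) = y
    field_simp

/-- Every transcendental element of a function field has a pole. -/
lemma IsFunctionField.exists_place_notMem [Finite Fq] (hK : IsFunctionField Fq K) {a : K}
    (ha : Transcendental Fq a) :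
    ∃ V : ValuationSubring K, IsDiscreteValuationRing V ∧ a ∉ V := by
  obtain ⟨V, hV⟩ := exists_valuationSubring_notMem ha
  have ha0 : a ≠ 0 := by
    rintro rfl
    exact hV (zero_mem V)
  refine ⟨V, hK.isDiscreteValuationRing (x := a⁻¹) (inv_ne_zero ha0) ?_, hV⟩
  rw [map_inv₀]
  refine inv_lt_one_of_one_lt₀ (not_le.1 fun h => hV ((V.valuation_le_one_iff _).1 h))

end FunctionField

section InfinitePlace

open Polynomial IsDedekindDomain HeightOneSpectrum

variable {Fq K : Type*} [Field Fq] [Field K] [Algebra Fq K]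
  {pl : ValuationSubring K} [IsDiscreteValuationRing pl]

omit [Field Fq] [Algebra Fq K] in
lemma isEquiv_valuation_maximalIdeal :
    ((IsDiscreteValuationRing.maximalIdeal pl).valuation K).IsEquiv pl.valuation := by
  refine Valuation.isEquiv_of_val_le_one fun x => ?_
  rw [pl.valuation_le_one_iff]
  constructor
  · intro h
    by_contra hx
    have hinv := (pl.mem_or_inv_mem x).resolve_left hx
    have hx0 : x ≠ 0 := by
      rintro rfl
      exact hx (zero_mem _)
    have hmem : (⟨x⁻¹, hinv⟩ : pl) ∈ (IsDiscreteValuationRing.maximalIdeal pl).asIdeal := by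
      change _ ∈ IsLocalRing.maximalIdeal pl
      rw [IsLocalRing.mem_maximalIdeal, mem_nonunits_iff, pl.valuation_eq_one_iff]
      intro h1
      rw [map_inv₀, inv_eq_one] at h1
      exact hx ((pl.valuation_le_one_iff _).1 h1.le)
    have hlt : (IsDiscreteValuationRing.maximalIdeal pl).valuation K x⁻¹ < 1 :=
      ((IsDiscreteValuationRing.maximalIdeal pl).valuation_lt_one_iff_mem
        (⟨x⁻¹, hinv⟩ : pl)).2 hmem
    rw [map_inv₀] at hlt
    exact absurd h (not_le.2 ((inv_lt_one₀ (zero_lt_iff.2 (by simpa using hx0))).1 hlt))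
  · intro h
    exact (IsDiscreteValuationRing.maximalIdeal pl).valuation_le_one (⟨x, h⟩ : pl)

omit [Field Fq] [Algebra Fq K] in
lemma norm_algebraMap_le_one_iff {x : K} :
    ‖algebraMap K (Kinf K pl) x‖ ≤ 1 ↔ pl.valuation x ≤ 1 := by
  rw [Valued.toNormedField.norm_le_one_iff, valued_algebraMap]
  exact isEquiv_valuation_maximalIdeal.le_one_iff_le_one

omit [Field Fq] [Algebra Fq K] in
lemma norm_algebraMap_lt_one_iff {x : K} :
    ‖algebraMap K (Kinf K pl) x‖ < 1 ↔ pl.valuation x < 1 := by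
  rw [Valued.toNormedField.norm_lt_one_iff, valued_algebraMap]
  exact isEquiv_valuation_maximalIdeal.lt_one_iff_lt_one

/-- The residue field of a place of a function field is finite. -/
lemma IsFunctionField.finite_residueField [Finite Fq] (hK : IsFunctionField Fq K)
    (pl : ValuationSubring K) [IsDiscreteValuationRing pl] :
    Finite (IsLocalRing.ResidueField pl) := by
  classical
  obtain ⟨ϖ, hϖ⟩ := IsDiscreteValuationRing.exists_irreducible pl
  have hx0 : (ϖ : K) ≠ 0 := by simpa using hϖ.ne_zero
  have hx : pl.valuation (ϖ : K) < 1 :=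
    lt_of_le_of_ne (pl.valuation_le_one ϖ) fun h => hϖ.not_isUnit ((pl.valuation_eq_one_iff ϖ).2 h)
  obtain ⟨d, hd⟩ := hK.exists_relation (transcendental_of_valuation_lt_one pl hx0 hx)
  let f : Fq →+* pl := (algebraMap Fq K).codRestrict pl.toSubring
    fun c => algebraMap_mem_valuationSubring pl c
  let _ : Algebra Fq (IsLocalRing.ResidueField pl) := ((IsLocalRing.residue pl).comp f).toAlgebra
  have hrank : Module.rank Fq (IsLocalRing.ResidueField pl) ≤ d := by
    refine rank_le fun s hs => ?_
    by_contra! hcard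
    obtain ⟨t, hts, htd⟩ := Finset.exists_subset_card_eq hcard.le
    let e : Fin d ≃ t := (t.equivFinOfCardEq htd).symm
    have hli : LinearIndependent Fq fun i : Fin d => ((e i : t) : IsLocalRing.ResidueField pl) :=
      hs.comp (fun i => ⟨(e i : IsLocalRing.ResidueField pl), hts (e i).2⟩) fun i j hij =>
        e.injective (Subtype.ext (congrArg (fun z : s => (z : IsLocalRing.ResidueField pl)) hij))
    choose y hy using fun i : Fin d =>
      IsLocalRing.residue_surjective ((e i : t) : IsLocalRing.ResidueField pl)
    obtain ⟨P, hrel, i₀, hi₀⟩ := hd fun i => (y i : K)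
    have hrel' : ∑ i, (f ((P i).coeff 0) + ϖ *
        ⟨aeval (ϖ : K) (divX (P i)), aeval_mem_valuationSubring ϖ.2 _⟩) * y i = 0 := by
      apply Subtype.ext
      rw [ZeroMemClass.coe_zero, ← hrel, AddSubmonoidClass.coe_finsetSum]
      refine Finset.sum_congr rfl fun i _ => ?_
      exact Eq.trans rfl (congrArg (· * (y i : K)) (aeval_eq_add_mul_divX (ϖ : K) (P i)).symm)
    have hres : IsLocalRing.residue pl ϖ = 0 := by
      rw [IsLocalRing.residue_eq_zero_iff, IsLocalRing.mem_maximalIdeal]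
      exact hϖ.not_isUnit
    have h0 := congrArg (IsLocalRing.residue pl) hrel'
    rw [map_sum, map_zero] at h0
    refine hi₀ (Fintype.linearIndependent_iff.1 hli (fun i => (P i).coeff 0) ?_ i₀)
    rw [← h0]
    refine Finset.sum_congr rfl fun i _ => ?_
    rw [map_mul, map_add, map_mul, hres, zero_mul, add_zero, hy, Algebra.smul_def]
    rfl
  have : Module.Finite Fq (IsLocalRing.ResidueField pl) :=
    Module.rank_lt_aleph0_iff.1 (hrank.trans_lt (Cardinal.natCast_lt_aleph0))
  exact Module.finite_of_finite Fq

omit [Field Fq] [Algebra Fq K] in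
lemma exists_norm_sub_algebraMap_le_one (x : Kinf K pl) :
    ∃ k : K, ‖x - algebraMap K (Kinf K pl) k‖ ≤ 1 := by
  obtain ⟨k, hk⟩ := exists_sub_algebraMap_mem_integers _ x
  exact ⟨k, Valued.toNormedField.norm_le_one_iff.2 hk⟩

open Valued in
omit [Field Fq] [Algebra Fq K] in
lemma residue_eq_zero_of_norm_lt_one {z : 𝒪[Kinf K pl]} (hz : ‖(z : Kinf K pl)‖ < 1) :
    IsLocalRing.residue 𝒪[Kinf K pl] z = 0 := by
  rw [IsLocalRing.residue_eq_zero_iff, IsLocalRing.mem_maximalIdeal, mem_nonunits_iff]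
  intro hu
  have h1 := (Valuation.integer.integers (v := Valued.v (R := Kinf K pl))).one_of_isUnit hu
  rw [Valued.toNormedField.norm_lt_one_iff] at hz
  exact hz.ne h1

omit [Field Fq] [Algebra Fq K] in
lemma exists_norm_sub_algebraMap_lt_one (x : Kinf K pl) :
    ∃ k : K, ‖x - algebraMap K (Kinf K pl) k‖ < 1 := by
  obtain ⟨ϖ, hϖ⟩ := IsDiscreteValuationRing.exists_irreducible pl
  have hx0 : (ϖ : K) ≠ 0 := by simpa using hϖ.ne_zero
  have hx : pl.valuation (ϖ : K) < 1 :=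
    lt_of_le_of_ne (pl.valuation_le_one ϖ) fun h => hϖ.not_isUnit ((pl.valuation_eq_one_iff ϖ).2 h)
  have hc0 : algebraMap K (Kinf K pl) ϖ ≠ 0 := by simpa using hx0
  obtain ⟨k, hk⟩ := exists_norm_sub_algebraMap_le_one (x * (algebraMap K (Kinf K pl) ϖ)⁻¹)
  refine ⟨ϖ * k, ?_⟩
  have : x - algebraMap K (Kinf K pl) (ϖ * k) =
      algebraMap K (Kinf K pl) ϖ * (x * (algebraMap K (Kinf K pl) ϖ)⁻¹ - algebraMap K _ k) := by
    rw [map_mul, mul_sub, mul_comm x, mul_inv_cancel_left₀ hc0]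
  rw [this, norm_mul]
  exact (mul_le_of_le_one_right (norm_nonneg _) hk).trans_lt (norm_algebraMap_lt_one_iff.2 hx)

open Valued in
/-- The completion of a function field at a place is locally compact. -/
lemma IsFunctionField.properSpace [Finite Fq] (hK : IsFunctionField Fq K)
    (pl : ValuationSubring K) [IsDiscreteValuationRing pl] : ProperSpace (Kinf K pl) := by
  have hres := hK.finite_residueField pl
  have hdvr : IsDiscreteValuationRing 𝒪[Kinf K pl] :=
    inferInstanceAs (IsDiscreteValuationRing
      ((IsDiscreteValuationRing.maximalIdeal pl).adicCompletionIntegers K))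
  refine (Valued.integer.properSpace_iff_completeSpace_and_isDiscreteValuationRing_integer_and_finite_residueField).2
    ⟨inferInstance, hdvr, ?_⟩
  let f : pl →+* 𝒪[Kinf K pl] := ((algebraMap K (Kinf K pl)).comp pl.subtype).codRestrict _ fun x =>
    Valued.toNormedField.norm_le_one_iff.1
      (norm_algebraMap_le_one_iff.2 ((pl.valuation_le_one_iff _).2 x.2))
  let g : pl →+* 𝓀[Kinf K pl] := (IsLocalRing.residue 𝒪[Kinf K pl]).comp f
  have hg : ∀ x ∈ IsLocalRing.maximalIdeal pl, g x = 0 := by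
    intro x hx
    refine residue_eq_zero_of_norm_lt_one (z := f x) (norm_algebraMap_lt_one_iff.2 ?_)
    rw [IsLocalRing.mem_maximalIdeal, mem_nonunits_iff, pl.valuation_eq_one_iff] at hx
    exact lt_of_le_of_ne (pl.valuation_le_one x) hx
  let G : IsLocalRing.ResidueField pl →+* 𝓀[Kinf K pl] :=
    Ideal.Quotient.lift (IsLocalRing.maximalIdeal pl) g hg
  refine Finite.of_surjective G fun y => ?_
  obtain ⟨z, rfl⟩ := IsLocalRing.residue_surjective y
  obtain ⟨k, hk⟩ := exists_norm_sub_algebraMap_lt_one (z : Kinf K pl)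
  have hk1 : ‖algebraMap K (Kinf K pl) k‖ ≤ 1 := by
    rw [Valued.toNormedField.norm_le_one_iff]
    have h1 := sub_mem z.2 (Valued.toNormedField.norm_le_one_iff.1 hk.le :
      (z : Kinf K pl) - algebraMap K (Kinf K pl) k ∈ Valuation.integer Valued.v)
    rwa [sub_sub_cancel] at h1
  let κ : pl := ⟨k, (pl.valuation_le_one_iff _).1 (norm_algebraMap_le_one_iff.1 hk1)⟩
  refine ⟨IsLocalRing.residue pl κ, ?_⟩
  have h2 : IsLocalRing.residue 𝒪[Kinf K pl] (z - f κ) = 0 :=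
    residue_eq_zero_of_norm_lt_one (z := z - f κ) hk
  rw [map_sub, sub_eq_zero] at h2
  rw [h2]
  exact Ideal.Quotient.lift_mk _ _ _

variable {A : Type*} [CommRing A] [Algebra A K]

lemma eq_zero_of_norm_lt_one [Finite Fq] (hK : IsFunctionField Fq K)
    (hA : ∀ x : K, x ∈ Set.range (algebraMap A K) ↔
      ∀ v : ValuationSubring K, IsDiscreteValuationRing v → v ≠ pl → x ∈ v)
    {a : A} (ha : ‖algebraMap K (Kinf K pl) (algebraMap A K a)‖ < 1) : algebraMap A K a = 0 := by
  rw [norm_algebraMap_lt_one_iff] at ha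
  by_contra ha0
  obtain ⟨V, hV, haV⟩ :=
    hK.exists_place_notMem (transcendental_of_valuation_lt_one pl ha0 ha)
  refine haV ((hA _).1 ⟨a, rfl⟩ V hV ?_)
  rintro rfl
  exact haV ((V.valuation_le_one_iff _).1 ha.le)

lemma exists_transcendental [IsDomain A] [IsFractionRing A K] (hK : IsFunctionField Fq K) :
    ∃ t : A, Transcendental Fq (algebraMap A K t) := by
  obtain ⟨T, hT, -⟩ := hK.exists_finite
  by_contra! h
  obtain ⟨a, b, hb, rfl⟩ := IsFractionRing.div_surjective (A := A) T
  have ha := not_not.1 (h a)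
  have hb := not_not.1 (h b)
  refine hT ?_
  rw [div_eq_mul_inv]
  exact ha.mul hb.inv

lemma one_lt_valuation_of_transcendental [Finite Fq] (hK : IsFunctionField Fq K)
    (hA : ∀ x : K, x ∈ Set.range (algebraMap A K) ↔
      ∀ v : ValuationSubring K, IsDiscreteValuationRing v → v ≠ pl → x ∈ v)
    {t : A} (ht : Transcendental Fq (algebraMap A K t)) : 1 < pl.valuation (algebraMap A K t) := by
  obtain ⟨V, hV, htV⟩ := hK.exists_place_notMem ht
  have hVpl : V = pl := by
    by_contra hne
    exact htV ((hA _).1 ⟨t, rfl⟩ V hV hne)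
  subst hVpl
  exact not_le.1 fun h => htV ((V.valuation_le_one_iff _).1 h)

lemma valuation_aeval_of_one_lt [Finite Fq] (V : ValuationSubring K) {t : K}
    (ht : 1 < V.valuation t) {P : Fq[X]} (hP : P ≠ 0) :
    V.valuation (aeval t P) = V.valuation t ^ P.natDegree := by
  have ht0 : t ≠ 0 := by
    rintro rfl
    simp at ht
  let _ := invertibleOfNonzero ht0
  have h := eval₂_reverse_mul_pow (algebraMap Fq K) t P
  rw [aeval_def, ← h, map_mul, map_pow, ← aeval_def, valuation_aeval, one_mul]
  · rw [invOf_eq_inv, map_inv₀]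
    exact inv_lt_one_of_one_lt₀ ht
  · rwa [coeff_zero_reverse, leadingCoeff_ne_zero]

/-- `K` is the sum of `A` and a bounded set. -/
lemma exists_norm_sub_le [Finite Fq] [IsDomain A] [IsFractionRing A K] (hK : IsFunctionField Fq K)
    (hA : ∀ x : K, x ∈ Set.range (algebraMap A K) ↔
      ∀ v : ValuationSubring K, IsDiscreteValuationRing v → v ≠ pl → x ∈ v) :
    ∃ C : ℝ, ∀ x : Kinf K pl, ∃ a : A,
      ‖x - algebraMap K (Kinf K pl) (algebraMap A K a)‖ ≤ C := by
  obtain ⟨t, ht⟩ := exists_transcendental (A := A) hK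
  have ht1 := one_lt_valuation_of_transcendental hK hA ht
  have := hK.finiteDimensional ht
  set τ := algebraMap A K t with hτ
  set F := IntermediateField.adjoin Fq ({τ} : Set K) with hF
  have hpoly : ∀ P : Fq[X], ∃ a : A, algebraMap A K a = aeval τ P := fun P =>
    (hA _).2 fun V hV hne => aeval_mem_valuationSubring ((hA _).1 ⟨t, rfl⟩ V hV hne) P
  have hsplit : ∀ f : F, ∃ (a : A) (g : K), (f : K) = algebraMap A K a + g ∧
      ‖algebraMap K (Kinf K pl) g‖ ≤ 1 := by
    intro f
    obtain ⟨r, s, hrs⟩ := IntermediateField.mem_adjoin_simple_iff Fq (f : K) |>.1 f.2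
    by_cases hs : s = 0
    · refine ⟨0, 0, ?_, by simp⟩
      rw [hrs, hs]
      simp
    have hs' : aeval τ s ≠ 0 := fun h => hs (transcendental_iff.1 ht s h)
    obtain ⟨a, ha⟩ := hpoly (r / s)
    refine ⟨a, aeval τ (r % s) / aeval τ s, ?_, ?_⟩
    · rw [hrs, ha, eq_comm, eq_div_iff hs', add_mul, div_mul_cancel₀ _ hs', ← map_mul, ← map_add,
        mul_comm, EuclideanDomain.div_add_mod]
    · rw [norm_algebraMap_le_one_iff]
      by_cases hr : r % s = 0
      · simp [hr]
      · rw [map_div₀, valuation_aeval_of_one_lt pl ht1 hr, valuation_aeval_of_one_lt pl ht1 hs]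
        refine div_le_one_of_le₀ (pow_le_pow_right₀ ht1.le ?_) zero_le
        exact natDegree_le_natDegree (degree_mod_lt r hs).le
  let b := Module.finBasis F K
  obtain ⟨c, hc⟩ := IsLocalization.exist_integer_multiples_of_finite (nonZeroDivisors A) b
  have hcK : algebraMap A K c ≠ 0 := by simp
  set N : K → ℝ := fun x => ‖algebraMap K (Kinf K pl) x‖ with hN
  have hfrac : ∀ x : K, ∃ a : A, N (x - algebraMap A K a) ≤ N (algebraMap A K c) * ∑ i, N (b i) := by
    intro x
    choose a g hfg hg using fun i => hsplit (b.equivFun (x / algebraMap A K c) i)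
    choose e he using hc
    refine ⟨∑ i, a i * e i, ?_⟩
    have hx : x - algebraMap A K (∑ i, a i * e i) = algebraMap A K c * ∑ i, g i * b i := by
      have h1 : x = algebraMap A K c * ∑ i, ((b.equivFun (x / algebraMap A K c) i : F) : K) * b i := by
        have h2 : ∑ i, ((b.equivFun (x / algebraMap A K c) i : F) : K) * b i =
            x / algebraMap A K c := b.sum_equivFun (x / algebraMap A K c)
        rw [h2]
        field_simp
      conv_lhs => rw [h1]
      rw [map_sum, Finset.mul_sum, Finset.mul_sum, ← Finset.sum_sub_distrib]
      refine Finset.sum_congr rfl fun i _ => ?_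
      rw [map_mul, he i, Algebra.smul_def, hfg i]
      ring
    rw [hx]
    simp only [hN, map_mul, norm_mul, map_sum]
    refine mul_le_mul_of_nonneg_left ((norm_sum_le _ _).trans (Finset.sum_le_sum fun i _ => ?_))
      (norm_nonneg _)
    rw [norm_mul]
    exact mul_le_of_le_one_left (norm_nonneg _) (hg i)
  refine ⟨1 + N (algebraMap A K c) * ∑ i, N (b i), fun x => ?_⟩
  obtain ⟨k, hk⟩ := exists_norm_sub_algebraMap_le_one x
  obtain ⟨a, ha⟩ := hfrac k
  refine ⟨a, ?_⟩
  have : x - algebraMap K (Kinf K pl) (algebraMap A K a) =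
      (x - algebraMap K (Kinf K pl) k) + algebraMap K (Kinf K pl) (k - algebraMap A K a) := by
    rw [map_sub]
    ring
  rw [this]
  exact (norm_add_le _ _).trans (add_le_add hk ha)

end InfinitePlace

section Transport

variable {A K : Type*} [CommRing A] [Field K] [Algebra A K] {n : ℕ}
  {V W V' W' : Type*} [AddCommGroup V] [Module A V] [Module K V] [IsScalarTower A K V]
  [AddCommGroup W] [Module A W] [Module K W] [IsScalarTower A K W]
  [AddCommGroup V'] [Module A V'] [Module K V'] [IsScalarTower A K V']
  [AddCommGroup W'] [Module A W'] [Module K W'] [IsScalarTower A K W']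

lemma exists_carries (f : V →ₗ[K] W) (L : LabelledModule A K V n) :
    ∃ L' : LabelledModule A K W n, Carries f L L' := by
  let Λ' := L.lat.map (f.restrictScalars A)
  let q : (V ⧸ L.lat) →ₗ[A] W ⧸ Λ' :=
    L.lat.mapQ Λ' (f.restrictScalars A) (Submodule.le_comap_map _ _)
  have hq : ∀ x : spanQuot K L.lat, q x ∈ spanQuot K Λ' := by
    rintro ⟨_, v, hv, rfl⟩
    refine ⟨f v, ?_, rfl⟩
    change f v ∈ Submodule.span K (f '' L.lat)
    rw [← Submodule.map_span]
    exact ⟨v, hv, rfl⟩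
  refine ⟨⟨Λ', ((q ∘ₗ (spanQuot K L.lat).subtype).codRestrict _ hq) ∘ₗ L.hom⟩, rfl,
    fun t v hv => ?_⟩
  change q (L.hom t) = _
  rw [hv]
  rfl

lemma exists_carries_comap {f : V →ₗ[K] W} (L' : LabelledModule A K W n)
    (hf : (L'.lat : Set W) ⊆ LinearMap.range f)
    (hspan : Submodule.span K (L'.lat.comap (f.restrictScalars A) : Set V) = ⊤) :
    ∃ L : LabelledModule A K V n, L.lat = L'.lat.comap (f.restrictScalars A) ∧
      Carries f L L' := by
  let Λ := L'.lat.comap (f.restrictScalars A)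
  let q : (V ⧸ Λ) →ₗ[A] W ⧸ L'.lat := Λ.mapQ L'.lat (f.restrictScalars A) le_rfl
  have hq : Function.Injective q := by
    rw [← LinearMap.ker_eq_bot, Submodule.ker_mapQ]
    exact Submodule.mkQ_map_self _
  have hrange : ∀ x : spanQuot K L'.lat, (x : W ⧸ L'.lat) ∈ LinearMap.range q := by
    rintro ⟨_, w, hw, rfl⟩
    obtain ⟨v, rfl⟩ := Submodule.span_le.2 hf hw
    exact ⟨Submodule.Quotient.mk v, rfl⟩
  let φ : TorsionPts A K n →ₗ[A] V ⧸ Λ := (LinearEquiv.ofInjective q hq).symm.toLinearMap ∘ₗ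
    ((spanQuot K L'.lat).subtype.codRestrict _ hrange) ∘ₗ L'.hom
  have hφ : ∀ t, q (φ t) = L'.hom t := fun t =>
    congrArg Subtype.val ((LinearEquiv.ofInjective q hq).apply_symm_apply
      ⟨(L'.hom t : W ⧸ L'.lat), hrange _⟩)
  have htop : spanQuot K Λ = ⊤ := by
    rw [spanQuot, hspan, Submodule.restrictScalars_top, Submodule.map_top, Submodule.range_mkQ]
  refine ⟨⟨Λ, φ.codRestrict _ fun t => by rw [htop]; trivial⟩, rfl, ?_, fun t v hv => ?_⟩
  · refine (Submodule.map_comap_eq_of_le fun w hw => ?_).symm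
    exact hf hw
  · have h1 : φ t = Submodule.Quotient.mk v := hv
    rw [LabelledModule.Maps, ← hφ, h1]
    rfl

variable {f : V →ₗ[K] W} {f' : V' →ₗ[K] W'} {h : V →ₗ[K] V'} {k : W →ₗ[K] W'}
  {L₀ : LabelledModule A K V n} {L : LabelledModule A K W n}
  {L₀' : LabelledModule A K V' n} {L' : LabelledModule A K W' n}

lemma Carries.mem_iff (hL : Carries f L₀ L) (hf : Function.Injective f) {v : V} :
    f v ∈ L.lat ↔ v ∈ L₀.lat := by
  rw [hL.1]
  exact hf.mem_set_image

lemma Carries.maps_iff (hL : Carries f L₀ L) (hf : Function.Injective f)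
    {t : TorsionPts A K n} {v : V} : L.Maps t (f v) ↔ L₀.Maps t v := by
  obtain ⟨v₀, hv₀⟩ := L₀.exists_maps t
  rw [hv₀.iff_sub_mem, (hL.2 _ _ hv₀).iff_sub_mem, ← map_sub, hL.mem_iff hf]

lemma Carries.span_eq (hL : Carries f L₀ L) :
    Submodule.span K (L.lat : Set W) = (Submodule.span K (L₀.lat : Set V)).map f := by
  rw [hL.1, Submodule.map_span]
  rfl

lemma map_lat_comm (hL : Carries f L₀ L) (hcomm : ∀ v, f' (h v) = k (f v)) :
    L.lat.map (k.restrictScalars A) =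
      (L₀.lat.map (h.restrictScalars A)).map (f'.restrictScalars A) := by
  rw [hL.1, ← Submodule.map_comp, ← Submodule.map_comp]
  congr 1
  exact LinearMap.ext fun v => (hcomm v).symm

/-- Transport of an isomorphism of labelled modules along injective maps. -/
lemma carries_iff_of_comm (hL : Carries f L₀ L) (hL' : Carries f' L₀' L')
    (hf' : Function.Injective f') (hcomm : ∀ v, f' (h v) = k (f v)) :
    Carries k L L' ↔ Carries h L₀ L₀' := by
  have hmap := map_lat_comm (A := A) hL hcomm
  constructor
  · rintro ⟨h1, h2⟩
    refine ⟨?_, fun t v hv => ?_⟩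
    · rw [hmap, hL'.1] at h1
      exact Submodule.map_injective_of_injective (f := f'.restrictScalars A) hf' h1
    · rw [← hL'.maps_iff hf', hcomm]
      exact h2 _ _ (hL.2 _ _ hv)
  · rintro ⟨h1, h2⟩
    have h3 : L'.lat = L.lat.map (k.restrictScalars A) := by rw [hmap, hL'.1, h1]
    refine ⟨h3, fun t w hw => ?_⟩
    obtain ⟨v, hv⟩ := L₀.exists_maps t
    have h4 := hL'.2 _ _ (h2 _ _ hv)
    rw [hcomm] at h4
    rw [h4.iff_sub_mem, ← map_sub, h3]
    exact ⟨_, (hL.2 _ _ hv).iff_sub_mem.1 hw, rfl⟩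

/-- Transport of a commensurability of labelled modules along injective maps. -/
lemma commVia_iff_of_comm (hL : Carries f L₀ L) (hL' : Carries f' L₀' L')
    (hf' : Function.Injective f') (hcomm : ∀ v, f' (h v) = k (f v)) :
    CommVia k L L' ↔ CommVia h L₀ L₀' := by
  have hmap := map_lat_comm (A := A) hL hcomm
  have hspan : Submodule.span K (L.lat.map (k.restrictScalars A) : Set W') =
      (Submodule.span K (L₀.lat.map (h.restrictScalars A) : Set V')).map f' := by
    rw [hmap, Submodule.map_span]
    rfl
  have hsup : L.lat.map (k.restrictScalars A) ⊔ L'.lat =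
      (L₀.lat.map (h.restrictScalars A) ⊔ L₀'.lat).map (f'.restrictScalars A) := by
    rw [hmap, hL'.1, Submodule.map_sup]
  constructor
  · rintro ⟨h1, h2⟩
    refine ⟨?_, fun t v v' hv hv' => ?_⟩
    · rw [hspan, hL'.span_eq] at h1
      exact Submodule.map_injective_of_injective hf' h1
    · have h3 := h2 _ _ _ (hL.2 _ _ hv) (hL'.2 _ _ hv')
      rw [hsup, ← hcomm, ← map_sub] at h3
      exact hf'.mem_set_image.1 h3
  · rintro ⟨h1, h2⟩
    refine ⟨by rw [hspan, hL'.span_eq, h1], fun t w w' hw hw' => ?_⟩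
    obtain ⟨v, hv⟩ := L₀.exists_maps t
    obtain ⟨v', hv'⟩ := L₀'.exists_maps t
    have h3 : f' (h v - v') ∈ L.lat.map (k.restrictScalars A) ⊔ L'.lat := by
      rw [hsup]
      exact ⟨_, h2 _ _ _ hv hv', rfl⟩
    have h4 : k (f v - w) ∈ L.lat.map (k.restrictScalars A) :=
      ⟨_, (hL.2 _ _ hv).iff_sub_mem.1 hw, rfl⟩
    have h5 := (hL'.2 _ _ hv').iff_sub_mem.1 hw'
    have h6 : k w - w' = f' (h v - v') + ((f' v' - w') - k (f v - w)) := by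
      rw [map_sub, map_sub, hcomm]
      abel
    rw [h6]
    exact add_mem h3 (sub_mem (Submodule.mem_sup_right h5) (Submodule.mem_sup_left h4))

end Transport

section Period

variable {K : Type*} [Field K] {pl : ValuationSubring K} [IsDiscreteValuationRing pl] {n : ℕ}

lemma iotaMap_apply (ω : OmegaTilde K pl n) (x : Fin n → K) :
    iotaMap ω x = ∑ i, x i • ω.1 i := rfl

lemma iotaMap_injective (ω : OmegaTilde K pl n) : Function.Injective (iotaMap ω) := by
  refine linearIndependent_iff_injective_fintypeLinearCombination.1
    (ω.2.restrict_scalars ?_)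
  intro x y hxy
  simpa [Algebra.smul_def] using hxy

lemma iotaMap_rowMul (ω : OmegaTilde K pl n) (γ : GL (Fin n) K) (x : Fin n → K) :
    iotaMap ω (rowMul γ x) = ∑ i, x i • actVec γ ω.1 i := by
  rw [iotaMap_apply]
  simp only [actVec, Matrix.vecMulLinear_apply, Matrix.vecMul, dotProduct, Finset.sum_smul,
    Finset.smul_sum, mul_smul]
  exact Finset.sum_comm

lemma iotaMap_comm_iff {ω ω' : OmegaTilde K pl n} {γ : GL (Fin n) K} {c : (Cinf K pl)ˣ} :
    (∀ x, iotaMap ω' (rowMul γ x) = scale pl c (iotaMap ω x)) ↔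
      actVec γ ω'.1 = (c : Cinf K pl) • ω.1 := by
  have h : ∀ x, scale pl c (iotaMap ω x) = ∑ i, x i • ((c : Cinf K pl) • ω.1) i := by
    intro x
    rw [iotaMap_apply, map_sum]
    refine Finset.sum_congr rfl fun i _ => ?_
    rw [map_smul]
    rfl
  constructor
  · intro hx
    funext i
    have := hx (Pi.single i 1)
    rw [iotaMap_rowMul, h] at this
    simpa [Pi.single_apply, ite_smul] using this
  · intro hx x
    rw [iotaMap_rowMul, h, hx]

lemma mk_eq_omegaAct_inv_iff {ω ω' : OmegaTilde K pl n} {γ : GL (Fin n) K} :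
    (⟦ω'⟧ : Omega K pl n) = omegaAct γ⁻¹ ⟦ω⟧ ↔
      ∃ c : (Cinf K pl)ˣ, actVec γ ω'.1 = (c : Cinf K pl) • ω.1 := by
  have h1 : (⟦ω'⟧ : Omega K pl n) = omegaAct γ⁻¹ ⟦ω⟧ ↔
      (⟦ω⟧ : Omega K pl n) = omegaAct γ ⟦ω'⟧ := by
    constructor
    · intro h
      rw [h, ← omegaAct_mul, mul_inv_cancel, omegaAct_one]
    · intro h
      rw [h, ← omegaAct_mul, inv_mul_cancel, omegaAct_one]
  rw [h1]
  exact Quotient.eq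

/-- A homothety carrying the `K`-span of one period tuple to another is given by a matrix. -/
lemma exists_GL_of_range_eq {ω ω' : OmegaTilde K pl n} {c : (Cinf K pl)ˣ}
    (h : (LinearMap.range (iotaMap ω)).map (scale pl c) = LinearMap.range (iotaMap ω')) :
    ∃ γ : GL (Fin n) K, ∀ x, iotaMap ω' (rowMul γ x) = scale pl c (iotaMap ω x) := by
  have hinj : Function.Injective (scale pl c ∘ₗ iotaMap ω) :=
    (mul_right_injective₀ c.ne_zero).comp (iotaMap_injective ω)
  rw [← LinearMap.range_comp] at h
  let e := (LinearEquiv.ofInjective _ hinj).trans ((LinearEquiv.ofEq _ _ h).trans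
    (LinearEquiv.ofInjective _ (iotaMap_injective ω')).symm)
  obtain ⟨γ, hγ⟩ := exists_GL_of_linearEquiv e
  refine ⟨γ, fun x => ?_⟩
  have h1 : rowMul γ x = e x := hγ x
  rw [h1]
  have h2 := (LinearEquiv.ofInjective _ (iotaMap_injective ω')).apply_symm_apply
    (LinearEquiv.ofEq _ _ h (LinearEquiv.ofInjective _ hinj x))
  exact congrArg Subtype.val h2

end Period

section Discrete

variable {K : Type*} [Field K] {pl : ValuationSubring K} [IsDiscreteValuationRing pl] {n : ℕ}

noncomputable instance : NormedAlgebra (Kinf K pl) (Cinf K pl) where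
  norm_smul_le r x := by
    rw [Algebra.smul_def, IsScalarTower.algebraMap_apply (Kinf K pl) (KinfBar K pl) (Cinf K pl),
      norm_mul, norm_algebraMap', norm_algebraMap']

variable {A : Type*} [CommRing A] [Algebra A K]

lemma discreteTopology_of_norm {Λ : Submodule A (Cinf K pl)} {ε : ℝ} (hε : 0 < ε)
    (h : ∀ x ∈ Λ, ‖x‖ < ε → x = 0) : DiscreteTopology Λ := by
  have : DiscreteTopology Λ.toAddSubgroup := by
    refine discreteTopology_of_isOpen_singleton_zero ?_
    rw [Metric.isOpen_singleton_iff]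
    refine ⟨ε, hε, fun y hy => ?_⟩
    rw [dist_zero_right] at hy
    exact Subtype.ext (h y y.2 hy)
  exact this

variable {Fq : Type*} [Field Fq] [Algebra Fq K]

/-- The image of a lattice of `K^n` under a period map is discrete. -/
lemma discreteTopology_map_iotaMap [Finite Fq] [IsDedekindDomain A] [IsFractionRing A K]
    (hK : IsFunctionField Fq K)
    (hA : ∀ x : K, x ∈ Set.range (algebraMap A K) ↔
      ∀ v : ValuationSubring K, IsDiscreteValuationRing v → v ≠ pl → x ∈ v)
    (ω : OmegaTilde K pl n) {Λ : Submodule A (Fin n → K)} (hΛ : Λ.FG) :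
    DiscreteTopology (Λ.map ((iotaMap ω).restrictScalars A)) := by
  obtain ⟨d, hd, hΛ⟩ := exists_smul_mem_stdLattice hΛ
  let F : (Fin n → Kinf K pl) →ₗ[Kinf K pl] Cinf K pl := Fintype.linearCombination (Kinf K pl) ω.1
  have hF : LinearMap.ker F = ⊥ :=
    LinearMap.ker_eq_bot.2 (linearIndependent_iff_injective_fintypeLinearCombination.1 ω.2)
  obtain ⟨B, hB0, hB⟩ := F.exists_antilipschitzWith hF
  have hd0 : algebraMap K (Kinf K pl) (algebraMap A K d) ≠ 0 := by simpa using hd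
  set N := ‖algebraMap K (Kinf K pl) (algebraMap A K d)‖ with hN
  have hN0 : 0 < N := norm_pos_iff.2 hd0
  have hB0' : (0 : ℝ) < B := hB0
  refine discreteTopology_of_norm (ε := (N * B)⁻¹) (by positivity) ?_
  rintro _ ⟨x, hx, rfl⟩ hlt
  suffices x = 0 by rw [this, map_zero]
  have hFx : (iotaMap ω).restrictScalars A x = F fun i => algebraMap K (Kinf K pl) (x i) := by
    change ∑ i, x i • ω.1 i = ∑ i, algebraMap K (Kinf K pl) (x i) • ω.1 i
    simp
  funext i
  obtain ⟨a, ha⟩ := mem_stdLattice.1 (hΛ x hx) i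
  have h1 : ‖algebraMap K (Kinf K pl) (algebraMap A K a)‖ < 1 := by
    rw [ha, Pi.smul_apply, Algebra.smul_def, map_mul, norm_mul, ← hN]
    have h2 := hB.le_mul_dist (fun i => algebraMap K (Kinf K pl) (x i)) 0
    rw [dist_zero_right, map_zero, dist_zero_right, ← hFx] at h2
    have h3 := (norm_le_pi_norm (fun i => algebraMap K (Kinf K pl) (x i)) i).trans h2
    calc N * ‖algebraMap K (Kinf K pl) (x i)‖ ≤ N * (B * ‖(iotaMap ω).restrictScalars A x‖) := by
          gcongr
      _ = N * B * ‖(iotaMap ω).restrictScalars A x‖ := by ring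
      _ < N * B * (N * B)⁻¹ := by gcongr
      _ = 1 := mul_inv_cancel₀ (by positivity)
  have h4 := eq_zero_of_norm_lt_one hK hA h1
  rw [ha, Pi.smul_apply, smul_eq_zero] at h4
  exact h4.resolve_left hd

lemma IsFunctionField.infinite_of_isFractionRing [IsDomain A] [IsFractionRing A K]
    (hK : IsFunctionField Fq K) : Infinite A := by
  by_contra h
  rw [not_infinite_iff_finite] at h
  have : Finite K := Finite.of_surjective (fun p : A × A => algebraMap A K p.1 / algebraMap A K p.2)
    fun z => by
      obtain ⟨a, b, -, h⟩ := IsFractionRing.div_surjective (A := A) z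
      exact ⟨(a, b), h⟩
  obtain ⟨T, hT, -⟩ := hK.exists_finite
  exact hT (Algebra.IsAlgebraic.isAlgebraic T)

/-- In a discrete submodule of `C_∞`, linear independence over `K` implies linear independence
over the completion. -/
lemma linearIndependent_of_discrete [Finite Fq] [IsDomain A] [IsFractionRing A K]
    (hK : IsFunctionField Fq K)
    (hA : ∀ x : K, x ∈ Set.range (algebraMap A K) ↔
      ∀ v : ValuationSubring K, IsDiscreteValuationRing v → v ≠ pl → x ∈ v)
    {Λ : Submodule A (Cinf K pl)} [hΛ : DiscreteTopology Λ] {ω : Fin n → Cinf K pl}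
    (hω : ∀ i, ω i ∈ Λ) (hli : LinearIndependent K ω) : LinearIndependent (Kinf K pl) ω := by
  have := hK.properSpace pl
  have := hK.infinite_of_isFractionRing (A := A)
  obtain ⟨C, hC⟩ := exists_norm_sub_le (pl := pl) hK hA
  by_contra hdep
  rw [Fintype.not_linearIndependent_iff] at hdep
  obtain ⟨c, hc, j, hj⟩ := hdep
  let c' : Fin n → Kinf K pl := fun i => (c j)⁻¹ * c i
  have hc'j : c' j = 1 := inv_mul_cancel₀ hj
  have hc' : ∑ i, c' i • ω i = 0 := by
    simp only [c', mul_smul]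
    rw [← Finset.smul_sum, hc, smul_zero]
  let T : Set (Cinf K pl) :=
    (fun e : Fin n → Kinf K pl => ∑ i, e i • ω i) '' Metric.closedBall 0 (max C 0)
  have hT : IsCompact T := (isCompact_closedBall _ _).image (by fun_prop)
  have hdisc : DiscreteTopology Λ.toAddSubgroup := hΛ
  have hclosed : IsClosed (Λ : Set (Cinf K pl)) := Λ.toAddSubgroup.isClosed_of_discrete
  have hfin : (T ∩ Λ).Finite :=
    (hT.inter_right hclosed).finite ⟨DiscreteTopology.of_subset hdisc Set.inter_subset_right⟩
  have hb : ∀ a : A, ∃ b : Fin n → A, b j = a ∧ ∑ i, b i • ω i ∈ T ∩ Λ := by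
    intro a
    have : ∀ i, ∃ b : A, (i = j → b = a) ∧
        ‖algebraMap K (Kinf K pl) (algebraMap A K b) -
          algebraMap K (Kinf K pl) (algebraMap A K a) * c' i‖ ≤ max C 0 := by
      intro i
      by_cases hij : i = j
      · refine ⟨a, fun _ => rfl, ?_⟩
        rw [hij, hc'j, mul_one, sub_self, norm_zero]
        exact le_max_right _ _
      · obtain ⟨b, hb⟩ := hC (algebraMap K (Kinf K pl) (algebraMap A K a) * c' i)
        refine ⟨b, fun h => absurd h hij, ?_⟩
        rw [norm_sub_rev]
        exact hb.trans (le_max_left _ _)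
    choose b hbj hb using this
    refine ⟨b, hbj j rfl, ⟨_, mem_closedBall_zero_iff.2
      ((pi_norm_le_iff_of_nonneg (le_max_right _ _)).2 hb), ?_⟩,
      sum_mem fun i _ => Λ.smul_mem _ (hω i)⟩
    simp only [sub_smul, mul_smul, Finset.sum_sub_distrib]
    rw [← Finset.smul_sum, hc', smul_zero, sub_zero]
    simp
  choose b hbj hb using hb
  have := hfin.to_subtype
  obtain ⟨a, a', hne, heq⟩ := Finite.exists_ne_map_eq_of_infinite
    fun a => (⟨_, hb a⟩ : (T ∩ Λ : Set (Cinf K pl)))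
  refine hne ?_
  have h0 : ∑ i, (algebraMap A K (b a i) - algebraMap A K (b a' i)) • ω i = 0 := by
    simp only [sub_smul, Finset.sum_sub_distrib, algebraMap_smul]
    exact sub_eq_zero.2 (congrArg Subtype.val heq)
  have h1 := Fintype.linearIndependent_iff.1 hli _ h0 j
  rw [hbj, hbj, sub_eq_zero] at h1
  exact IsFractionRing.injective A K h1

end Discrete

lemma exists_fin_linearIndependent {k V : Type*} [Field k] [AddCommGroup V] [Module k V]
    {b : Set V} (hfin : b.Finite) (hli : LinearIndependent k ((↑) : b → V)) :
    ∃ (m : ℕ) (v : Fin m → V), LinearIndependent k v ∧ Set.range v = b := by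
  let _ := hfin.fintype
  let e := (Fintype.equivFin b).symm
  refine ⟨Fintype.card b, Subtype.val ∘ e, hli.comp e e.injective, ?_⟩
  rw [e.surjective.range_comp, Subtype.range_coe]

section CLattices

open IsDedekindDomain

variable {Fq K A : Type*} [Field Fq] [Finite Fq] [Field K] [Algebra Fq K]
  {pl : ValuationSubring K} [IsDiscreteValuationRing pl]
  [CommRing A] [IsDedekindDomain A] [Algebra A K] [IsFractionRing A K] {n : ℕ}

omit [Field Fq] [Finite Fq] [Algebra Fq K] in
lemma range_iotaMap (ω : OmegaTilde K pl n) :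
    LinearMap.range (iotaMap ω) = Submodule.span K (Set.range ω.1) :=
  Fintype.range_linearCombination K (v := ω.1)

/-- A `C_∞`-lattice has a period tuple. -/
lemma exists_omegaTilde (hK : IsFunctionField Fq K)
    (hA : ∀ x : K, x ∈ Set.range (algebraMap A K) ↔
      ∀ v : ValuationSubring K, IsDiscreteValuationRing v → v ≠ pl → x ∈ v)
    {Λ : Submodule A (Cinf K pl)} (hfg : Λ.FG) (hdisc : DiscreteTopology Λ)
    (hrank : Module.finrank (Kinf K pl)
      (Submodule.span (Kinf K pl) (Λ : Set (Cinf K pl))) = n) :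
    ∃ ω : OmegaTilde K pl n, (∀ i, ω.1 i ∈ Λ) ∧
      LinearMap.range (iotaMap ω) = Submodule.span K (Λ : Set (Cinf K pl)) := by
  obtain ⟨S, hS⟩ := hfg
  obtain ⟨b, hbS, hspan, hli⟩ := exists_linearIndependent K (S : Set (Cinf K pl))
  have hfin : b.Finite := S.finite_toSet.subset hbS
  have hspanΛ : Submodule.span K b = Submodule.span K (Λ : Set (Cinf K pl)) := by
    rw [hspan, ← hS, Submodule.span_span_of_tower]
  obtain ⟨m, v, hv, hrange⟩ := exists_fin_linearIndependent hfin hli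
  have hvΛ : ∀ i, v i ∈ Λ := fun i => by
    rw [← hS]
    exact Submodule.subset_span (hbS (hrange.subset (Set.mem_range_self i)))
  have hliv := linearIndependent_of_discrete hK hA hvΛ hv
  obtain rfl : m = n := by
    rw [← hrank, ← Submodule.span_span_of_tower K (Kinf K pl) (Λ : Set (Cinf K pl)), ← hspanΛ,
      Submodule.span_span_of_tower, ← hrange, finrank_span_eq_card hliv, Fintype.card_fin]
  exact ⟨⟨v, hliv⟩, hvΛ, (range_iotaMap _).trans (by rw [← hspanΛ, ← hrange])⟩

lemma exists_representsC_of_lattice (hK : IsFunctionField Fq K)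
    (hA : ∀ x : K, x ∈ Set.range (algebraMap A K) ↔
      ∀ v : ValuationSubring K, IsDiscreteValuationRing v → v ≠ pl → x ∈ v)
    (L : CLattice A K n pl) :
    ∃ (g : GL (Fin n) (FiniteAdeleRing A K)) (ω : OmegaTilde K pl n)
      (ρ : Matrix (Fin n) (Fin n) (intAdeles A K)), RepresentsC g ω ρ L.1 := by
  obtain ⟨L, hfg, hdisc, hrank⟩ := L
  obtain ⟨ω, hω, hrange⟩ := exists_omegaTilde hK hA hfg hdisc hrank
  have hspan : Submodule.span K
      (L.lat.comap ((iotaMap ω).restrictScalars A) : Set (Fin n → K)) = ⊤ := by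
    refine span_eq_top_of_single_mem one_ne_zero fun i => ?_
    rw [one_smul]
    change iotaMap ω (Pi.single i 1) ∈ L.lat
    rw [iotaMap_apply]
    simpa [Pi.single_apply, ite_smul] using hω i
  obtain ⟨L₀, hlat, hL₀⟩ := exists_carries_comap (f := iotaMap ω) L
    (by rw [hrange]; exact Submodule.subset_span) hspan
  rw [← hlat] at hspan
  have hlattice : Submodule.IsLattice K L₀.lat :=
    ⟨Submodule.fg_of_fg_map_injective ((iotaMap ω).restrictScalars A) (iotaMap_injective ω)
      (by rw [← hL₀.1]; exact hfg), hspan⟩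
  obtain ⟨g, ρ, h⟩ := exists_represents_of_lattice ⟨L₀, hlattice⟩
  exact ⟨g, ω, ρ, L₀, h, hL₀⟩

omit [Field Fq] [Finite Fq] [Algebra Fq K] in
lemma Represents.isLattice {g : GL (Fin n) (FiniteAdeleRing A K)}
    {ρ : Matrix (Fin n) (Fin n) (intAdeles A K)} {L : LabelledModule A K (Fin n → K) n}
    (h : Represents g ρ L) : Submodule.IsLattice K L.lat := by
  have : L.lat = adelicLattice g := Submodule.ext h.1
  rw [this]
  exact isLattice_adelicLattice g

omit [Field Fq] [Finite Fq] [Algebra Fq K]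
  [IsDedekindDomain A] [IsFractionRing A K] in
lemma Carries.span_eq_range {ω : OmegaTilde K pl n} {L₀ : LabelledModule A K (Fin n → K) n}
    {L : LabelledModule A K (Cinf K pl) n} (h : Carries (iotaMap ω) L₀ L)
    (hL₀ : Submodule.IsLattice K L₀.lat) :
    Submodule.span K (L.lat : Set (Cinf K pl)) = LinearMap.range (iotaMap ω) := by
  rw [h.span_eq, hL₀.span_eq_top, Submodule.map_top]

lemma exists_representsC (hK : IsFunctionField Fq K)
    (hA : ∀ x : K, x ∈ Set.range (algebraMap A K) ↔
      ∀ v : ValuationSubring K, IsDiscreteValuationRing v → v ≠ pl → x ∈ v)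
    (g : GL (Fin n) (FiniteAdeleRing A K)) (ω : OmegaTilde K pl n)
    (ρ : Matrix (Fin n) (Fin n) (intAdeles A K)) :
    ∃ L : CLattice A K n pl, RepresentsC g ω ρ L.1 := by
  obtain ⟨⟨L₀, hL₀⟩, h⟩ := exists_represents g ρ
  obtain ⟨L, hL⟩ := exists_carries (iotaMap ω) L₀
  refine ⟨⟨L, ?_, ?_, ?_⟩, L₀, h, hL⟩
  · rw [hL.1]
    exact hL₀.fg.map _
  · rw [hL.1]
    exact discreteTopology_map_iotaMap hK hA ω hL₀.fg
  · rw [← Submodule.span_span_of_tower K (Kinf K pl), hL.span_eq_range hL₀, range_iotaMap,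
      Submodule.span_span_of_tower, finrank_span_eq_card ω.2, Fintype.card_fin]

variable {g g' : GL (Fin n) (FiniteAdeleRing A K)} {ω ω' : OmegaTilde K pl n}
  {ρ ρ' : Matrix (Fin n) (Fin n) (intAdeles A K)} {L L' : LabelledModule A K (Cinf K pl) n}

omit [Field Fq] [Finite Fq] [Algebra Fq K] in
lemma RepresentsC.exists_carries_iff (h : RepresentsC g ω ρ L) (h' : RepresentsC g' ω' ρ' L') :
    (∃ c, Carries (scale pl c) L L') ↔ ∃ (γ : GL (Fin n) K) (m : GL (Fin n) (intAdeles A K)),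
      g' = diagGL γ * g * inclGL m ∧ (⟦ω'⟧ : Omega K pl n) = omegaAct γ ⟦ω⟧ ∧
        ρ' = ρ * m.val := by
  obtain ⟨L₀, hg, hL⟩ := h
  obtain ⟨L₀', hg', hL'⟩ := h'
  constructor
  · rintro ⟨c, hc⟩
    obtain ⟨γ, hγ⟩ := exists_GL_of_range_eq (ω := ω) (ω' := ω') (c := c) (by
      rw [← hL.span_eq_range hg.isLattice, ← hL'.span_eq_range hg'.isLattice, hc.span_eq])
    have h1 := (hg.carries_iff hg' γ).1
      ((carries_iff_of_comm hL hL' (iotaMap_injective ω') hγ).1 hc)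
    obtain ⟨m, hm, hm'⟩ := (exists_inclGL_iff (g := g) (g' := g') (ρ := ρ) (ρ' := ρ')
      (γ := γ⁻¹)).2 ⟨h1.1, by rw [diagGL_inv, inv_inv]; exact h1.2⟩
    exact ⟨γ⁻¹, m, hm, mk_eq_omegaAct_inv_iff.2 ⟨c, iotaMap_comm_iff.1 hγ⟩, hm'⟩
  · rintro ⟨γ, m, hm, hz, hm'⟩
    rw [← inv_inv γ] at hz
    obtain ⟨c, hc⟩ := mk_eq_omegaAct_inv_iff.1 hz
    refine ⟨c, (carries_iff_of_comm hL hL' (iotaMap_injective ω') (iotaMap_comm_iff.2 hc)).2 ?_⟩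
    rw [hg.carries_iff hg', inv_inv, diagGL_inv]
    exact exists_inclGL_iff.1 ⟨m, hm, hm'⟩

omit [Field Fq] [Finite Fq] [Algebra Fq K] in
lemma RepresentsC.exists_commVia_iff (h : RepresentsC g ω ρ L) (h' : RepresentsC g' ω' ρ' L') :
    (∃ c, CommVia (scale pl c) L L') ↔ ∃ γ : GL (Fin n) K,
      rhoInv g' ρ' = rhoInv g ρ * ((diagGL γ)⁻¹ : GL (Fin n) (FiniteAdeleRing A K)).val ∧
        (⟦ω'⟧ : Omega K pl n) = omegaAct γ ⟦ω⟧ := by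
  obtain ⟨L₀, hg, hL⟩ := h
  obtain ⟨L₀', hg', hL'⟩ := h'
  constructor
  · rintro ⟨c, hc⟩
    obtain ⟨γ, hγ⟩ := exists_GL_of_range_eq (ω := ω) (ω' := ω') (c := c) (by
      rw [← hL.span_eq_range hg.isLattice, ← hL'.span_eq_range hg'.isLattice, ← hc.1,
        Submodule.map_span]
      rfl)
    refine ⟨γ⁻¹, ?_, mk_eq_omegaAct_inv_iff.2 ⟨c, iotaMap_comm_iff.1 hγ⟩⟩
    rw [diagGL_inv, inv_inv]
    exact (hg.commVia_iff hg' hg.isLattice hg'.isLattice γ).1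
      ((commVia_iff_of_comm hL hL' (iotaMap_injective ω') hγ).1 hc)
  · rintro ⟨γ, hu, hz⟩
    rw [← inv_inv γ] at hz
    obtain ⟨c, hc⟩ := mk_eq_omegaAct_inv_iff.1 hz
    refine ⟨c, (commVia_iff_of_comm hL hL' (iotaMap_injective ω') (iotaMap_comm_iff.2 hc)).2 ?_⟩
    rw [hg.commVia_iff hg' hg.isLattice hg'.isLattice, diagGL_inv]
    exact hu

omit [Field Fq] [Finite Fq] [Algebra Fq K] in
lemma Upsilon_surjective : Function.Surjective (Upsilon A K n pl) := by
  intro z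
  induction z using Quotient.inductionOn with | h u =>
  obtain ⟨g, ρ, h⟩ := exists_rhoInv_eq u.1
  exact ⟨⟦(g, u.2, ρ)⟧, congrArg (Quotient.mk _) (Prod.ext h rfl)⟩

theorem cLattice_classification (hK : IsFunctionField Fq K)
    (hA : ∀ x : K, x ∈ Set.range (algebraMap A K) ↔
      ∀ v : ValuationSubring K, IsDiscreteValuationRing v → v ≠ pl → x ∈ v) :
    Equivalence (CComm (A := A) (K := K) (n := n) (pl := pl)) ∧
      ∃ p : DoubleQuotC A K n pl ≃ CClass A K n pl,
        (∀ g (ω : OmegaTilde K pl n) ρ, ∃ L : CLattice A K n pl,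
          RepresentsC g ω ρ L.1 ∧ p ⟦(g, ⟦ω⟧, ρ)⟧ = ⟦L⟧) ∧
        ∃ e : CCommClass A K n pl ≃ MatQuotC A K n pl,
          ∀ d, e (Quot.mk _ (p d)) = Upsilon A K n pl d := by
  obtain ⟨p, hp⟩ := exists_quotient_equiv
    (fun (x : GL (Fin n) (FiniteAdeleRing A K) × Omega K pl n ×
        Matrix (Fin n) (Fin n) (intAdeles A K)) (L : CLattice A K n pl) =>
      ∃ ω : OmegaTilde K pl n, ⟦ω⟧ = x.2.1 ∧ RepresentsC x.1 ω x.2.2 L.1)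
    (fun x => by
      obtain ⟨ω, hω⟩ := Quotient.exists_rep x.2.1
      obtain ⟨L, hL⟩ := exists_representsC hK hA x.1 ω x.2.2
      exact ⟨L, ω, hω, hL⟩)
    (fun L => by
      obtain ⟨g, ω, ρ, h⟩ := exists_representsC_of_lattice hK hA L
      exact ⟨(g, ⟦ω⟧, ρ), ω, rfl, h⟩)
    (by
      rintro ⟨g, z, ρ⟩ ⟨g', z', ρ'⟩ L L' ⟨ω, rfl, h⟩ ⟨ω', rfl, h'⟩
      exact (h.exists_carries_iff h').symm)
  have hp' : ∀ (g : GL (Fin n) (FiniteAdeleRing A K)) (ω : OmegaTilde K pl n)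
      (ρ : Matrix (Fin n) (Fin n) (intAdeles A K)) (L : CLattice A K n pl),
      RepresentsC g ω ρ L.1 → p ⟦(g, ⟦ω⟧, ρ)⟧ = ⟦L⟧ := fun g ω ρ L h => hp _ L ⟨ω, rfl, h⟩
  have hcomm : ∀ a b, CComm (p a) (p b) ↔ Upsilon A K n pl a = Upsilon A K n pl b := by
    intro a b
    constructor
    · rintro ⟨L, L', c, hL, hL', hc⟩
      obtain ⟨g, ω, ρ, h⟩ := exists_representsC_of_lattice hK hA L
      obtain ⟨g', ω', ρ', h'⟩ := exists_representsC_of_lattice hK hA L'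
      have ha : a = ⟦(g, ⟦ω⟧, ρ)⟧ := p.injective (by rw [hp' g ω ρ L h, hL])
      have hb : b = ⟦(g', ⟦ω'⟧, ρ')⟧ := p.injective (by rw [hp' g' ω' ρ' L' h', hL'])
      rw [ha, hb]
      exact Quotient.sound ((h.exists_commVia_iff h').1 ⟨c, hc⟩)
    · intro hab
      induction a using Quotient.inductionOn with | h x =>
      induction b using Quotient.inductionOn with | h x' =>
      obtain ⟨g, z, ρ⟩ := x
      obtain ⟨g', z', ρ'⟩ := x'
      obtain ⟨ω, rfl⟩ := Quotient.exists_rep z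
      obtain ⟨ω', rfl⟩ := Quotient.exists_rep z'
      obtain ⟨L, hL⟩ := exists_representsC hK hA g ω ρ
      obtain ⟨L', hL'⟩ := exists_representsC hK hA g' ω' ρ'
      obtain ⟨c, hc⟩ := (hL.exists_commVia_iff hL').2 (Quotient.exact hab)
      exact ⟨L, L', c, (hp' g ω ρ L hL).symm, (hp' g' ω' ρ' L' hL').symm, hc⟩
  obtain ⟨heq, e, he⟩ := equivalence_and_exists_equiv p _ _ Upsilon_surjective hcomm
  refine ⟨heq, p, fun g ω ρ => ?_, e, he⟩
  obtain ⟨L, hL⟩ := exists_representsC hK hA g ω ρ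
  exact ⟨L, hL, hp' g ω ρ L hL⟩

end CLattices

end RatLat

theorem theorem3p10
    (Fq K A : Type*) [Field Fq] [Finite Fq] [Field K] [Algebra Fq K]
    (hK : RatLat.IsFunctionField Fq K)
    (pl : ValuationSubring K) [IsDiscreteValuationRing pl]
    [CommRing A] [IsDedekindDomain A] [Algebra A K] [IsFractionRing A K]
    (hA : ∀ x : K, x ∈ Set.range (algebraMap A K) ↔
      ∀ v : ValuationSubring K, IsDiscreteValuationRing v → v ≠ pl → x ∈ v)
    (n : ℕ) :
    (Equivalence (RatLat.RationalComm (A := A) (K := K) (n := n)) ∧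
      ∃ p : RatLat.DoubleQuot A K n ≃ RatLat.RationalClass A K n,
        (∀ g ρ, ∃ L : RatLat.RationalLattice A K n,
          RatLat.Represents g ρ L.1 ∧ p ⟦(g, ρ)⟧ = ⟦L⟧) ∧
        ∃ e : RatLat.RationalCommClass A K n ≃ RatLat.MatQuot A K n,
          ∀ d, e (Quot.mk _ (p d)) = RatLat.Theta A K n d) ∧
    (Equivalence (RatLat.CComm (A := A) (K := K) (n := n) (pl := pl)) ∧
      ∃ p : RatLat.DoubleQuotC A K n pl ≃ RatLat.CClass A K n pl,
        (∀ g (ω : RatLat.OmegaTilde K pl n) ρ, ∃ L : RatLat.CLattice A K n pl,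
          RatLat.RepresentsC g ω ρ L.1 ∧ p ⟦(g, ⟦ω⟧, ρ)⟧ = ⟦L⟧) ∧
        ∃ e : RatLat.CCommClass A K n pl ≃ RatLat.MatQuotC A K n pl,
          ∀ d, e (Quot.mk _ (p d)) = RatLat.Upsilon A K n pl d) :=
  ⟨RatLat.rational_classification A K n, RatLat.cLattice_classification hK hA⟩
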